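/- Let $k$ be a field. All algebras are associative and unital, bimodules over $k$-algebras are assumed to be $k$-central, and $A^{\circ}$ denotes the opposite algebra of $A$. For a $k$-algebra $A$, an $A$-coring is an $A$-bimodule $C$ with $A$-bimodule maps $\Delta : C \to C\otimes_A C$ (comultiplication, coassociative) and $\epsilon : C \to A$ (counit) satisfying the counit axioms $(\epsilon\otimes_A C)\Delta = C = (C\otimes_A\epsilon)\Delta$ up to the canonical isomorphisms. A left $C$-comodule is a left $A$-module $M$ with an $A$-linear coaction $M\to C\otimes_A M$ that is coassociative and counital; a morphism of comodules is an $A$-linear map commuting with the coactions. A subcomodule of $M$ is a submodule which is the image of an injective morphism of comodules into $M$. A comodule is simple if it has exactly two subcomodules, and semisimple if it is a direct sum of simple comodules. * The $k$-algebra $A$ is separable if there is an $A$-bimodule map $\theta : A\to A\otimes_k A$ with $\mu\theta = \mathrm{id}_A$, where $\mu$ is the multiplication. * The $A$-coring $C$ is coseparable if there is a morphism of $C$-bicomodules $\pi : C\otimes_A C\to C$ with $\pi\Delta = \mathrm{id}_C$, where $C\otimes_A C$ has the left coaction $\Delta\otimes_A C$ and the right coaction $C\otimes_A\Delta$. * The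 $A$-coring $C$ is semisimple if $C$ is semisimple as a left $C$-comodule and flat as a right $A$-module. * If $C$ is an $A$-coring and $D$ is a $B$-coring, then $C\otimes_k D$ is the $A\otimes_k B$-coring with comultiplication $C\otimes_k D \to (C\otimes_A C)\otimes_k(D\otimes_B D)\cong (C\otimes_k D)\otimes_{A\otimes_k B}(C\otimes_k D)$ given by $\Delta_C\otimes\Delta_D$ and the interchange of the two middle factors, and with counit $\epsilon_C\otimes\epsilon_D$. A field extension $K$ of $k$ is regarded as a $K$-coring with $\Delta(x) = x\otimes 1$ and $\epsilon = \mathrm{id}_K$. * The opposite coring $C^{\circ}$ is the $A^{\circ}$-coring with underlying $k$-module $C$, opposite bimodule structure, comultiplication $C\to C\otimes_A C\cong C^{\circ}\otimes_{A^{\circ}}C^{\circ}$, the last map being $x\otimes y\mapsto y\otimes x$, and counit $\epsilon$. **Theorem.** Let $A$ be a separable algebra over a field $k$ and let $C$ be an $A$-coring. The following conditions are equivalent: (i) $C$ is coseparable; (ii) $C\otimes_k K$ is a semisimple $A\otimes_k K$-coring for every field extension $k\subseteq K$; (iii) $C\otimes_k D$ is a semisimple $A\otimes_k B$-coring for every $k$-algebra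 $B$ and every semisimple $B$-coring $D$; (iv) $C\otimes_k C^{\circ}$ is a semisimple $A\otimes_k A^{\circ}$-coring. -/

import Mathlib

open scoped TensorProduct
open MulOpposite

universe u

namespace Coseparable

/-! ### Bimodules over `k`-algebras -/

/-- An `A`-`B`-bimodule over `k`: a `k`-module with commuting left `A`-action and right
`B`-action (the latter written, as in Mathlib, as an action of `Bᵐᵒᵖ`), both compatible with the
action of `k`.  A left `A`-module is the same thing as a `Bimodule k A k`. -/
structure Bimodule (k A B : Type u) [CommRing k] [Ring A] [Algebra k A] [Ring B] [Algebra k B] where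
  /-- The underlying type. -/
  carrier : Type u
  [addCommGroup : AddCommGroup carrier]
  [moduleBase : Module k carrier]
  [moduleLeft : Module A carrier]
  [moduleRight : Module Bᵐᵒᵖ carrier]
  [towerLeft : IsScalarTower k A carrier]
  [towerRight : IsScalarTower k Bᵐᵒᵖ carrier]
  [smulComm : SMulCommClass A Bᵐᵒᵖ carrier]

namespace Bimodule

section Basic

variable {k A B : Type u} [CommRing k] [Ring A] [Algebra k A] [Ring B] [Algebra k B]

instance : CoeSort (Bimodule k A B) (Type u) := ⟨Bimodule.carrier⟩

attribute [instance 1100] addCommGroup moduleBase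

attribute [instance] moduleLeft moduleRight towerLeft towerRight smulComm

/-- The bimodule defined by two commuting actions by `k`-linear endomorphisms. -/
@[reducible]
def ofActions (Q : Type u) [AddCommGroup Q] [Module k Q] (l : A →ₐ[k] Module.End k Q)
    (r : Bᵐᵒᵖ →ₐ[k] Module.End k Q) (h : ∀ a b x, l a (r b x) = r b (l a x)) :
    Bimodule k A B :=
  letI _iL : Module A Q := Module.compHom Q (l : A →+* Module.End k Q)
  letI _iR : Module Bᵐᵒᵖ Q := Module.compHom Q (r : Bᵐᵒᵖ →+* Module.End k Q)
  haveI _tL : IsScalarTower k A Q := ⟨fun c a x => by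
    change l (c • a) x = c • l a x
    rw [map_smul, LinearMap.smul_apply]⟩
  haveI _tR : IsScalarTower k Bᵐᵒᵖ Q := ⟨fun c b x => by
    change r (c • b) x = c • r b x
    rw [map_smul, LinearMap.smul_apply]⟩
  haveI _sc : SMulCommClass A Bᵐᵒᵖ Q := ⟨fun a b x => h a b x⟩
  { carrier := Q }

/-- The left action of `a : A` on a bimodule, as a `k`-linear map. -/
@[reducible]
def lAct (M : Bimodule k A B) : A →ₐ[k] Module.End k M := Algebra.lsmul k k M

/-- The right action of `b : B` on a bimodule, as a `k`-linear map. -/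
@[reducible]
def rAct (M : Bimodule k A B) : Bᵐᵒᵖ →ₐ[k] Module.End k M := Algebra.lsmul k k M

/-- Homomorphisms of bimodules. -/
structure Hom (M N : Bimodule k A B) where
  /-- The underlying `k`-linear map. -/
  toLin : M →ₗ[k] N
  map_left : ∀ (a : A) (m : M), toLin (a • m) = a • toLin m
  map_right : ∀ (b : B) (m : M), toLin (op b • m) = op b • toLin m

instance (M N : Bimodule k A B) : CoeFun (Hom M N) (fun _ => M → N) := ⟨fun f => f.toLin⟩

/-- The identity homomorphism. -/
def Hom.id (M : Bimodule k A B) : Hom M M := ⟨LinearMap.id, fun _ _ => rfl, fun _ _ => rfl⟩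

/-- The composition `g ∘ f`. -/
def Hom.comp {M N P : Bimodule k A B} (g : Hom N P) (f : Hom M N) : Hom M P where
  toLin := g.toLin ∘ₗ f.toLin
  map_left a m := by
    change g (f (a • m)) = a • g (f m)
    rw [f.map_left, g.map_left]
  map_right b m := by
    change g (f (op b • m)) = op b • g (f m)
    rw [f.map_right, g.map_right]

variable (k A) in
/-- The algebra `A` as an `A`-bimodule. -/
@[reducible]
def regular : Bimodule k A A where
  carrier := A

/-- The left `A`-module (that is, `A`-`k`-bimodule) underlying an `A`-`B`-bimodule. -/
@[reducible]
def toLeft (M : Bimodule k A B) : Bimodule k A k :=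
  ofActions M (lAct M)
    ((Algebra.ofId k (Module.End k M)).comp (AlgEquiv.toOpposite k k).symm.toAlgHom) (by
      intro a c x
      change a • (unop c • x) = unop c • (a • x)
      exact smul_comm a (unop c) x)

/-- The opposite bimodule: an `A`-`B`-bimodule `M` is a `Bᵐᵒᵖ`-`Aᵐᵒᵖ`-bimodule with
`(op b) · m = m · b` and `m · (op a) = a · m`. -/
@[reducible]
def opp (M : Bimodule k A B) : Bimodule k Bᵐᵒᵖ Aᵐᵒᵖ :=
  ofActions M (rAct M) ((lAct M).comp (AlgEquiv.opOp k A).symm.toAlgHom) (by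
    intro b a x
    exact (smul_comm (unop (unop a)) b x).symm)

end Basic

/-! ### The tensor product of bimodules over the middle algebra -/

section Tensor

variable {k A B R S : Type u} [CommRing k] [Ring A] [Algebra k A] [Ring B] [Algebra k B]
  [Ring R] [Algebra k R] [Ring S] [Algebra k S]

/-- The submodule of `M ⊗[k] N` generated by the elements `m b ⊗ n - m ⊗ b n`. -/
def balanced (M : Bimodule k A B) (N : Bimodule k B R) : Submodule k (M ⊗[k] N) :=
  Submodule.span k {t | ∃ (m : M) (b : B) (n : N), t = (op b • m) ⊗ₜ[k] n - m ⊗ₜ[k] (b • n)}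

/-- The tensor product over `B`, as a quotient of the tensor product over `k`. -/
abbrev BalTensor (M : Bimodule k A B) (N : Bimodule k B R) : Type u :=
  (M ⊗[k] N) ⧸ balanced M N

/-- The map `a (m ⊗ n) = a m ⊗ n`. -/
def leftLin (M : Bimodule k A B) (N : Bimodule k B R) (a : A) :
    BalTensor M N →ₗ[k] BalTensor M N :=
  (balanced M N).mapQ (balanced M N) (TensorProduct.map (lAct M a) LinearMap.id) (by
    refine Submodule.span_le.2 ?_
    rintro _ ⟨m, b, n, rfl⟩
    refine Submodule.subset_span ⟨a • m, b, n, ?_⟩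
    simp [smul_comm a (op b) m])

/-- The map `(m ⊗ n) r = m ⊗ n r`. -/
def rightLin (M : Bimodule k A B) (N : Bimodule k B R) (r : Rᵐᵒᵖ) :
    BalTensor M N →ₗ[k] BalTensor M N :=
  (balanced M N).mapQ (balanced M N) (TensorProduct.map LinearMap.id (rAct N r)) (by
    refine Submodule.span_le.2 ?_
    rintro _ ⟨m, b, n, rfl⟩
    refine Submodule.subset_span ⟨m, b, r • n, ?_⟩
    simp [smul_comm b r n])

theorem balTensor_ext {M : Bimodule k A B} {N : Bimodule k B R} {P : Type u} [AddCommGroup P]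
    [Module k P] {f g : BalTensor M N →ₗ[k] P}
    (h : ∀ m n, f ((balanced M N).mkQ (m ⊗ₜ n)) = g ((balanced M N).mkQ (m ⊗ₜ n))) : f = g :=
  Submodule.linearMap_qext _ (TensorProduct.ext' h)

theorem leftLin_mk (M : Bimodule k A B) (N : Bimodule k B R) (a : A) (m : M) (n : N) :
    leftLin M N a ((balanced M N).mkQ (m ⊗ₜ n)) = (balanced M N).mkQ ((a • m) ⊗ₜ n) := rfl

theorem rightLin_mk (M : Bimodule k A B) (N : Bimodule k B R) (r : Rᵐᵒᵖ) (m : M) (n : N) :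
    rightLin M N r ((balanced M N).mkQ (m ⊗ₜ n)) = (balanced M N).mkQ (m ⊗ₜ (r • n)) := rfl

/-- The left action of `A` on the tensor product over `B`. -/
def leftAction (M : Bimodule k A B) (N : Bimodule k B R) :
    A →ₐ[k] Module.End k (BalTensor M N) :=
  AlgHom.ofLinearMap
    { toFun := leftLin M N
      map_add' := fun a a' => balTensor_ext fun m n => by
        simp only [LinearMap.add_apply, leftLin_mk, add_smul, TensorProduct.add_tmul, map_add]
      map_smul' := fun c a => balTensor_ext fun m n => by
        simp only [LinearMap.smul_apply, leftLin_mk, smul_assoc, ← TensorProduct.smul_tmul',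
          map_smul, RingHom.id_apply] }
    (balTensor_ext fun m n => by
      refine (congrArg (balanced M N).mkQ ?_ : (balanced M N).mkQ (((1 : A) • m) ⊗ₜ n)
        = (balanced M N).mkQ (m ⊗ₜ n))
      rw [one_smul])
    (fun a a' => balTensor_ext fun m n => by
      refine (congrArg (balanced M N).mkQ ?_ : (balanced M N).mkQ (((a * a') • m) ⊗ₜ n)
        = (balanced M N).mkQ ((a • a' • m) ⊗ₜ n))
      rw [mul_smul])

/-- The right action of `R` on the tensor product over `B`. -/
def rightAction (M : Bimodule k A B) (N : Bimodule k B R) :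
    Rᵐᵒᵖ →ₐ[k] Module.End k (BalTensor M N) :=
  AlgHom.ofLinearMap
    { toFun := rightLin M N
      map_add' := fun a a' => balTensor_ext fun m n => by
        simp only [LinearMap.add_apply, rightLin_mk, add_smul, TensorProduct.tmul_add, map_add]
      map_smul' := fun c a => balTensor_ext fun m n => by
        simp only [LinearMap.smul_apply, rightLin_mk, smul_assoc, TensorProduct.tmul_smul,
          map_smul, RingHom.id_apply] }
    (balTensor_ext fun m n => by
      refine (congrArg (balanced M N).mkQ ?_ : (balanced M N).mkQ (m ⊗ₜ ((1 : Rᵐᵒᵖ) • n))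
        = (balanced M N).mkQ (m ⊗ₜ n))
      rw [one_smul])
    (fun a a' => balTensor_ext fun m n => by
      refine (congrArg (balanced M N).mkQ ?_ : (balanced M N).mkQ (m ⊗ₜ ((a * a') • n))
        = (balanced M N).mkQ (m ⊗ₜ (a • a' • n)))
      rw [mul_smul])

/-- The tensor product `M ⊗_B N` of an `A`-`B`-bimodule and a `B`-`R`-bimodule, as an
`A`-`R`-bimodule: `a (m ⊗ n) r = a m ⊗ n r`. -/
def tensor (M : Bimodule k A B) (N : Bimodule k B R) : Bimodule k A R :=
  ofActions (BalTensor M N) (leftAction M N) (rightAction M N)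
    (fun a r => LinearMap.congr_fun (balTensor_ext
      (f := (leftLin M N a) ∘ₗ (rightLin M N r))
      (g := (rightLin M N r) ∘ₗ (leftLin M N a)) fun _ _ => rfl :
        (leftLin M N a) ∘ₗ (rightLin M N r) = (rightLin M N r) ∘ₗ (leftLin M N a)))

/-- The bilinear map `(m, n) ↦ m ⊗ n`. -/
def tmulBilin (M : Bimodule k A B) (N : Bimodule k B R) : M →ₗ[k] N →ₗ[k] M.tensor N :=
  (TensorProduct.mk k M N).compr₂ (balanced M N).mkQ

/-- The pure tensor `m ⊗ n` over `B`. -/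
def tmul {M : Bimodule k A B} {N : Bimodule k B R} (m : M) (n : N) : M.tensor N :=
  tmulBilin M N m n

section API

variable {M : Bimodule k A B} {N : Bimodule k B R}

theorem tmulBilin_apply (m : M) (n : N) : tmulBilin M N m n = tmul m n := rfl

theorem left_smul_tmul (a : A) (m : M) (n : N) : a • tmul m n = tmul (a • m) n := rfl

theorem right_smul_tmul (r : Rᵐᵒᵖ) (m : M) (n : N) : r • tmul m n = tmul m (r • n) := rfl

theorem smul_tmul (m : M) (b : B) (n : N) : tmul (op b • m) n = tmul m (b • n) := by
  have h : (balanced M N).mkQ ((op b • m) ⊗ₜ[k] n - m ⊗ₜ[k] (b • n)) = 0 :=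
    (Submodule.Quotient.mk_eq_zero _).2 (Submodule.subset_span ⟨m, b, n, rfl⟩)
  rw [map_sub, sub_eq_zero] at h
  exact h

/-- Two `k`-linear maps that agree on pure tensors are equal. -/
theorem tensor_ext {P : Type u} [AddCommGroup P] [Module k P] {f g : M.tensor N →ₗ[k] P}
    (h : ∀ m n, f (tmul m n) = g (tmul m n)) : f = g :=
  balTensor_ext h

/-- The `k`-linear map out of `M ⊗_B N` induced by a balanced bilinear map. -/
def lift {P : Type u} [AddCommGroup P] [Module k P]
    (f : M →ₗ[k] N →ₗ[k] P) (h : ∀ (m : M) (b : B) (n : N), f (op b • m) n = f m (b • n)) :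
    M.tensor N →ₗ[k] P :=
  (balanced M N).liftQ (TensorProduct.lift f) (by
    refine Submodule.span_le.2 ?_
    rintro _ ⟨m, b, n, rfl⟩
    simp [h])

theorem lift_tmul {P : Type u} [AddCommGroup P] [Module k P] (f : M →ₗ[k] N →ₗ[k] P)
    (h : ∀ (m : M) (b : B) (n : N), f (op b • m) n = f m (b • n)) (m : M) (n : N) :
    lift f h (tmul m n) = f m n := rfl

variable {M' : Bimodule k A B} {N' : Bimodule k B R}

/-- The `k`-linear map `f ⊗_B g`. -/
def mapLin (f : Hom M M') (g : Hom N N') : M.tensor N →ₗ[k] M'.tensor N' :=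
  lift ((tmulBilin M' N').compl₁₂ f.toLin g.toLin) (by
    intro m b n
    change tmul (f (op b • m)) (g n) = tmul (f m) (g (b • n))
    rw [f.map_right, g.map_left, smul_tmul])

/-- The tensor product `f ⊗_B g` of two bimodule homomorphisms. -/
def map (f : Hom M M') (g : Hom N N') : Hom (M.tensor N) (M'.tensor N') where
  toLin := mapLin f g
  map_left a x := LinearMap.congr_fun (tensor_ext (f := mapLin f g ∘ₗ lAct (M.tensor N) a)
    (g := lAct (M'.tensor N') a ∘ₗ mapLin f g) fun m n => by
      change tmul (f (a • m)) (g n) = tmul (a • f m) (g n)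
      rw [f.map_left]) x
  map_right r x := LinearMap.congr_fun (tensor_ext (f := mapLin f g ∘ₗ rAct (M.tensor N) (op r))
    (g := rAct (M'.tensor N') (op r) ∘ₗ mapLin f g) fun m n => by
      change tmul (f m) (g (op r • n)) = tmul (f m) (op r • g n)
      rw [g.map_right]) x

theorem map_tmul (f : Hom M M') (g : Hom N N') (m : M) (n : N) :
    map f g (tmul m n) = tmul (f m) (g n) := rfl

end API

/-- For `p : P`, the map `m ⊗ n ↦ m ⊗ (n ⊗ p)`. -/
def assocAux (M : Bimodule k A B) (N : Bimodule k B R) (P : Bimodule k R S) :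
    M.tensor N →ₗ[k] P →ₗ[k] M.tensor (N.tensor P) :=
  lift
    (LinearMap.mk₂ k (fun m n => tmulBilin M (N.tensor P) m ∘ₗ tmulBilin N P n)
      (by intros; ext; simp) (by intros; ext; simp) (by intros; ext; simp)
      (by intros; ext; simp))
    (by
      intro m b n
      refine LinearMap.ext fun p => ?_
      exact smul_tmul m b (tmul n p))

/-- The canonical isomorphism `(M ⊗ N) ⊗ P → M ⊗ (N ⊗ P)`, as a `k`-linear map. -/
def assoc (M : Bimodule k A B) (N : Bimodule k B R) (P : Bimodule k R S) :
    (M.tensor N).tensor P →ₗ[k] M.tensor (N.tensor P) :=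
  lift (assocAux M N P) (by
      intro x r p
      exact LinearMap.congr_fun (tensor_ext
        (f := (LinearMap.applyₗ p ∘ₗ assocAux M N P) ∘ₗ rAct (M.tensor N) (op r))
        (g := LinearMap.applyₗ (r • p) ∘ₗ assocAux M N P) fun m n =>
          congrArg (tmulBilin M (N.tensor P) m) (smul_tmul n r p)) x)

theorem assoc_tmul {M : Bimodule k A B} {N : Bimodule k B R} {P : Bimodule k R S}
    (m : M) (n : N) (p : P) : assoc M N P (tmul (tmul m n) p) = tmul m (tmul n p) := rfl

/-- For `m : M`, the map `n ⊗ p ↦ (m ⊗ n) ⊗ p`. -/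
def assocInvAux (M : Bimodule k A B) (N : Bimodule k B R) (P : Bimodule k R S) :
    M →ₗ[k] N.tensor P →ₗ[k] (M.tensor N).tensor P :=
  { toFun := fun m => lift (tmulBilin (M.tensor N) P ∘ₗ tmulBilin M N m)
      (fun n r p => smul_tmul (tmul m n) r p)
    map_add' := fun m m' => tensor_ext fun n p => by
      change tmul (tmul (m + m') n) p = tmul (tmul m n) p + tmul (tmul m' n) p
      simp only [tmul, map_add, LinearMap.add_apply]
    map_smul' := fun c m => tensor_ext fun n p => by
      change tmul (tmul (c • m) n) p = c • tmul (tmul m n) p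
      simp only [tmul, map_smul, LinearMap.smul_apply] }

/-- The inverse `M ⊗ (N ⊗ P) → (M ⊗ N) ⊗ P` of `assoc`. -/
def assocInv (M : Bimodule k A B) (N : Bimodule k B R) (P : Bimodule k R S) :
    M.tensor (N.tensor P) →ₗ[k] (M.tensor N).tensor P :=
  lift (assocInvAux M N P) (by
    intro m b x
    exact LinearMap.congr_fun (tensor_ext
      (f := assocInvAux M N P (op b • m))
      (g := assocInvAux M N P m ∘ₗ lAct (N.tensor P) b) fun n p =>
        congrArg (fun y => tmulBilin (M.tensor N) P y p) (smul_tmul m b n)) x)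

theorem assocInv_tmul {M : Bimodule k A B} {N : Bimodule k B R} {P : Bimodule k R S}
    (m : M) (n : N) (p : P) : assocInv M N P (tmul m (tmul n p)) = tmul (tmul m n) p := rfl

theorem assocInv_assoc (M : Bimodule k A B) (N : Bimodule k B R) (P : Bimodule k R S)
    (x : (M.tensor N).tensor P) : assocInv M N P (assoc M N P x) = x := by
  refine LinearMap.congr_fun (f := assocInv M N P ∘ₗ assoc M N P) (g := LinearMap.id)
    (tensor_ext fun y p => ?_) x
  exact LinearMap.congr_fun (f := assocInv M N P ∘ₗ assoc M N P ∘ₗ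
    (tmulBilin (M.tensor N) P).flip p) (g := (tmulBilin (M.tensor N) P).flip p)
    (tensor_ext fun _ _ => rfl) y

theorem assoc_assocInv (M : Bimodule k A B) (N : Bimodule k B R) (P : Bimodule k R S)
    (x : M.tensor (N.tensor P)) : assoc M N P (assocInv M N P x) = x := by
  refine LinearMap.congr_fun (f := assoc M N P ∘ₗ assocInv M N P) (g := LinearMap.id)
    (tensor_ext fun m y => ?_) x
  exact LinearMap.congr_fun (f := assoc M N P ∘ₗ assocInv M N P ∘ₗ
    tmulBilin M (N.tensor P) m) (g := tmulBilin M (N.tensor P) m)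
    (tensor_ext fun _ _ => rfl) y

/-- The canonical isomorphism `A ⊗_A M → M`, `a ⊗ m ↦ a m`, as a `k`-linear map. -/
def lid (M : Bimodule k A B) : (regular k A).tensor M →ₗ[k] M :=
  lift (M := regular k A) (lAct M).toLinearMap (fun a b m => mul_smul a b m)

/-- The canonical isomorphism `M ⊗_B B → M`, `m ⊗ b ↦ m b`, as a `k`-linear map. -/
def rid (M : Bimodule k A B) : M.tensor (regular k B) →ₗ[k] M :=
  lift (N := regular k B)
    ((rAct M).toLinearMap ∘ₗ (opLinearEquiv k).toLinearMap).flip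
    (fun m b c => (mul_smul (op c) (op b) m).symm)

/-- The map `M ⊗_B N → M ⊗_B N`, `m ⊗ n ↦ m ⊗ n`, that forgets the right action on `N`. -/
def tensorToLeft (M : Bimodule k A B) (N : Bimodule k B R) :
    M.tensor N →ₗ[k] M.tensor N.toLeft :=
  lift (tmulBilin M N.toLeft) (fun m b n => smul_tmul (N := N.toLeft) m b n)

theorem op_base_smul (M : Bimodule k A k) (c : k) (m : M) : op c • m = c • m := by
  rw [← algebraMap_smul kᵐᵒᵖ c m]
  rfl

/-- The map `tensorToLeft`, as a homomorphism of left `A`-modules. -/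
def tensorToLeftHom (M : Bimodule k A B) (N : Bimodule k B R) :
    Hom (M.tensor N).toLeft (M.tensor N.toLeft) where
  toLin := tensorToLeft M N
  map_left a x := LinearMap.congr_fun (tensor_ext (f := tensorToLeft M N ∘ₗ lAct (M.tensor N) a)
    (g := lAct (M.tensor N.toLeft) a ∘ₗ tensorToLeft M N) fun _ _ => rfl) x
  map_right c x := by
    rw [op_base_smul, op_base_smul, map_smul]

/-- A homomorphism of bimodules, seen as a homomorphism of left modules. -/
def Hom.toLeft {M N : Bimodule k A B} (f : Hom M N) : Hom M.toLeft N.toLeft where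
  toLin := f.toLin
  map_left a m := f.map_left a m
  map_right c m := by
    rw [op_base_smul, op_base_smul, map_smul]

/-- The map `(M ⊗_B N)° → N° ⊗_{B°} M°`, `m ⊗ n ↦ n ⊗ m`. -/
def swapLin (M : Bimodule k A B) (N : Bimodule k B R) :
    M.tensor N →ₗ[k] N.opp.tensor M.opp :=
  lift (tmulBilin N.opp M.opp).flip
    (fun m b n => (smul_tmul (M := N.opp) (N := M.opp) n (op b) m).symm)

/-- The map `(M ⊗_B N)° → N° ⊗_{B°} M°`, `m ⊗ n ↦ n ⊗ m`, as a homomorphism of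
`R°`-`A°`-bimodules. -/
def swap (M : Bimodule k A B) (N : Bimodule k B R) :
    Hom (M.tensor N).opp (N.opp.tensor M.opp) where
  toLin := swapLin M N
  map_left r x := LinearMap.congr_fun (tensor_ext (f := swapLin M N ∘ₗ rAct (M.tensor N) r)
    (g := lAct (N.opp.tensor M.opp) r ∘ₗ swapLin M N) fun _ _ => rfl) x
  map_right a x := LinearMap.congr_fun (tensor_ext
    (f := swapLin M N ∘ₗ lAct (M.tensor N) (unop a))
    (g := rAct (N.opp.tensor M.opp) (op a) ∘ₗ swapLin M N) fun _ _ => rfl) x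

/-- A homomorphism of bimodules, seen between the opposite bimodules. -/
def Hom.opp {M N : Bimodule k A B} (f : Hom M N) : Hom M.opp N.opp where
  toLin := f.toLin
  map_left b m := f.map_right (unop b) m
  map_right a m := f.map_left (unop a) m

end Tensor

/-! ### The tensor product of bimodules over the base ring -/

section KTensor

variable {k A B R A' B' R' : Type u} [CommRing k] [Ring A] [Algebra k A] [Ring B] [Algebra k B]
  [Ring R] [Algebra k R] [Ring A'] [Algebra k A'] [Ring B'] [Algebra k B'] [Ring R']
  [Algebra k R']

/-- The action of `A ⊗ A'` on `M ⊗ M'` by `(a ⊗ a') (m ⊗ m') = a m ⊗ a' m'`. -/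
noncomputable def kLeftAction (M : Bimodule k A B) (M' : Bimodule k A' B') :
    A ⊗[k] A' →ₐ[k] Module.End k (M ⊗[k] M') :=
  (Module.endTensorEndAlgHom (R := k) (S := k) (A := k) (M := M) (N := M')).comp
    (Algebra.TensorProduct.map M.lAct M'.lAct)

/-- The action of `(B ⊗ B')ᵐᵒᵖ` on `M ⊗ M'` by `(m ⊗ m') (b ⊗ b') = m b ⊗ m' b'`. -/
noncomputable def kRightAction (M : Bimodule k A B) (M' : Bimodule k A' B') :
    (B ⊗[k] B')ᵐᵒᵖ →ₐ[k] Module.End k (M ⊗[k] M') :=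
  ((Module.endTensorEndAlgHom (R := k) (S := k) (A := k) (M := M) (N := M')).comp
    (Algebra.TensorProduct.map M.rAct M'.rAct)).comp
      (Algebra.TensorProduct.opAlgEquiv k k B B').symm.toAlgHom

theorem kLeftAction_tmul (M : Bimodule k A B) (M' : Bimodule k A' B') (a : A) (a' : A')
    (m : M) (m' : M') :
    kLeftAction M M' (a ⊗ₜ a') (m ⊗ₜ m') = (a • m) ⊗ₜ (a' • m') := by
  simp only [kLeftAction, AlgHom.comp_apply, Algebra.TensorProduct.map_tmul]
  rfl

theorem kRightAction_tmul (M : Bimodule k A B) (M' : Bimodule k A' B') (b : B) (b' : B')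
    (m : M) (m' : M') :
    kRightAction M M' (op (b ⊗ₜ b')) (m ⊗ₜ m') = (op b • m) ⊗ₜ (op b' • m') := by
  simp only [kRightAction, AlgHom.comp_apply]
  rfl

/-- The tensor product `M ⊗_k M'` of an `A`-`B`-bimodule and an `A'`-`B'`-bimodule, as an
`A ⊗ A'`-`B ⊗ B'`-bimodule. -/
noncomputable def kTensor (M : Bimodule k A B) (M' : Bimodule k A' B') :
    Bimodule k (A ⊗[k] A') (B ⊗[k] B') :=
  ofActions (M ⊗[k] M') (kLeftAction M M') (kRightAction M M') (by
    intro s t x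
    induction s using TensorProduct.induction_on with
    | zero => simp
    | add s s' hs hs' => simp only [map_add, LinearMap.add_apply, hs, hs']
    | tmul a a' =>
      induction t using MulOpposite.rec' with
      | _ t =>
      induction t using TensorProduct.induction_on with
      | zero => simp
      | add t t' ht ht' => simp only [op_add, map_add, LinearMap.add_apply, ht, ht']
      | tmul b b' =>
        induction x using TensorProduct.induction_on with
        | zero => simp
        | add x x' hx hx' => simp only [map_add, hx, hx']
        | tmul m m' => simp only [kLeftAction_tmul, kRightAction_tmul, smul_comm])

/-- The bilinear map `(m, m') ↦ m ⊗ m'`. -/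
noncomputable def ktmulBilin (M : Bimodule k A B) (M' : Bimodule k A' B') :
    M →ₗ[k] M' →ₗ[k] M.kTensor M' :=
  TensorProduct.mk k M M'

/-- The pure tensor `m ⊗ m'` over `k`. -/
noncomputable def ktmul {M : Bimodule k A B} {M' : Bimodule k A' B'} (m : M) (m' : M') :
    M.kTensor M' :=
  ktmulBilin M M' m m'

section API

variable {M : Bimodule k A B} {M' : Bimodule k A' B'}

theorem left_smul_ktmul (a : A) (a' : A') (m : M) (m' : M') :
    (a ⊗ₜ[k] a') • ktmul m m' = ktmul (a • m) (a' • m') :=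
  kLeftAction_tmul M M' a a' m m'

theorem right_smul_ktmul (b : B) (b' : B') (m : M) (m' : M') :
    op (b ⊗ₜ[k] b') • ktmul m m' = ktmul (op b • m) (op b' • m') :=
  kRightAction_tmul M M' b b' m m'

theorem kTensor_ext {P : Type u} [AddCommGroup P] [Module k P] {f g : M.kTensor M' →ₗ[k] P}
    (h : ∀ m m', f (ktmul m m') = g (ktmul m m')) : f = g :=
  TensorProduct.ext' h

/-- The `k`-linear map out of `M ⊗_k M'` induced by a bilinear map. -/
noncomputable def klift {P : Type u} [AddCommGroup P] [Module k P] (f : M →ₗ[k] M' →ₗ[k] P) :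
    M.kTensor M' →ₗ[k] P :=
  TensorProduct.lift f

/-- A `k`-linear map between bimodules over tensor product algebras is a homomorphism as soon as
it is compatible with the action of pure tensors. -/
def Hom.ofPure {X Y : Bimodule k (A ⊗[k] A') (B ⊗[k] B')} (f : X →ₗ[k] Y)
    (hl : ∀ (a : A) (a' : A') x, f ((a ⊗ₜ[k] a') • x) = (a ⊗ₜ[k] a') • f x)
    (hr : ∀ (b : B) (b' : B') x, f (op (b ⊗ₜ[k] b') • x) = op (b ⊗ₜ[k] b') • f x) :
    Hom X Y where
  toLin := f
  map_left s x := by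
    induction s using TensorProduct.induction_on with
    | zero => rw [zero_smul, zero_smul, map_zero]
    | add s s' hs hs' => rw [add_smul, add_smul, map_add, hs, hs']
    | tmul a a' => exact hl a a' x
  map_right s x := by
    induction s using TensorProduct.induction_on with
    | zero => rw [op_zero, zero_smul, zero_smul, map_zero]
    | add s s' hs hs' => rw [op_add, add_smul, add_smul, map_add, hs, hs']
    | tmul b b' => exact hr b b' x

/-- The `k`-linear map `f ⊗_k f'`, for `k`-linear maps `f` and `f'`. -/
noncomputable def kMapLin' {P P' Q Q' : Type u} [Ring P] [Algebra k P] [Ring P'] [Algebra k P']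
    [Ring Q] [Algebra k Q] [Ring Q'] [Algebra k Q'] {N : Bimodule k P Q} {N' : Bimodule k P' Q'}
    (f : M →ₗ[k] N) (f' : M' →ₗ[k] N') : M.kTensor M' →ₗ[k] N.kTensor N' :=
  klift ((ktmulBilin N N').compl₁₂ f f')

/-- The `k`-linear map `f ⊗_k f'`. -/
noncomputable def kMapLin {N : Bimodule k A B} {N' : Bimodule k A' B'} (f : Hom M N)
    (f' : Hom M' N') : M.kTensor M' →ₗ[k] N.kTensor N' :=
  klift ((ktmulBilin N N').compl₁₂ f.toLin f'.toLin)

/-- The tensor product `f ⊗_k f'` of two bimodule homomorphisms. -/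
noncomputable def kMap {N : Bimodule k A B} {N' : Bimodule k A' B'} (f : Hom M N)
    (f' : Hom M' N') : Hom (M.kTensor M') (N.kTensor N') :=
  Hom.ofPure (kMapLin f f')
    (fun a a' x => LinearMap.congr_fun (kTensor_ext
      (f := kMapLin f f' ∘ₗ lAct (M.kTensor M') (a ⊗ₜ a'))
      (g := lAct (N.kTensor N') (a ⊗ₜ a') ∘ₗ kMapLin f f')
      fun m m' => by
        change kMapLin f f' ((a ⊗ₜ[k] a') • ktmul m m') = (a ⊗ₜ[k] a') • ktmul (f m) (f' m')
        rw [left_smul_ktmul, left_smul_ktmul]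
        change ktmul (f (a • m)) (f' (a' • m')) = _
        rw [f.map_left, f'.map_left]) x)
    (fun b b' x => LinearMap.congr_fun (kTensor_ext
      (f := kMapLin f f' ∘ₗ
        rAct (M.kTensor M') (op (b ⊗ₜ b')))
      (g := rAct (N.kTensor N') (op (b ⊗ₜ b')) ∘ₗ
        kMapLin f f')
      fun m m' => by
        change kMapLin f f' (op (b ⊗ₜ[k] b') • ktmul m m') = op (b ⊗ₜ[k] b') • ktmul (f m) (f' m')
        rw [right_smul_ktmul, right_smul_ktmul]
        change ktmul (f (op b • m)) (f' (op b' • m')) = _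
        rw [f.map_right, f'.map_right]) x)

theorem kMap_ktmul {N : Bimodule k A B} {N' : Bimodule k A' B'} (f : Hom M N)
    (f' : Hom M' N') (m : M) (m' : M') : kMap f f' (ktmul m m') = ktmul (f m) (f' m') := rfl

end API

/-- The canonical map `A ⊗_k A' → A ⊗_k A'` from the tensor product of the regular bimodules to
the regular bimodule of the tensor product. -/
noncomputable def kRegular (k A A' : Type u) [CommRing k] [Ring A] [Algebra k A] [Ring A']
    [Algebra k A'] :
    Hom ((regular k A).kTensor (regular k A')) (regular k (A ⊗[k] A')) :=
  Hom.ofPure (TensorProduct.lift (TensorProduct.mk k A A'))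
    (fun a a' x => LinearMap.congr_fun (kTensor_ext
      (f := TensorProduct.lift (TensorProduct.mk k A A') ∘ₗ
        lAct ((regular k A).kTensor (regular k A')) (a ⊗ₜ a'))
      (g := lAct (regular k (A ⊗[k] A')) (a ⊗ₜ a') ∘ₗ
        TensorProduct.lift (TensorProduct.mk k A A'))
      fun m m' => by
        change TensorProduct.lift (TensorProduct.mk k A A')
          ((a ⊗ₜ[k] a') • ktmul (M := regular k A) (M' := regular k A') m m') =
            (a ⊗ₜ[k] a') * (m ⊗ₜ m')
        rw [left_smul_ktmul, Algebra.TensorProduct.tmul_mul_tmul]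
        rfl) x)
    (fun b b' x => LinearMap.congr_fun (kTensor_ext
      (f := TensorProduct.lift (TensorProduct.mk k A A') ∘ₗ
        rAct ((regular k A).kTensor (regular k A')) (op (b ⊗ₜ b')))
      (g := rAct (regular k (A ⊗[k] A')) (op (b ⊗ₜ b')) ∘ₗ
        TensorProduct.lift (TensorProduct.mk k A A'))
      fun m m' => by
        change TensorProduct.lift (TensorProduct.mk k A A')
          (op (b ⊗ₜ[k] b') • ktmul (M := regular k A) (M' := regular k A') m m') =
            (m ⊗ₜ m') * (b ⊗ₜ[k] b')
        rw [right_smul_ktmul, Algebra.TensorProduct.tmul_mul_tmul]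
        rfl) x)

section Interchange

variable (M : Bimodule k A B) (N : Bimodule k B R) (M' : Bimodule k A' B') (N' : Bimodule k B' R')

/-- For `m : M` and `n : N`, the map `m' ⊗ n' ↦ (m ⊗ m') ⊗ (n ⊗ n')`. -/
noncomputable def interchangeAux (m : M) (n : N) :
    M'.tensor N' →ₗ[k] (M.kTensor M').tensor (N.kTensor N') :=
  lift ((tmulBilin (M.kTensor M') (N.kTensor N')).compl₁₂ (ktmulBilin M M' m) (ktmulBilin N N' n))
    (by
      intro m' b' n'
      change tmul (ktmul m (op b' • m')) (ktmul n n') = tmul (ktmul m m') (ktmul n (b' • n'))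
      have h := smul_tmul (ktmul m m') ((1 : B) ⊗ₜ[k] b') (ktmul n n')
      rw [right_smul_ktmul, left_smul_ktmul, op_one, one_smul, one_smul] at h
      exact h)

/-- The `k`-linear map underlying `interchange`. -/
noncomputable def interchangeLin :
    (M.tensor N).kTensor (M'.tensor N') →ₗ[k] (M.kTensor M').tensor (N.kTensor N') :=
  klift (lift (LinearMap.mk₂ k (interchangeAux M N M' N')
      (fun m₁ m₂ n => tensor_ext fun m' n' => by
        change tmul (ktmul (m₁ + m₂) m') (ktmul n n') =
          tmul (ktmul m₁ m') (ktmul n n') + tmul (ktmul m₂ m') (ktmul n n')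
        simp only [ktmul, tmul, map_add, LinearMap.add_apply])
      (fun c m n => tensor_ext fun m' n' => by
        change tmul (ktmul (c • m) m') (ktmul n n') = c • tmul (ktmul m m') (ktmul n n')
        simp only [ktmul, tmul, map_smul, LinearMap.smul_apply])
      (fun m n₁ n₂ => tensor_ext fun m' n' => by
        change tmul (ktmul m m') (ktmul (n₁ + n₂) n') =
          tmul (ktmul m m') (ktmul n₁ n') + tmul (ktmul m m') (ktmul n₂ n')
        simp only [ktmul, tmul, map_add, LinearMap.add_apply])
      (fun c m n => tensor_ext fun m' n' => by
        change tmul (ktmul m m') (ktmul (c • n) n') = c • tmul (ktmul m m') (ktmul n n')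
        simp only [ktmul, tmul, map_smul, LinearMap.smul_apply]))
    (fun m b n => tensor_ext fun m' n' => by
      change tmul (ktmul (op b • m) m') (ktmul n n') = tmul (ktmul m m') (ktmul (b • n) n')
      have h := smul_tmul (ktmul m m') (b ⊗ₜ[k] (1 : B')) (ktmul n n')
      rw [right_smul_ktmul, left_smul_ktmul, op_one, one_smul, one_smul] at h
      exact h))

variable {M N M' N'} in
theorem interchangeLin_tmul (m : M) (n : N) (m' : M') (n' : N') :
    interchangeLin M N M' N' (ktmul (tmul m n) (tmul m' n')) =
      tmul (ktmul m m') (ktmul n n') := rfl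

variable {M N M' N'} in
theorem interchange_ext {P : Type u} [AddCommGroup P] [Module k P]
    {f g : (M.tensor N).kTensor (M'.tensor N') →ₗ[k] P}
    (h : ∀ m n m' n', f (ktmul (tmul m n) (tmul m' n')) = g (ktmul (tmul m n) (tmul m' n'))) :
    f = g := by
  refine kTensor_ext fun x x' => ?_
  have h₁ : ∀ m n, f.comp (ktmulBilin _ _ (tmul m n)) = g.comp (ktmulBilin _ _ (tmul m n)) :=
    fun m n => tensor_ext fun m' n' => h m n m' n'
  have h₂ : f.comp ((ktmulBilin (M.tensor N) (M'.tensor N')).flip x') =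
      g.comp ((ktmulBilin (M.tensor N) (M'.tensor N')).flip x') :=
    tensor_ext fun m n => LinearMap.congr_fun (h₁ m n) x'
  exact LinearMap.congr_fun h₂ x

/-- The canonical isomorphism `(M ⊗_B N) ⊗_k (M' ⊗_B' N') → (M ⊗_k M') ⊗_{B ⊗ B'} (N ⊗_k N')`,
`(m ⊗ n) ⊗ (m' ⊗ n') ↦ (m ⊗ m') ⊗ (n ⊗ n')`. -/
noncomputable def interchange :
    Hom ((M.tensor N).kTensor (M'.tensor N')) ((M.kTensor M').tensor (N.kTensor N')) :=
  Hom.ofPure (interchangeLin M N M' N')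
    (fun a a' x => LinearMap.congr_fun (interchange_ext
      (f := interchangeLin M N M' N' ∘ₗ
        lAct ((M.tensor N).kTensor (M'.tensor N')) (a ⊗ₜ a'))
      (g := lAct ((M.kTensor M').tensor (N.kTensor N')) (a ⊗ₜ a') ∘ₗ interchangeLin M N M' N')
      fun m n m' n' => by
        change interchangeLin M N M' N' ((a ⊗ₜ[k] a') • ktmul (tmul m n) (tmul m' n')) =
          (a ⊗ₜ[k] a') • tmul (ktmul m m') (ktmul n n')
        rw [left_smul_ktmul, left_smul_tmul, left_smul_tmul, left_smul_tmul, left_smul_ktmul]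
        rfl) x)
    (fun b b' x => LinearMap.congr_fun (interchange_ext
      (f := interchangeLin M N M' N' ∘ₗ
        rAct ((M.tensor N).kTensor (M'.tensor N')) (op (b ⊗ₜ b')))
      (g := rAct ((M.kTensor M').tensor (N.kTensor N')) (op (b ⊗ₜ b')) ∘ₗ
        interchangeLin M N M' N')
      fun m n m' n' => by
        change interchangeLin M N M' N' (op (b ⊗ₜ[k] b') • ktmul (tmul m n) (tmul m' n')) =
          op (b ⊗ₜ[k] b') • tmul (ktmul m m') (ktmul n n')
        rw [right_smul_ktmul, right_smul_tmul, right_smul_tmul, right_smul_tmul,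
          right_smul_ktmul]
        rfl) x)

end Interchange

end KTensor

/-- `M` is flat as a right `B`-module: tensoring with `M` over `B` preserves injectivity of
homomorphisms of left `B`-modules. -/
def IsRightFlat {k A B : Type u} [CommRing k] [Ring A] [Algebra k A] [Ring B] [Algebra k B]
    (M : Bimodule k A B) : Prop :=
  ∀ (N N' : Bimodule k B k) (f : Hom N N'),
    Function.Injective f → Function.Injective (map (Hom.id M) f)

end Bimodule

open Bimodule

/-- The `k`-algebra `A` is separable: the multiplication `A ⊗ A → A` splits as a map of
`A`-bimodules (`a (x ⊗ y) b = a x ⊗ y b`). -/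
def IsSeparableAlgebra (k A : Type u) [CommRing k] [Ring A] [Algebra k A] : Prop :=
  ∃ θ : A →ₗ[k] A ⊗[k] A,
    (∀ a x b : A, θ (a * x * b) =
      TensorProduct.map (LinearMap.mulLeft k a) (LinearMap.mulRight k b) (θ x)) ∧
    ∀ x : A, LinearMap.mul' k A (θ x) = x

/-! ### Corings -/

/-- An `A`-coring. -/
structure Coring (k A : Type u) [CommRing k] [Ring A] [Algebra k A] where
  /-- The underlying `A`-bimodule. -/
  bim : Bimodule k A A
  /-- The comultiplication `C → C ⊗_A C`. -/
  comul : Hom bim (bim.tensor bim)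
  /-- The counit `C → A`. -/
  counit : Hom bim (regular k A)
  coassoc : ∀ c, assoc bim bim bim (map comul (Hom.id bim) (comul c)) =
    map (Hom.id bim) comul (comul c)
  lid_counit : ∀ c, lid bim (map counit (Hom.id bim) (comul c)) = c
  rid_counit : ∀ c, rid bim (map (Hom.id bim) counit (comul c)) = c

namespace Coring

section Constructions

variable {k A B : Type u} [CommRing k] [Ring A] [Algebra k A] [Ring B] [Algebra k B]

variable (k A) in
/-- The comultiplication `A ≅ A ⊗_A A`, `a ↦ a ⊗ 1`, of the trivial coring. -/
def trivialComul : Hom (regular k A) ((regular k A).tensor (regular k A)) where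
  toLin := (tmulBilin (regular k A) (regular k A)).flip (1 : A)
  map_left _ _ := rfl
  map_right b m := by
    have h : (op b • (1 : A)) = b • (1 : A) := by
      rw [op_smul_eq_mul, smul_eq_mul, mul_one, one_mul]
    exact (smul_tmul (M := regular k A) (N := regular k A) m b (1 : A)).trans
      (congrArg (tmulBilin (regular k A) (regular k A) m) h.symm)

variable (k A) in
/-- The trivial `A`-coring `A`, with the canonical isomorphism `A ≅ A ⊗_A A` as comultiplication
and the identity as counit. -/
def trivial : Coring k A where
  bim := regular k A
  comul := trivialComul k A
  counit := Hom.id (regular k A)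
  coassoc _ := rfl
  lid_counit c := by
    change (c : A) * 1 = c
    exact mul_one _
  rid_counit c := by
    change (c : A) * 1 = c
    exact mul_one _

section TensorAux

variable (C : Coring k A) (D : Coring k B)

/-- The comultiplication of `C ⊗_k D`. -/
noncomputable def tensorComul :
    Hom (C.bim.kTensor D.bim) ((C.bim.kTensor D.bim).tensor (C.bim.kTensor D.bim)) :=
  (interchange C.bim C.bim D.bim D.bim).comp (kMap C.comul D.comul)

/-- The counit of `C ⊗_k D`. -/
noncomputable def tensorCounit : Hom (C.bim.kTensor D.bim) (regular k (A ⊗[k] B)) :=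
  (kRegular k A B).comp (kMap C.counit D.counit)

/-- The iterated interchange map. -/
noncomputable def interchange₃ :
    (C.bim.tensor (C.bim.tensor C.bim)).kTensor (D.bim.tensor (D.bim.tensor D.bim)) →ₗ[k]
      (C.bim.kTensor D.bim).tensor ((C.bim.kTensor D.bim).tensor (C.bim.kTensor D.bim)) :=
  (map (Hom.id (C.bim.kTensor D.bim)) (interchange C.bim C.bim D.bim D.bim)).toLin ∘ₗ
    (interchange C.bim (C.bim.tensor C.bim) D.bim (D.bim.tensor D.bim)).toLin

theorem tensorComul_coassoc_left (s : C.bim.tensor C.bim) (t : D.bim.tensor D.bim) :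
    assoc _ _ _ (map (tensorComul C D) (Hom.id _)
      (interchange C.bim C.bim D.bim D.bim (ktmul s t))) =
    interchange₃ C D (ktmul (assoc _ _ _ (map C.comul (Hom.id _) s))
      (assoc _ _ _ (map D.comul (Hom.id _) t))) := by
  refine LinearMap.congr_fun (interchange_ext
    (f := assoc _ _ _ ∘ₗ (map (tensorComul C D) (Hom.id _)).toLin ∘ₗ
      (interchange C.bim C.bim D.bim D.bim).toLin)
    (g := interchange₃ C D ∘ₗ kMapLin' (assoc _ _ _ ∘ₗ (map C.comul (Hom.id _)).toLin)
      (assoc _ _ _ ∘ₗ (map D.comul (Hom.id _)).toLin)) ?_) (ktmul s t)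
  intro c c' d d'
  exact LinearMap.congr_fun (interchange_ext
    (f := assoc _ _ _ ∘ₗ ((tmulBilin ((C.bim.kTensor D.bim).tensor (C.bim.kTensor D.bim))
      (C.bim.kTensor D.bim)).flip (ktmul c' d')) ∘ₗ (interchange C.bim C.bim D.bim D.bim).toLin)
    (g := interchange₃ C D ∘ₗ kMapLin'
      (assoc _ _ _ ∘ₗ (tmulBilin (C.bim.tensor C.bim) C.bim).flip c')
      (assoc _ _ _ ∘ₗ (tmulBilin (D.bim.tensor D.bim) D.bim).flip d'))
    fun _ _ _ _ => rfl) (ktmul (C.comul c) (D.comul d))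

theorem tensorComul_coassoc_right (s : C.bim.tensor C.bim) (t : D.bim.tensor D.bim) :
    map (Hom.id _) (tensorComul C D) (interchange C.bim C.bim D.bim D.bim (ktmul s t)) =
    interchange₃ C D (ktmul (map (Hom.id _) C.comul s) (map (Hom.id _) D.comul t)) :=
  LinearMap.congr_fun (interchange_ext
    (f := (map (Hom.id _) (tensorComul C D)).toLin ∘ₗ
      (interchange C.bim C.bim D.bim D.bim).toLin)
    (g := interchange₃ C D ∘ₗ kMapLin' (map (Hom.id _) C.comul).toLin
      (map (Hom.id _) D.comul).toLin) fun _ _ _ _ => rfl) (ktmul s t)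

theorem tensor_lid (s : C.bim.tensor C.bim) (t : D.bim.tensor D.bim) :
    lid _ (map (tensorCounit C D) (Hom.id _)
      (interchange C.bim C.bim D.bim D.bim (ktmul s t))) =
    ktmul (lid _ (map C.counit (Hom.id _) s)) (lid _ (map D.counit (Hom.id _) t)) :=
  LinearMap.congr_fun (interchange_ext
    (f := lid _ ∘ₗ (map (tensorCounit C D) (Hom.id _)).toLin ∘ₗ
      (interchange C.bim C.bim D.bim D.bim).toLin)
    (g := kMapLin' (lid _ ∘ₗ (map C.counit (Hom.id _)).toLin)
      (lid _ ∘ₗ (map D.counit (Hom.id _)).toLin))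
    fun c c' d d' => left_smul_ktmul (C.counit c) (D.counit d) c' d') (ktmul s t)

theorem tensor_rid (s : C.bim.tensor C.bim) (t : D.bim.tensor D.bim) :
    rid _ (map (Hom.id _) (tensorCounit C D)
      (interchange C.bim C.bim D.bim D.bim (ktmul s t))) =
    ktmul (rid _ (map (Hom.id _) C.counit s)) (rid _ (map (Hom.id _) D.counit t)) :=
  LinearMap.congr_fun (interchange_ext
    (f := rid _ ∘ₗ (map (Hom.id _) (tensorCounit C D)).toLin ∘ₗ
      (interchange C.bim C.bim D.bim D.bim).toLin)
    (g := kMapLin' (rid _ ∘ₗ (map (Hom.id _) C.counit).toLin)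
      (rid _ ∘ₗ (map (Hom.id _) D.counit).toLin))
    fun c c' d d' => right_smul_ktmul (C.counit c') (D.counit d') c d) (ktmul s t)

end TensorAux

/-- The tensor product `C ⊗_k D` of an `A`-coring and a `B`-coring, as an `A ⊗ B`-coring. -/
noncomputable def tensor (C : Coring k A) (D : Coring k B) : Coring k (A ⊗[k] B) where
  bim := C.bim.kTensor D.bim
  comul := tensorComul C D
  counit := tensorCounit C D
  coassoc x := LinearMap.congr_fun (kTensor_ext
    (f := assoc _ _ _ ∘ₗ (map (tensorComul C D) (Hom.id _)).toLin ∘ₗ (tensorComul C D).toLin)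
    (g := (map (Hom.id _) (tensorComul C D)).toLin ∘ₗ (tensorComul C D).toLin) fun c d => by
      refine (tensorComul_coassoc_left C D (C.comul c) (D.comul d)).trans ?_
      rw [C.coassoc, D.coassoc]
      exact (tensorComul_coassoc_right C D (C.comul c) (D.comul d)).symm) x
  lid_counit x := LinearMap.congr_fun (kTensor_ext
    (f := lid _ ∘ₗ (map (tensorCounit C D) (Hom.id _)).toLin ∘ₗ (tensorComul C D).toLin)
    (g := LinearMap.id) fun c d => by
      refine (tensor_lid C D (C.comul c) (D.comul d)).trans ?_
      rw [C.lid_counit, D.lid_counit]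
      rfl) x
  rid_counit x := LinearMap.congr_fun (kTensor_ext
    (f := rid _ ∘ₗ (map (Hom.id _) (tensorCounit C D)).toLin ∘ₗ (tensorComul C D).toLin)
    (g := LinearMap.id) fun c d => by
      refine (tensor_rid C D (C.comul c) (D.comul d)).trans ?_
      rw [C.rid_counit, D.rid_counit]
      rfl) x

section OppositeAux

variable (C : Coring k A)

/-- The comultiplication of `C°`, that is `C → C ⊗_A C ≅ C° ⊗_{A°} C°`. -/
def oppositeComul : Hom C.bim.opp (C.bim.opp.tensor C.bim.opp) :=
  (swap C.bim C.bim).comp C.comul.opp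

/-- The counit of `C°`. -/
def oppositeCounit : Hom C.bim.opp (regular k Aᵐᵒᵖ) where
  toLin := (opLinearEquiv k).toLinearMap ∘ₗ C.counit.toLin
  map_left b m := congrArg op (C.counit.map_right (unop b) m)
  map_right b m := congrArg op (C.counit.map_left (unop b) m)

/-- The reversal `a ⊗ b ⊗ c ↦ c ⊗ b ⊗ a`. -/
def reverse₃ : C.bim.tensor (C.bim.tensor C.bim) →ₗ[k]
    C.bim.opp.tensor (C.bim.opp.tensor C.bim.opp) :=
  assoc _ _ _ ∘ₗ (map (swap C.bim C.bim) (Hom.id C.bim.opp)).toLin ∘ₗ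
    (swap C.bim (C.bim.tensor C.bim)).toLin

theorem oppositeComul_coassoc_right (s : C.bim.tensor C.bim) :
    map (Hom.id _) (oppositeComul C) (swap C.bim C.bim s) =
      reverse₃ C (assoc _ _ _ (map C.comul (Hom.id _) s)) := by
  refine LinearMap.congr_fun (tensor_ext
    (f := (map (Hom.id _) (oppositeComul C)).toLin ∘ₗ (swap C.bim C.bim).toLin)
    (g := reverse₃ C ∘ₗ assoc _ _ _ ∘ₗ (map C.comul (Hom.id _)).toLin) ?_) s
  intro c c'
  exact LinearMap.congr_fun (tensor_ext
    (f := tmulBilin C.bim.opp (C.bim.opp.tensor C.bim.opp) c' ∘ₗ (swap C.bim C.bim).toLin)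
    (g := reverse₃ C ∘ₗ assoc _ _ _ ∘ₗ (tmulBilin (C.bim.tensor C.bim) C.bim).flip c')
    fun _ _ => rfl) (C.comul c)

theorem oppositeComul_coassoc_left (s : C.bim.tensor C.bim) :
    assoc _ _ _ (map (oppositeComul C) (Hom.id _) (swap C.bim C.bim s)) =
      reverse₃ C (map (Hom.id _) C.comul s) :=
  LinearMap.congr_fun (tensor_ext
    (f := assoc _ _ _ ∘ₗ (map (oppositeComul C) (Hom.id _)).toLin ∘ₗ (swap C.bim C.bim).toLin)
    (g := reverse₃ C ∘ₗ (map (Hom.id _) C.comul).toLin) fun _ _ => rfl) s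

theorem opposite_lid (s : C.bim.tensor C.bim) :
    lid _ (map (oppositeCounit C) (Hom.id _) (swap C.bim C.bim s)) =
      rid _ (map (Hom.id _) C.counit s) :=
  LinearMap.congr_fun (tensor_ext (P := C.bim)
    (f := lid C.bim.opp ∘ₗ (map (oppositeCounit C) (Hom.id C.bim.opp)).toLin ∘ₗ (swap C.bim C.bim).toLin)
    (g := rid _ ∘ₗ (map (Hom.id _) C.counit).toLin) fun _ _ => rfl) s

theorem opposite_rid (s : C.bim.tensor C.bim) :
    rid _ (map (Hom.id _) (oppositeCounit C) (swap C.bim C.bim s)) =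
      lid _ (map C.counit (Hom.id _) s) :=
  LinearMap.congr_fun (tensor_ext (P := C.bim)
    (f := rid C.bim.opp ∘ₗ (map (Hom.id C.bim.opp) (oppositeCounit C)).toLin ∘ₗ (swap C.bim C.bim).toLin)
    (g := lid _ ∘ₗ (map C.counit (Hom.id _)).toLin) fun _ _ => rfl) s

end OppositeAux

/-- The opposite coring `C°` of an `A`-coring `C`, an `A°`-coring. -/
def opposite (C : Coring k A) : Coring k Aᵐᵒᵖ where
  bim := C.bim.opp
  comul := oppositeComul C
  counit := oppositeCounit C
  coassoc c := by
    refine (oppositeComul_coassoc_left C (C.comul c)).trans ?_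
    rw [← C.coassoc]
    exact (oppositeComul_coassoc_right C (C.comul c)).symm
  lid_counit c := (opposite_lid C (C.comul c)).trans (C.rid_counit c)
  rid_counit c := (opposite_rid C (C.comul c)).trans (C.lid_counit c)

end Constructions

section Properties

variable {k A : Type u} [CommRing k] [Ring A] [Algebra k A]

/-- The coring `C` is coseparable: the comultiplication has a left inverse
`π : C ⊗_A C → C` which is a homomorphism of bicomodules, where `C ⊗_A C` has the left coaction
`Δ ⊗ C` and the right coaction `C ⊗ Δ`, and `C` has both coactions given by `Δ`. -/
def IsCoseparable (C : Coring k A) : Prop :=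
  ∃ π : Hom (C.bim.tensor C.bim) C.bim,
    (∀ x, C.comul (π x) =
      map (Hom.id C.bim) π (assoc C.bim C.bim C.bim (map C.comul (Hom.id C.bim) x))) ∧
    (∀ x, C.comul (π x) =
      map π (Hom.id C.bim) (assocInv C.bim C.bim C.bim (map (Hom.id C.bim) C.comul x))) ∧
    ∀ c, π (C.comul c) = c

end Properties

end Coring

/-! ### Comodules -/

section Comodules

variable {k A : Type u} [CommRing k] [Ring A] [Algebra k A]

/-- A left comodule over the `A`-coring `C`. -/
structure LeftComodule (C : Coring k A) where
  /-- The underlying left `A`-module. -/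
  obj : Bimodule k A k
  /-- The coaction `M → C ⊗_A M`. -/
  coact : Hom obj (C.bim.tensor obj)
  coassoc : ∀ m, assoc C.bim C.bim obj (map C.comul (Hom.id obj) (coact m)) =
    map (Hom.id C.bim) coact (coact m)
  lid_counit : ∀ m, lid obj (map C.counit (Hom.id obj) (coact m)) = m

namespace LeftComodule

variable {C : Coring k A}

/-- Homomorphisms of left comodules. -/
structure Hom (M N : LeftComodule C) where
  /-- The underlying homomorphism of left `A`-modules. -/
  toHom : Bimodule.Hom M.obj N.obj
  colinear : ∀ m, N.coact (toHom m) = map (Bimodule.Hom.id C.bim) toHom (M.coact m)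

/-- The submodule `N` of `M` is a subcomodule: it is the image of an injective homomorphism of
comodules. -/
def IsSubcomodule (M : LeftComodule C) (N : Submodule A M.obj) : Prop :=
  ∃ (S : LeftComodule C) (i : Hom S M), Function.Injective i.toHom ∧
    Set.range i.toHom = (N : Set M.obj)

/-- The comodule `M` is simple: it has just two subcomodules. -/
def IsSimple (M : LeftComodule C) : Prop :=
  {N : Submodule A M.obj | M.IsSubcomodule N}.ncard = 2

open Classical in
/-- The comodule `M` is semisimple: it is a direct sum of simple comodules. -/
def IsSemisimple (M : LeftComodule C) : Prop :=
  ∃ (ι : Type u) (S : ι → LeftComodule C) (f : ∀ i, Hom (S i) M), (∀ i, (S i).IsSimple) ∧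
    Function.Bijective (DirectSum.toModule k ι M.obj fun i => (f i).toHom.toLin)

variable (C) in
/-- The coring `C` as a left comodule over itself. -/
def self : LeftComodule C where
  obj := C.bim.toLeft
  coact := (tensorToLeftHom C.bim C.bim).comp C.comul.toLeft
  coassoc c := by
    have h₁ : ∀ s : C.bim.tensor C.bim,
        assoc _ _ _ (map C.comul (Bimodule.Hom.id _) (tensorToLeft C.bim C.bim s)) =
        map (Bimodule.Hom.id _) (tensorToLeftHom C.bim C.bim) (tensorToLeft _ _
          (assoc _ _ _ (map C.comul (Bimodule.Hom.id _) s))) := fun s =>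
      LinearMap.congr_fun (tensor_ext
        (f := assoc _ _ _ ∘ₗ (map C.comul (Bimodule.Hom.id C.bim.toLeft)).toLin ∘ₗ
          tensorToLeft C.bim C.bim)
        (g := (map (Bimodule.Hom.id _) (tensorToLeftHom C.bim C.bim)).toLin ∘ₗ
          tensorToLeft _ _ ∘ₗ assoc _ _ _ ∘ₗ (map C.comul (Bimodule.Hom.id _)).toLin)
        fun c c' => LinearMap.congr_fun (tensor_ext
          (f := assoc _ _ _ ∘ₗ (tmulBilin (C.bim.tensor C.bim) C.bim.toLeft).flip c')
          (g := (map (Bimodule.Hom.id _) (tensorToLeftHom C.bim C.bim)).toLin ∘ₗ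
            tensorToLeft _ _ ∘ₗ assoc _ _ _ ∘ₗ (tmulBilin (C.bim.tensor C.bim) C.bim).flip c')
          fun _ _ => rfl) (C.comul c)) s
    have h₂ : ∀ s : C.bim.tensor C.bim,
        map (Bimodule.Hom.id _) ((tensorToLeftHom C.bim C.bim).comp C.comul.toLeft)
          (tensorToLeft C.bim C.bim s) =
        map (Bimodule.Hom.id _) (tensorToLeftHom C.bim C.bim) (tensorToLeft _ _
          (map (Bimodule.Hom.id _) C.comul s)) := fun s =>
      LinearMap.congr_fun (tensor_ext
        (f := (map (Bimodule.Hom.id _)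
          ((tensorToLeftHom C.bim C.bim).comp C.comul.toLeft)).toLin ∘ₗ tensorToLeft C.bim C.bim)
        (g := (map (Bimodule.Hom.id _) (tensorToLeftHom C.bim C.bim)).toLin ∘ₗ
          tensorToLeft _ _ ∘ₗ (map (Bimodule.Hom.id _) C.comul).toLin)
        fun _ _ => rfl) s
    refine (h₁ (C.comul c)).trans ?_
    rw [C.coassoc]
    exact (h₂ (C.comul c)).symm
  lid_counit c := by
    have h : ∀ s : C.bim.tensor C.bim,
        lid _ (map C.counit (Bimodule.Hom.id _) (tensorToLeft C.bim C.bim s)) =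
        lid _ (map C.counit (Bimodule.Hom.id _) s) := fun s =>
      LinearMap.congr_fun (tensor_ext (P := C.bim)
        (f := lid _ ∘ₗ (map C.counit (Bimodule.Hom.id C.bim.toLeft)).toLin ∘ₗ
          tensorToLeft C.bim C.bim)
        (g := lid _ ∘ₗ (map C.counit (Bimodule.Hom.id _)).toLin) fun _ _ => rfl) s
    exact (h (C.comul c)).trans (C.lid_counit c)

end LeftComodule

end Comodules

/-- The coring `C` is semisimple: it is semisimple as a left comodule over itself and flat as a
right `A`-module. -/
def Coring.IsSemisimple {k A : Type u} [CommRing k] [Ring A] [Algebra k A] (C : Coring k A) :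
    Prop :=
  (LeftComodule.self C).IsSemisimple ∧ C.bim.IsRightFlat

end Coseparable

/-! Separability enters through a Casimir element `∑ xᵢ ⊗ yᵢ` of `A ⊗ A`. It forces `A` to be
finite-dimensional, and averaging with it turns `k`-linear functionals into `A`-linear ones, so that
`C` has local dual bases on both sides (`HasCasimir.hasLocalDual`). Local dual bases translate
comodule conditions into conditions on operators. The endomorphisms of the right comodule `C` are
the maps `c ↦ f(c₁) c₂` with `f` right linear; the left subcomodules of `C` are the subspaces stable
under all of them; and a linear retraction of `Δ` is bicolinear as soon as it commutes with the
endomorphisms of the right comodule `C` acting on the first factor and with those of the left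
comodule `C` acting on the second (`isCoseparable_of_retraction`). Since flatness allows
subcomodules to be intersected, a coring is semisimple exactly when it is flat and every left
subcomodule has a complement (`Coring.isSemisimple_iff`).

(i) ⇒ (iii): as a left `D`-comodule, `C ⊗ D` is a sum of copies of `D`, so a subcomodule `N` of the
coring is the image of a `D`-colinear projection `p`. The average `c ⊗ d ↦ ∑ π(c₁ xᵢ ⊗ -) p(yᵢ c₂ ⊗
d)`, with `π(c ⊗ -)` acting on the first factor, is still a projection onto `N` and now commutes
with the endomorphisms of the right comodule `C`. Its kernel is the required complement
(`IsCoseparable.exists_isCompl_of_projection`).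

(iii) ⇒ (ii) holds because a field is a semisimple coring. For (i) ⇒ (iv), `C°` is again
coseparable, hence semisimple, and the previous argument applies with `D = C°`.

(iv) ⇒ (i): `C ⊗_A C` is a quotient of `C ⊗_k C°`, compatibly with both families of operators, and
`Δ` embeds `C` equivariantly in it. A stable complement upstairs gives an equivariant retraction of
`Δ`.

(ii) ⇒ (i): let `K` be an algebraic closure and `X = K ⊗ C`. By (ii), `X` is a semisimple module
over the algebra generated by the endomorphisms of the right comodule, and its simple submodules are
finite-dimensional because `A` is. The subspaces stable under the endomorphisms of the left comodule
are stable under the whole commutant (`apply_mem_of_commute`), so the commutant orbit of a nonzero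
vector of a simple submodule is minimal among them. Schur's lemma and the density theorem make the
product of a simple submodule and such an orbit minimal in `X ⊗_K X`, and these products span. Hence
stable subspaces of `X ⊗_K X` have stable complements (`StableComplemented.tensorOps`). As for (iv),
this gives an equivariant retraction of `K ⊗ Δ`, which a `k`-linear map `K → k` sending `1` to `1`
brings down to `k`. -/

namespace Coseparable

/-! ### Families of submodules closed under sums and finite intersections -/

section Families

variable {α : Type*} [CompleteLattice α] [IsModularLattice α]

/-- The minimal nonzero members of a family. -/
def IsMinimalIn (F : Set α) (P : α) : Prop :=
  P ∈ F ∧ P ≠ ⊥ ∧ ∀ Q ∈ F, Q ≤ P → Q = ⊥ ∨ Q = P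

/-- The usual proof that an atomistic modular lattice is complemented, run relative to `F`. Zorn
gives a maximal independent set `s` of minimal members whose supremum is disjoint from `b`. A
minimal member meets `b ⊔ sSup s` in a member of `F`, so it lies below it or is disjoint from it,
and in the second case it could be added to `s`. -/
theorem exists_sSupIndep_isCompl_of_isMinimalIn [IsCompactlyGenerated α] {F : Set α}
    (hF : ∀ P ∈ F, ∀ Q ∈ F, P ⊓ Q ∈ F)
    (hS : ∀ S ⊆ F, sSup S ∈ F) (h : sSup {P | IsMinimalIn F P} = ⊤) {b : α} (hb : b ∈ F) :
    ∃ s : Set α, s ⊆ {P | IsMinimalIn F P} ∧ sSupIndep s ∧ IsCompl b (sSup s) := by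
  have zorn := zorn_subset
    (S := {s : Set α | sSupIndep s ∧ Disjoint b (sSup s) ∧ ∀ a ∈ s, IsMinimalIn F a})
    fun c hc1 hc2 =>
      ⟨⋃₀ c,
        ⟨iSupIndep_sUnion_of_directed hc2.directedOn fun s hs => (hc1 hs).1, ?_,
          fun a ⟨s, sc, as⟩ => (hc1 sc).2.2 a as⟩,
        fun _ => Set.subset_sUnion_of_mem⟩
  swap
  · rw [sSup_sUnion, ← sSup_image, DirectedOn.disjoint_sSup_right]
    · rintro _ ⟨s, hs, rfl⟩
      exact (hc1 hs).2.1
    · rw [directedOn_image]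
      exact hc2.directedOn.mono @fun s t => sSup_le_sSup
  simp_rw [maximal_subset_iff] at zorn
  obtain ⟨s, ⟨s_ind, b_inf_Sup_s, s_atoms⟩, s_max⟩ := zorn
  refine ⟨s, fun a ha ↦ s_atoms a ha, s_ind, b_inf_Sup_s, codisjoint_iff.2 (le_antisymm le_top ?_)⟩
  rw [← h, sSup_le_iff]
  intro a ha
  rw [← inf_eq_left]
  have hmem : b ⊔ sSup s ∈ F := by
    rw [← sSup_pair]
    refine hS _ (Set.pair_subset hb (hS _ fun x hx => (s_atoms x hx).1))
  refine (ha.2.2 _ (hF a ha.1 _ hmem) inf_le_left).resolve_left fun con => ha.2.1 ?_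
  rw [← con, eq_comm, inf_eq_left]
  refine (le_sSup ?_).trans le_sup_right
  rw [← disjoint_iff] at con
  have a_dis_Sup_s : Disjoint a (sSup s) := con.mono_right le_sup_right
  rw [s_max ⟨fun x hx => ?_, ?_, fun x hx => ?_⟩ Set.subset_union_left]
  · exact Set.mem_union_right _ (Set.mem_singleton _)
  · rw [sSup_union, sSup_singleton]
    exact b_inf_Sup_s.disjoint_sup_right_of_disjoint_sup_left con.symm
  · rw [Set.mem_union, Set.mem_singleton_iff] at hx
    obtain rfl | xa := eq_or_ne x a
    · simp only [Set.mem_singleton, Set.insert_sdiff_of_mem, Set.union_singleton]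
      exact con.mono_right ((sSup_le_sSup Set.sdiff_subset).trans le_sup_right)
    · have h : (s ∪ {a}) \ {x} = s \ {x} ∪ {a} := by
        simp only [Set.union_singleton]
        rw [Set.insert_sdiff_of_notMem]
        rw [Set.mem_singleton_iff]
        exact Ne.symm xa
      rw [h, sSup_union, sSup_singleton]
      apply
        (s_ind (hx.resolve_right xa)).disjoint_sup_right_of_disjoint_sup_left
          (a_dis_Sup_s.mono_right _).symm
      rw [← sSup_insert, Set.insert_sdiff_singleton, Set.insert_eq_of_mem (hx.resolve_right xa)]
  · rw [Set.mem_union, Set.mem_singleton_iff] at hx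
    obtain hx | rfl := hx
    · exact s_atoms x hx
    · exact ha

/-- Otherwise the sum of the minimal members has a nonzero complement `J` in `F`. For `0 ≠ m ∈ J`,
let `N ≤ J` be maximal in `F` subject to `m ∉ N`. A complement `S` of `N` in `J` is minimal: a
proper splitting `S = Q ⊕ R` would put `m` in `(N ⊔ Q) ⊓ (N ⊔ R) = N`. But `S` is disjoint from all
minimal members. -/
theorem sSup_isMinimalIn_eq_top {A M : Type*} [Ring A] [AddCommGroup M] [Module A M]
    {F : Set (Submodule A M)} (hF : ∀ P ∈ F, ∀ Q ∈ F, P ⊓ Q ∈ F)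
    (hS : ∀ S ⊆ F, sSup S ∈ F) (h : ∀ P ∈ F, ∃ Q ∈ F, IsCompl P Q) :
    sSup {P | IsMinimalIn F P} = ⊤ := by
  have hsup : ∀ P ∈ F, ∀ Q ∈ F, P ⊔ Q ∈ F := fun P hP Q hQ => by
    rw [← sSup_pair]; exact hS _ (Set.pair_subset hP hQ)
  have relcompl : ∀ P ∈ F, ∀ Q ∈ F, P ≤ Q → ∃ R ∈ F, R ≤ Q ∧ Disjoint P R ∧ P ⊔ R = Q := by
    intro P hP Q hQ hPQ
    obtain ⟨R, hR, hc⟩ := h P hP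
    refine ⟨R ⊓ Q, hF R hR Q hQ, inf_le_right, hc.disjoint.mono_right inf_le_left, ?_⟩
    rw [← sup_inf_assoc_of_le R hPQ, hc.sup_eq_top, top_inf_eq]
  obtain ⟨J, hJ, hc⟩ := h (sSup {P | IsMinimalIn F P}) (hS _ fun P hP => hP.1)
  suffices hbot : J = ⊥ by simpa [hbot] using hc.sup_eq_top
  by_contra hne
  obtain ⟨m, hmJ, hm0⟩ := J.exists_mem_ne_zero_of_ne_bot hne
  obtain ⟨N, hN⟩ := zorn_le_nonempty₀ {P | P ∈ F ∧ P ≤ J ∧ m ∉ P} (by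
    intro c hc1 hc2 P hP
    refine ⟨sSup c, ⟨hS _ fun Q hQ => (hc1 hQ).1, sSup_le fun Q hQ => (hc1 hQ).2.1, ?_⟩,
      fun Q hQ => le_sSup hQ⟩
    rw [Submodule.mem_sSup_of_directed ⟨P, hP⟩ hc2.directedOn]
    rintro ⟨Q, hQ, hmQ⟩
    exact (hc1 hQ).2.2 hmQ) ⊥ ⟨by simpa using hS ∅ (Set.empty_subset _), bot_le, by simpa⟩
  obtain ⟨⟨hNF, hNJ, hmN⟩, hmax⟩ := hN.2
  have hmax' : ∀ Q ∈ F, Q ≤ J → N ≤ Q → Q ≠ N → m ∈ Q := fun Q hQ hQJ hNQ hQN => by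
    by_contra hmQ
    exact hQN (le_antisymm (hmax ⟨hQ, hQJ, hmQ⟩ hNQ) hNQ)
  obtain ⟨S, hSF, hSJ, hdis, hNS⟩ := relcompl N hNF J hJ hNJ
  have hS0 : S ≠ ⊥ := by
    rintro rfl
    rw [sup_bot_eq] at hNS
    exact hmN (hNS ▸ hmJ)
  have hmin : IsMinimalIn F S := by
    refine ⟨hSF, hS0, fun Q hQ hQS => ?_⟩
    by_contra! hcon
    obtain ⟨hQ0, hQne⟩ := hcon
    obtain ⟨R, hR, hRS, hQR, hQRS⟩ := relcompl Q hQ S hSF hQS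
    have hR0 : R ≠ ⊥ := by
      rintro rfl
      exact hQne (by simpa using hQRS)
    have aux : ∀ T ∈ F, T ≤ S → T ≠ ⊥ → m ∈ N ⊔ T := fun T hT hTS hT0 =>
      hmax' _ (hsup _ hNF _ hT) (sup_le hNJ (hTS.trans hSJ)) le_sup_left fun heq =>
        hT0 (le_bot_iff.1 (hdis (le_sup_right.trans heq.le) hTS))
    have hm1 := aux Q hQ hQS hQ0
    have hm2 := aux R hR hRS hR0
    have hd : (N ⊔ Q) ⊓ (N ⊔ R) ≤ N := by
      have hdd : Disjoint (N ⊔ Q) R := by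
        refine Disjoint.disjoint_sup_left_of_disjoint_sup_right hQR ?_
        rwa [hQRS]
      rw [sup_comm N R, ← inf_sup_assoc_of_le R (le_sup_left : N ≤ N ⊔ Q), hdd.eq_bot, bot_sup_eq]
    exact hmN (hd ⟨hm1, hm2⟩)
  exact hS0 (le_bot_iff.1 (hc.disjoint (le_sSup hmin) hSJ))

end Families


/-! ### Submodules stable under a family of operators -/

section Stable

variable {K M : Type*} [Field K] [AddCommGroup M] [Module K M] {ι : Type*}

/-- The subspace `N` is stable under the operators `a i`. -/
def Stable (a : ι → Module.End K M) (N : Submodule K M) : Prop :=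
  ∀ i, ∀ n ∈ N, a i n ∈ N

/-- Every stable subspace has a stable complement. -/
def StableComplemented (a : ι → Module.End K M) : Prop :=
  ∀ N, Stable a N → ∃ N', Stable a N' ∧ IsCompl N N'

variable {a : ι → Module.End K M}

theorem stable_sSup {S : Set (Submodule K M)} (h : ∀ N ∈ S, Stable a N) : Stable a (sSup S) := by
  intro i
  change sSup S ≤ (sSup S).comap (a i)
  exact sSup_le fun N hN n hn => le_sSup hN (h N hN i n hn)

theorem Stable.inf {N P : Submodule K M} (hN : Stable a N) (hP : Stable a P) :
    Stable a (N ⊓ P) :=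
  fun i n hn => ⟨hN i n hn.1, hP i n hn.2⟩

theorem Stable.adjoin {N : Submodule K M} (hN : Stable a N) {t : Module.End K M}
    (ht : t ∈ Algebra.adjoin K (Set.range a)) {n : M} (hn : n ∈ N) : t n ∈ N := by
  induction ht using Algebra.adjoin_induction generalizing n with
  | mem x hx => obtain ⟨i, rfl⟩ := hx; exact hN i n hn
  | algebraMap r => exact N.smul_mem r hn
  | add x y _ _ hx hy => exact N.add_mem (hx hn) (hy hn)
  | mul x y _ _ hx hy => exact hx (hy hn)

/-- A stable subspace as a submodule over the algebra generated by the operators. -/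
def Stable.toSubmodule {N : Submodule K M} (hN : Stable a N) :
    Submodule (Algebra.adjoin K (Set.range a)) M where
  carrier := N
  add_mem' := N.add_mem
  zero_mem' := N.zero_mem
  smul_mem' t _ hn := hN.adjoin t.2 hn

theorem stable_restrictScalars (N : Submodule (Algebra.adjoin K (Set.range a)) M) :
    Stable a (N.restrictScalars K) :=
  fun i _ hn => N.smul_mem ⟨a i, Algebra.subset_adjoin ⟨i, rfl⟩⟩ hn

theorem StableComplemented.isSemisimpleModule (h : StableComplemented a) :
    IsSemisimpleModule (Algebra.adjoin K (Set.range a)) M where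
  exists_isCompl N := by
    obtain ⟨N', hN', hc⟩ := h _ (stable_restrictScalars N)
    refine ⟨hN'.toSubmodule, disjoint_iff.2 ?_, codisjoint_iff.2 ?_⟩
    · refine le_bot_iff.1 fun x hx => ?_
      exact hc.disjoint.le_bot (show x ∈ N.restrictScalars K ⊓ N' from ⟨hx.1, hx.2⟩)
    · refine top_le_iff.1 fun x _ => ?_
      obtain ⟨y, hy, z, hz, rfl⟩ := Submodule.mem_sup.1 (hc.sup_eq_top.ge (Submodule.mem_top (x := x)))
      exact Submodule.add_mem_sup (hy : y ∈ N) (hz : z ∈ hN'.toSubmodule)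

/-- A stable complement yields an equivariant retraction of an equivariant embedding into an
equivariant quotient. -/
theorem StableComplemented.exists_retraction (h : StableComplemented a) {Q Z : Type*}
    [AddCommGroup Q] [Module K Q] [AddCommGroup Z] [Module K Z] {b : ι → Module.End K Q}
    {c : ι → Module.End K Z} {q : M →ₗ[K] Q} (hq : Function.Surjective q)
    (hqa : ∀ i m, q (a i m) = b i (q m)) {j : Z →ₗ[K] Q} (hj : Function.Injective j)
    (hjc : ∀ i z, j (c i z) = b i (j z)) :
    ∃ p : Q →ₗ[K] Z, (∀ z, p (j z) = z) ∧ ∀ i x, p (b i x) = c i (p x) := by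
  -- The complement is chosen upstairs, for the preimage of the range of `j`. Its image still meets
  -- that range trivially: if `q m` is in the range and `m ∈ N'`, then `m` lies in both summands.
  obtain ⟨N', hN', hc⟩ := h ((LinearMap.range j).comap q) (by
    rintro i n ⟨z, hz⟩
    exact ⟨c i z, by rw [hjc, hz, hqa]⟩)
  have hcompl : IsCompl (LinearMap.range j) (N'.map q) := by
    refine ⟨disjoint_iff.2 (le_bot_iff.1 ?_), codisjoint_iff.2 (top_le_iff.1 ?_)⟩
    · rintro _ ⟨hx, m, hm, rfl⟩
      have := hc.disjoint.le_bot (show m ∈ (LinearMap.range j).comap q ⊓ N' from ⟨hx, hm⟩)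
      simp [(Submodule.mem_bot K).1 this]
    · rintro x -
      obtain ⟨m, rfl⟩ := hq x
      obtain ⟨y, hy, z, hz, rfl⟩ := Submodule.mem_sup.1 (hc.sup_eq_top.ge (Submodule.mem_top (x := m)))
      rw [map_add]
      exact Submodule.add_mem_sup hy ⟨z, hz, rfl⟩
  refine ⟨j.linearProjOfIsCompl _ hj hcompl, fun z => by simp, fun i x => ?_⟩
  obtain ⟨_, ⟨z, rfl⟩, _, ⟨m, hm, rfl⟩, rfl⟩ :=
    Submodule.mem_sup.1 (hcompl.sup_eq_top.ge (Submodule.mem_top (x := x)))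
  have h0 : ∀ m ∈ N', j.linearProjOfIsCompl _ hj hcompl (q m) = 0 := fun m hm => by
    have : q m ∈ LinearMap.ker (j.linearProjOfIsCompl _ hj hcompl) := by
      rw [LinearMap.ker_linearProjOfIsCompl]; exact ⟨m, hm, rfl⟩
    exact this
  rw [map_add, map_add, map_add, ← hjc, ← hqa, h0 _ hm, h0 _ (hN' i m hm)]
  simp

end Stable

/-! ### Tensor products of semisimple actions over an algebraically closed field -/

section AlgClosed

variable {K X : Type*} [Field K] [AddCommGroup X] [Module K X] {ι κ : Type*}
  {a : ι → Module.End K X} {b : κ → Module.End K X}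

/-- The orbit of `x` under the commutant of the operators `a i`. -/
def commutantOrbit (a : ι → Module.End K X) (x : X) : Submodule K X where
  carrier := {y | ∃ φ : Module.End K X, (∀ i, Commute (a i) φ) ∧ φ x = y}
  add_mem' := by
    rintro _ _ ⟨φ, hφ, rfl⟩ ⟨ψ, hψ, rfl⟩
    exact ⟨φ + ψ, fun i => (hφ i).add_right (hψ i), rfl⟩
  zero_mem' := ⟨0, fun i => Commute.zero_right _, rfl⟩
  smul_mem' := by
    rintro c _ ⟨φ, hφ, rfl⟩
    exact ⟨c • φ, fun i => (hφ i).smul_right c, rfl⟩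

/-- An endomorphism commuting with the operators is linear over the algebra they generate. -/
def linearOfCommute (φ : Module.End K X) (h : ∀ i, Commute (a i) φ) :
    X →ₗ[Algebra.adjoin K (Set.range a)] X where
  toFun := φ
  map_add' := map_add φ
  map_smul' t x := by
    have ht : Commute (t : Module.End K X) φ := by
      have := t.2
      refine Algebra.adjoin_induction (p := fun t _ => Commute t φ) ?_ ?_ ?_ ?_ this
      · rintro _ ⟨i, rfl⟩; exact h i
      · intro r; exact Algebra.commutes r φ
      · intro x y _ _ hx hy; exact hx.add_left hy
      · intro x y _ _ hx hy; exact hx.mul_left hy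
    exact (LinearMap.congr_fun ht.eq x).symm

theorem commute_of_linear (φ : X →ₗ[Algebra.adjoin K (Set.range a)] X) (i : ι) :
    Commute (a i) (φ.restrictScalars K) :=
  LinearMap.ext fun x => (φ.map_smul ⟨a i, Algebra.subset_adjoin ⟨i, rfl⟩⟩ x).symm

/-- By Schur's lemma `φ` is injective on the simple submodule `S`, and semisimplicity of `M` extends
the inclusion of `S` along `φ`. -/
theorem exists_linear_apply_eq {T M : Type*} [Ring T] [AddCommGroup M] [Module T M]
    [IsSemisimpleModule T M] (S : Submodule T M) [IsSimpleModule T S] {x : M} (hx : x ∈ S)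
    (φ : M →ₗ[T] M) (h0 : φ x ≠ 0) : ∃ ψ : M →ₗ[T] M, ψ (φ x) = x := by
  have hinj : Function.Injective (φ ∘ₗ S.subtype) :=
    (LinearMap.injective_or_eq_zero _).resolve_right fun h => h0 (LinearMap.congr_fun h ⟨x, hx⟩)
  obtain ⟨ψ, hψ⟩ := IsSemisimpleModule.extension_property _ hinj S.subtype
  exact ⟨ψ, LinearMap.congr_fun hψ ⟨x, hx⟩⟩

/-- A nonzero element `φ x` of a stable `N` inside the orbit can be sent back to `x` by another
element of the commutant, so `N` contains `x` and with it the orbit. The hypothesis `hb` says that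
the operators `b` are as good as the whole commutant for detecting stable subspaces. -/
theorem isMinimalIn_commutantOrbit (ha : StableComplemented a) (hab : ∀ i j, Commute (a i) (b j))
    (hb : ∀ N, Stable b N → ∀ φ : Module.End K X, (∀ i, Commute (a i) φ) → ∀ n ∈ N, φ n ∈ N)
    (S : Submodule (Algebra.adjoin K (Set.range a)) X) [IsSimpleModule (Algebra.adjoin K (Set.range a)) S] {x : X} (hx : x ∈ S)
    (hx0 : x ≠ 0) : IsMinimalIn {N | Stable b N} (commutantOrbit a x) := by
  have := ha.isSemisimpleModule
  refine ⟨?_, ?_, fun N hN hle => or_iff_not_imp_left.2 fun hN0 => le_antisymm hle ?_⟩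
  · rintro j _ ⟨φ, hφ, rfl⟩
    exact ⟨b j * φ, fun i => (hab i j).mul_right (hφ i), rfl⟩
  · intro h
    have : x ∈ commutantOrbit a x := ⟨1, fun i => Commute.one_right _, rfl⟩
    rw [h] at this
    exact hx0 this
  · obtain ⟨y, hy, hy0⟩ := N.exists_mem_ne_zero_of_ne_bot hN0
    obtain ⟨φ, hφ, rfl⟩ := hle hy
    obtain ⟨ψ, hψ⟩ := exists_linear_apply_eq S hx (linearOfCommute φ hφ) hy0
    have hxN : x ∈ N := by
      have h1 := hb N hN (ψ.restrictScalars K) (commute_of_linear ψ) _ hy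
      rwa [LinearMap.restrictScalars_apply, show ψ (φ x) = x from hψ] at h1
    rintro _ ⟨χ, hχ, rfl⟩
    exact hb N hN χ hχ _ hxN

/-- Over an algebraically closed field the endomorphisms of a finite-dimensional simple module are
scalars, so every `K`-linear `g` is linear over the endomorphism ring and the density theorem
applies to it. -/
theorem exists_adjoin_smul_eq [IsAlgClosed K]
    (S : Submodule (Algebra.adjoin K (Set.range a)) X) [IsSimpleModule (Algebra.adjoin K (Set.range a)) S]
    [FiniteDimensional K S] (g : Module.End K S) (s : Finset S) :
    ∃ t : Algebra.adjoin K (Set.range a), ∀ m ∈ s, g m = t • m := by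
  have hbij := IsSimpleModule.algebraMap_end_bijective_of_isAlgClosed
    (A := Algebra.adjoin K (Set.range a)) (V := S) K
  let f : Module.End (Module.End (Algebra.adjoin K (Set.range a)) S) S :=
    { toFun := g
      map_add' := map_add g
      map_smul' := fun e m => by
        obtain ⟨c, rfl⟩ := hbij.2 e
        exact g.map_smul c m }
  exact jacobson_density f s

/-- The operators `a i ⊗ 1` and `1 ⊗ b j`. -/
noncomputable def tensorOps (a : ι → Module.End K X) (b : κ → Module.End K X) :
    ι ⊕ κ → Module.End K (X ⊗[K] X) :=
  Sum.elim (fun i => TensorProduct.map (a i) LinearMap.id)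
    (fun j => TensorProduct.map LinearMap.id (b j))

/-- Expand a nonzero element of a stable `N` as `∑ Bᵢ ⊗ Fᵢ` in a basis of `S`. By density some
operator from the first family sends one `Bᵢ` with `Fᵢ ≠ 0` to a prescribed `s` and kills the others
that occur. Hence `s ⊗ Fᵢ ∈ N`, and `{y ∈ Y | s ⊗ y ∈ N}` is a nonzero stable subspace of the
minimal `Y`. -/
theorem isMinimalIn_tensor [IsAlgClosed K]
    (S : Submodule (Algebra.adjoin K (Set.range a)) X) [IsSimpleModule (Algebra.adjoin K (Set.range a)) S]
    [FiniteDimensional K S] {Y : Submodule K X} (hY : IsMinimalIn {N | Stable b N} Y) :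
    IsMinimalIn {N | Stable (tensorOps a b) N} (Submodule.span K
      {t : X ⊗[K] X | ∃ s ∈ S, ∃ y ∈ Y, t = s ⊗ₜ y}) := by
  have key : ∀ N, Stable (tensorOps a b) N → ∀ z : S ⊗[K] Y, z ≠ 0 →
      TensorProduct.map (S.subtype.restrictScalars K) Y.subtype z ∈ N →
      ∀ s ∈ S, ∀ y ∈ Y, s ⊗ₜ[K] y ∈ N := by
    intro N hN z hz0 hz s hs y hy
    classical
    let B := Module.Basis.ofVectorSpace K S
    have hz1 : TensorProduct.equivFinsuppOfBasisLeft B z ≠ 0 := by simpa using hz0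
    obtain ⟨i₀, hi₀⟩ := Finsupp.ne_iff.1 hz1
    set F := TensorProduct.equivFinsuppOfBasisLeft (N := Y) B z with hF
    have hzF : z = F.sum fun i n => B i ⊗ₜ[K] n := by
      rw [← TensorProduct.equivFinsuppOfBasisLeft_symm_apply, hF, LinearEquiv.symm_apply_apply]
    obtain ⟨t, ht⟩ := exists_adjoin_smul_eq S (B.constr K fun i => if i = i₀ then ⟨s, hs⟩ else 0)
      (F.support.image B)
    have hadj : ∀ t ∈ Algebra.adjoin K (Set.range a), ∀ n ∈ N,
        TensorProduct.map t LinearMap.id n ∈ N := by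
      intro t ht
      induction ht using Algebra.adjoin_induction with
      | mem x hx => obtain ⟨i, rfl⟩ := hx; exact hN (Sum.inl i)
      | algebraMap r =>
        intro n hn
        have : TensorProduct.map (algebraMap K (Module.End K X) r) LinearMap.id n = r • n := by
          rw [Algebra.algebraMap_eq_smul_one, TensorProduct.map_smul_left]
          simp [Module.End.one_eq_id]
        rw [this]; exact N.smul_mem r hn
      | add x y _ _ hx hy =>
        intro n hn
        rw [TensorProduct.map_add_left]
        exact N.add_mem (hx n hn) (hy n hn)
      | mul x y _ _ hx hy =>
        intro n hn
        have : TensorProduct.map (x * y) LinearMap.id n =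
            TensorProduct.map x LinearMap.id (TensorProduct.map y LinearMap.id n) := by
          rw [← LinearMap.comp_apply, ← TensorProduct.map_comp]; rfl
        rw [this]; exact hx _ (hy n hn)
    have h1 := hadj t t.2 _ hz
    have h2 : TensorProduct.map (t : Module.End K X) LinearMap.id
        (TensorProduct.map (S.subtype.restrictScalars K) Y.subtype z) =
        s ⊗ₜ[K] (F i₀ : X) := by
      rw [hzF, Finsupp.sum, map_sum, map_sum, Finset.sum_eq_single i₀]
      · simp only [TensorProduct.map_tmul]
        have := ht (B i₀) (Finset.mem_image_of_mem _ (Finsupp.mem_support_iff.2 hi₀))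
        rw [B.constr_basis, if_pos rfl] at this
        have := congrArg Subtype.val this
        change s = (t : Module.End K X) (B i₀ : X) at this
        change (t : Module.End K X) (B i₀ : X) ⊗ₜ[K] (F i₀ : X) = _
        rw [← this]
      · intro i hi hne
        simp only [TensorProduct.map_tmul]
        have := ht (B i) (Finset.mem_image_of_mem _ hi)
        rw [B.constr_basis, if_neg hne] at this
        have := congrArg Subtype.val this
        change 0 = (t : Module.End K X) (B i : X) at this
        change (t : Module.End K X) (B i : X) ⊗ₜ[K] (F i : X) = _
        rw [← this, TensorProduct.zero_tmul]
      · intro h; exact absurd (Finsupp.notMem_support_iff.1 h) hi₀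
    rw [h2] at h1
    have hst : Stable b (N.comap (TensorProduct.mk K X X s) ⊓ Y) :=
      Stable.inf (fun j n hn => hN (Sum.inr j) _ hn) hY.1
    rcases hY.2.2 _ hst inf_le_right with h | h
    · exfalso
      have : (F i₀ : X) ∈ N.comap (TensorProduct.mk K X X s) ⊓ Y := ⟨h1, (F i₀).2⟩
      rw [h] at this
      exact hi₀ (Subtype.ext this)
    · have : y ∈ N.comap (TensorProduct.mk K X X s) ⊓ Y := by rwa [h]
      exact this.1
  refine ⟨?_, ?_, fun N hN hle => or_iff_not_imp_left.2 fun hN0 => le_antisymm hle ?_⟩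
  · rintro (i | j)
    · change Submodule.span K _ ≤ (Submodule.span K _).comap (TensorProduct.map (a i) LinearMap.id)
      refine Submodule.span_le.2 ?_
      rintro _ ⟨s, hs, y, hy, rfl⟩
      exact Submodule.subset_span ⟨a i s, stable_restrictScalars S i s hs, y, hy, rfl⟩
    · change Submodule.span K _ ≤ (Submodule.span K _).comap (TensorProduct.map LinearMap.id (b j))
      refine Submodule.span_le.2 ?_
      rintro _ ⟨s, hs, y, hy, rfl⟩
      exact Submodule.subset_span ⟨s, hs, b j y, hY.1 j y hy, rfl⟩
  · have hn := IsSimpleModule.nontrivial (Algebra.adjoin K (Set.range a)) S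
    obtain ⟨s, hs⟩ := exists_ne (0 : S)
    obtain ⟨y, hy, hy0⟩ := Y.exists_mem_ne_zero_of_ne_bot hY.2.1
    intro h
    have hmem : (s : X) ⊗ₜ[K] y ∈ Submodule.span K
        {t : X ⊗[K] X | ∃ s ∈ S, ∃ y ∈ Y, t = s ⊗ₜ y} :=
      Submodule.subset_span ⟨s, s.2, y, hy, rfl⟩
    rw [h, Submodule.mem_bot] at hmem
    obtain ⟨f, hf⟩ := LinearMap.exists_leftInverse_of_injective
      (LinearMap.toSpanSingleton K X s) (LinearMap.ker_eq_bot.2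
        (smul_left_injective K fun h => hs (Subtype.ext h)))
    have hf1 : f s = 1 := by simpa using LinearMap.congr_fun hf 1
    have := congrArg (TensorProduct.lid K X ∘ TensorProduct.map f LinearMap.id) hmem
    simp [hf1] at this
    exact hy0 this
  · obtain ⟨n, hn, hn0⟩ := N.exists_mem_ne_zero_of_ne_bot hN0
    have hrange : Submodule.span K {t : X ⊗[K] X | ∃ s ∈ S, ∃ y ∈ Y, t = s ⊗ₜ y} ≤
        LinearMap.range (TensorProduct.map (S.subtype.restrictScalars K) Y.subtype) := by
      refine Submodule.span_le.2 ?_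
      rintro _ ⟨s, hs, y, hy, rfl⟩
      exact ⟨(⟨s, hs⟩ : S) ⊗ₜ (⟨y, hy⟩ : Y), rfl⟩
    obtain ⟨z, rfl⟩ := hrange (hle hn)
    have hz0 : z ≠ 0 := by rintro rfl; exact hn0 (map_zero _)
    refine Submodule.span_le.2 ?_
    rintro _ ⟨s, hs, y, hy, rfl⟩
    exact key N hN z hz0 hn s hs y hy

/-- Pure tensors of vectors taken from simple submodules span `X ⊗ X`, and each of them lies in a
minimal stable subspace: the product of a simple submodule with a commutant orbit. Complements then
follow from the lattice argument. -/
theorem StableComplemented.tensorOps [IsAlgClosed K] (ha : StableComplemented a)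
    (hab : ∀ i j, Commute (a i) (b j))
    (hfin : ∀ x, ∃ V : Submodule K X, FiniteDimensional K V ∧ Stable a V ∧ x ∈ V)
    (hb : ∀ N, Stable b N → ∀ φ : Module.End K X, (∀ i, Commute (a i) φ) → ∀ n ∈ N, φ n ∈ N) :
    StableComplemented (tensorOps a b) := by
  have := ha.isSemisimpleModule
  have htop := IsSemisimpleModule.sSup_simples_eq_top (Algebra.adjoin K (Set.range a)) X
  have hsS : ∀ s : X, s ∈ Submodule.span K {x : X | ∃ S : Submodule (Algebra.adjoin K (Set.range a)) X,
      IsSimpleModule (Algebra.adjoin K (Set.range a)) S ∧ x ∈ S} := by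
    intro s
    have : s ∈ ⨆ S : ↥{S : Submodule (Algebra.adjoin K (Set.range a)) X |
      IsSimpleModule (Algebra.adjoin K (Set.range a)) S}, (S.1 : Submodule (Algebra.adjoin K (Set.range a)) X) := by
      rw [← sSup_eq_iSup', htop]; trivial
    refine Submodule.iSup_induction _ (motive := fun s => s ∈ Submodule.span K _) this ?_ ?_ ?_
    · intro S x hx
      exact Submodule.subset_span ⟨S, S.2, hx⟩
    · exact Submodule.zero_mem _
    · exact fun x y hx hy => Submodule.add_mem _ hx hy
  suffices h : sSup {P | IsMinimalIn {N | Stable (Coseparable.tensorOps a b) N} P} = ⊤ by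
    intro N hN
    obtain ⟨s, hs, -, hc⟩ := exists_sSupIndep_isCompl_of_isMinimalIn
      (F := {N | Stable (Coseparable.tensorOps a b) N})
      (fun P hP Q hQ => Stable.inf hP hQ) (fun S hS => stable_sSup fun N hN => hS hN) h hN
    exact ⟨_, stable_sSup fun N hN => (hs hN).1, hc⟩
  rw [eq_top_iff]
  rintro t -
  induction t using TensorProduct.induction_on with
  | zero => exact Submodule.zero_mem _
  | add t t' h h' => exact Submodule.add_mem _ h h'
  | tmul x y =>
    have hle : ∀ x', (∃ S : Submodule (Algebra.adjoin K (Set.range a)) X,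
        IsSimpleModule (Algebra.adjoin K (Set.range a)) S ∧ x' ∈ S) → ∀ y',
        (∃ S : Submodule (Algebra.adjoin K (Set.range a)) X,
        IsSimpleModule (Algebra.adjoin K (Set.range a)) S ∧ y' ∈ S) → x' ⊗ₜ[K] y' ∈
        sSup {P | IsMinimalIn {N | Stable (Coseparable.tensorOps a b) N} P} := by
      rintro x' ⟨S, hS, hx'⟩ y' ⟨S', hS', hy'⟩
      by_cases hy0 : y' = 0
      · rw [hy0, TensorProduct.tmul_zero]; exact Submodule.zero_mem _
      by_cases hx0 : x' = 0
      · rw [hx0, TensorProduct.zero_tmul]; exact Submodule.zero_mem _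
      have hY := isMinimalIn_commutantOrbit ha hab hb S' hy' hy0
      obtain ⟨V, hV, hVa, hxV⟩ := hfin x'
      -- The simple `S` meets the finite-dimensional stable subspace `V` in the nonzero vector `x'`,
      -- so it is contained in `V`.
      have hSV : (S.restrictScalars K) ≤ V := by
        have hs : S ≤ hVa.toSubmodule := by
          have hatom := (isSimpleModule_iff_isAtom).1 hS
          have hne : S ⊓ hVa.toSubmodule ≠ ⊥ := fun h => hx0 (by
            have : x' ∈ S ⊓ hVa.toSubmodule := ⟨hx', hxV⟩
            rw [h] at this
            exact this)
          exact inf_eq_left.1 ((hatom.le_iff.1 inf_le_left).resolve_left hne)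
        exact fun s hs' => hs hs'
      have : FiniteDimensional K S :=
        Submodule.finiteDimensional_of_le (S₁ := S.restrictScalars K) hSV
      exact le_sSup (a := Submodule.span K {t : X ⊗[K] X | ∃ s ∈ S,
          ∃ y ∈ commutantOrbit a y', t = s ⊗ₜ y}) (isMinimalIn_tensor (b := b) S hY)
        (Submodule.subset_span ⟨x', hx', y', ⟨1, fun i => Commute.one_right _, rfl⟩, rfl⟩)
    have h1 : ∀ x', (∃ S : Submodule (Algebra.adjoin K (Set.range a)) X,
        IsSimpleModule (Algebra.adjoin K (Set.range a)) S ∧ x' ∈ S) → x' ⊗ₜ[K] y ∈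
        sSup {P | IsMinimalIn {N | Stable (Coseparable.tensorOps a b) N} P} := fun x' hx' =>
      Submodule.span_le (p := (sSup _ : Submodule K _).comap (TensorProduct.mk K X X x')).2
        (fun y' hy' => hle x' hx' y' hy') (hsS y)
    exact Submodule.span_le
      (p := (sSup _ : Submodule K _).comap ((TensorProduct.mk K X X).flip y)).2
        (fun x' hx' => h1 x' hx') (hsS x)

end AlgClosed


/-! ### Images of subspaces under `M ⊗_B -`, and exactness. -/

namespace Bimodule

section TensorRange

variable {k A A' B R S : Type u} [CommRing k] [Ring A] [Algebra k A] [Ring A'] [Algebra k A']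
  [Ring B] [Algebra k B] [Ring R] [Algebra k R] [Ring S] [Algebra k S]

/-- The subspace of `M ⊗_B N` spanned by the tensors `m ⊗ p` with `p ∈ P`. -/
def tensorRange (M : Bimodule k A B) (N : Bimodule k B R) (P : Set N) : Submodule k (M.tensor N) :=
  Submodule.span k {t | ∃ m : M, ∃ p ∈ P, t = tmul m p}

variable {M : Bimodule k A B} {N : Bimodule k B R}

theorem tmul_mem_tensorRange {P : Set N} (m : M) {p : N} (hp : p ∈ P) :
    tmul m p ∈ tensorRange M N P :=
  Submodule.subset_span ⟨m, p, hp, rfl⟩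

theorem tensorRange_le {P : Set N} {W : Submodule k (M.tensor N)}
    (h : ∀ m : M, ∀ p ∈ P, tmul m p ∈ W) : tensorRange M N P ≤ W :=
  Submodule.span_le.2 (by rintro _ ⟨m, p, hp, rfl⟩; exact h m p hp)

theorem tensorRange_univ : tensorRange M N Set.univ = ⊤ := by
  refine top_le_iff.1 ?_
  have : (Submodule.mkQ (tensorRange M N Set.univ)) = 0 := tensor_ext fun m n =>
    (Submodule.Quotient.mk_eq_zero _).2 (tmul_mem_tensorRange m (Set.mem_univ n))
  intro x _
  exact (Submodule.Quotient.mk_eq_zero _).1 (LinearMap.congr_fun this x)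

theorem tensorRange_mono {P Q : Set N} (h : P ⊆ Q) : tensorRange M N P ≤ tensorRange M N Q :=
  tensorRange_le fun m _ hp => tmul_mem_tensorRange m (h hp)

theorem tmul_sub (m : M) (n n' : N) : tmul m (n - n') = tmul m n - tmul m n' :=
  map_sub (tmulBilin M N m) n n'

theorem tmul_sum {ι : Type*} (s : Finset ι) (m : M) (n : ι → N) :
    tmul m (∑ i ∈ s, n i) = ∑ i ∈ s, tmul m (n i) :=
  map_sum (tmulBilin M N m) n s

theorem sum_tmul {ι : Type*} (s : Finset ι) (m : ι → M) (n : N) :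
    tmul (∑ i ∈ s, m i) n = ∑ i ∈ s, tmul (m i) n :=
  map_sum ((tmulBilin M N).flip n) m s

theorem map_tensorRange {R' : Type u} [Ring R'] [Algebra k R'] {M' : Bimodule k A' B}
    {N' : Bimodule k B R'} {P : Set N} {P' : Submodule k (M'.tensor N')}
    (f : M.tensor N →ₗ[k] M'.tensor N') (h : ∀ m : M, ∀ p ∈ P, f (tmul m p) ∈ P') {x : M.tensor N}
    (hx : x ∈ tensorRange M N P) : f x ∈ P' :=
  tensorRange_le (W := P'.comap f) h hx

theorem tensor_induction {p : M.tensor N → Prop} (zero : p 0) (add : ∀ x y, p x → p y → p (x + y))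
    (tmul : ∀ m n, p (tmul m n)) (x : M.tensor N) : p x := by
  obtain ⟨y, rfl⟩ := (balanced M N).mkQ_surjective x
  induction y using TensorProduct.induction_on with
  | zero => exact zero
  | add y y' hy hy' => exact add _ _ hy hy'
  | tmul m n => exact tmul m n

theorem exists_sum_tmul (x : M.tensor N) :
    ∃ (n : ℕ) (m : Fin n → M) (p : Fin n → N), x = ∑ i, tmul (m i) (p i) := by
  induction x using tensor_induction with
  | zero => exact ⟨0, Fin.elim0, Fin.elim0, by simp⟩
  | add x y hx hy =>
    obtain ⟨n, m, p, rfl⟩ := hx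
    obtain ⟨n', m', p', rfl⟩ := hy
    exact ⟨n + n', Fin.append m m', Fin.append p p', by simp [Fin.sum_univ_add]⟩
  | tmul m p => exact ⟨1, fun _ => m, fun _ => p, by simp⟩

/-- The vanishing of `m ⊗ n` modulo the kernel of a surjection. -/
theorem mem_tensorRange_ker {N' : Bimodule k B S} (g : N →ₗ[k] N')
    (hg : ∀ (b : B) (n : N), g (b • n) = b • g n)
    (hs : Function.Surjective g) {f : M.tensor N →ₗ[k] M.tensor N'}
    (hf : ∀ m n, f (tmul m n) = tmul m (g n)) {x : M.tensor N} (hx : f x = 0) :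
    x ∈ tensorRange M N {n | g n = 0} := by
  let W := tensorRange M N {n | g n = 0}
  have key : ∀ (m : M) (n n' : N), g n = g n' → W.mkQ (tmul m n) = W.mkQ (tmul m n') := by
    intro m n n' h
    rw [← sub_eq_zero, ← map_sub, ← tmul_sub]
    refine (Submodule.Quotient.mk_eq_zero _).2 (tmul_mem_tensorRange m ?_)
    change g (n - n') = 0
    rw [map_sub, h, sub_self]
  -- Right exactness of the tensor product. A set-theoretic section suffices: two lifts of an
  -- element of `N'` differ by an element of the kernel, so `m ⊗ n' ↦ m ⊗ s n'` is bilinear and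
  -- balanced modulo `W`, and it recovers the class of `x` from `f x`.
  let s := Function.surjInv hs
  have hsg : ∀ n, g (s n) = n := Function.surjInv_eq hs
  let F : M →ₗ[k] N' →ₗ[k] (M.tensor N) ⧸ W := LinearMap.mk₂ k
    (fun m n => W.mkQ (tmulBilin M N m (s n)))
    (fun m m' n => by simp only [map_add, LinearMap.add_apply])
    (fun c m n => by simp only [map_smul, LinearMap.smul_apply])
    (fun m n n' => by
      rw [← map_add, ← map_add]
      exact key _ _ _ (by rw [hsg, map_add, hsg, hsg]))
    (fun c m n => by
      rw [← map_smul, ← map_smul]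
      exact key _ _ _ (by rw [hsg, map_smul, hsg]))
  let G : M.tensor N' →ₗ[k] (M.tensor N) ⧸ W := lift F (fun m b n => by
    change W.mkQ (tmul (op b • m) (s n)) = W.mkQ (tmul m (s (b • n)))
    rw [smul_tmul]
    exact key _ _ _ (by rw [hg, hsg, hsg]))
  have hG : G ∘ₗ f = W.mkQ := tensor_ext fun m n => by
    rw [LinearMap.comp_apply, hf]
    exact key _ _ _ (hsg _)
  refine (Submodule.Quotient.mk_eq_zero _).1 ?_
  change W.mkQ x = 0
  rw [← hG, LinearMap.comp_apply, hx, map_zero]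

/-- A left module as an `A`-`k`-bimodule. -/
@[reducible]
def ofLeftModule (k A Q : Type u) [CommRing k] [Ring A] [Algebra k A] [AddCommGroup Q] [Module k Q]
    [Module A Q] [IsScalarTower k A Q] : Bimodule k A k :=
  letI _iR : Module kᵐᵒᵖ Q := Module.compHom Q ((AlgEquiv.toOpposite k k).symm : kᵐᵒᵖ →+* k)
  haveI _tR : IsScalarTower k kᵐᵒᵖ Q := ⟨fun c b x => by
    change (c • unop b) • x = c • (unop b • x)
    exact smul_assoc c (unop b) x⟩
  haveI _sc : SMulCommClass A kᵐᵒᵖ Q := ⟨fun a c x => by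
    change a • (unop c • x) = unop c • (a • x)
    exact smul_comm a (unop c) x⟩
  { carrier := Q }

/-- A linear map between left modules as a homomorphism of bimodules. -/
def Hom.ofLinear {N N' : Bimodule k A k} (f : N →ₗ[A] N') : Hom N N' where
  toLin := f.restrictScalars k
  map_left a n := f.map_smul a n
  map_right c n := by rw [op_base_smul, op_base_smul, map_smul]

/-- A homomorphism of bimodules as a linear map of left modules. -/
def Hom.toLinear {N N' : Bimodule k A B} (f : Hom N N') : N →ₗ[A] N' where
  toFun := f
  map_add' := map_add f.toLin
  map_smul' := f.map_left

/-- A submodule of a left module, as a bimodule. -/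
@[reducible]
def sub (N : Bimodule k A k) (P : Submodule A N) : Bimodule k A k := ofLeftModule k A P

/-- The inclusion of a submodule. -/
def incl (N : Bimodule k A k) (P : Submodule A N) : Hom (N.sub P) N :=
  Hom.ofLinear (N := N.sub P) P.subtype

/-- Factor `h` through its range: flatness removes the inclusion of the range, and right exactness
treats the surjection onto it. -/
theorem IsRightFlat.mem_tensorRange_ker (hM : M.IsRightFlat) {N N' : Bimodule k B k} (h : Hom N N')
    {x : M.tensor N} (hx : map (Hom.id M) h x = 0) : x ∈ tensorRange M N {n | h n = 0} := by
  let P := LinearMap.range h.toLinear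
  let h' : Hom N (N'.sub P) := Hom.ofLinear (N' := N'.sub P) h.toLinear.rangeRestrict
  have h1 : map (Hom.id M) h' x = 0 := by
    refine hM (N'.sub P) N' (incl N' P) Subtype.val_injective ?_
    rw [map_zero, ← hx]
    exact LinearMap.congr_fun (tensor_ext
      (f := (map (Hom.id M) (incl N' P)).toLin ∘ₗ (map (Hom.id M) h').toLin)
      (g := (map (Hom.id M) h).toLin) fun _ _ => rfl) x
  refine tensorRange_mono ?_ (Bimodule.mem_tensorRange_ker (N' := N'.sub P) h'.toLin h'.map_left
    h.toLinear.surjective_rangeRestrict (f := (map (Hom.id M) h').toLin) (fun _ _ => rfl) h1)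
  intro n hn
  exact congrArg Subtype.val (show h' n = 0 from hn)

theorem tensorRange_eq_range (M : Bimodule k A B) (N : Bimodule k B k) (P : Submodule B N) :
    tensorRange M N P = LinearMap.range (map (Hom.id M) (incl N P)).toLin := by
  refine le_antisymm (tensorRange_le fun m p hp => ⟨tmul m (⟨p, hp⟩ : P), rfl⟩) ?_
  rintro _ ⟨x, rfl⟩
  induction x using tensor_induction with
  | zero => rw [map_zero]; exact Submodule.zero_mem _
  | add x y hx hy => rw [map_add]; exact Submodule.add_mem _ hx hy
  | tmul m p => exact tmul_mem_tensorRange m p.2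

/-- `P ⊓ Q` is the kernel of `P → N / Q`, and flatness makes `M ⊗_B -` preserve this kernel. This is
why subcomodules over a flat coring are closed under intersection. -/
theorem IsRightFlat.tensorRange_inf (hM : M.IsRightFlat) {N : Bimodule k B k}
    (P Q : Submodule B N) :
    tensorRange M N P ⊓ tensorRange M N Q ≤ tensorRange M N (P ⊓ Q : Submodule B N) := by
  rintro x ⟨hxP, hxQ⟩
  rw [tensorRange_eq_range] at hxP
  obtain ⟨y, rfl⟩ := hxP
  let N' : Bimodule k B k := ofLeftModule k B (N ⧸ Q)
  let g : Hom N N' := Hom.ofLinear (N' := N') Q.mkQ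
  have h0 : map (Hom.id M) g (map (Hom.id M) (incl N P) y) = 0 := by
    have : tensorRange M N Q ≤ LinearMap.ker (map (Hom.id M) g).toLin :=
      tensorRange_le fun m q hq => by
        change tmul m (g q) = 0
        rw [show g q = 0 from (Submodule.Quotient.mk_eq_zero Q).2 hq]
        exact map_zero (tmulBilin M N' m)
    exact this hxQ
  have h1 : map (Hom.id M) (g.comp (incl N P)) y = 0 := by
    rw [← h0]
    exact LinearMap.congr_fun (tensor_ext
      (f := (map (Hom.id M) (g.comp (incl N P))).toLin)
      (g := (map (Hom.id M) g).toLin ∘ₗ (map (Hom.id M) (incl N P)).toLin) fun _ _ => rfl) y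
  refine map_tensorRange _ ?_ (hM.mem_tensorRange_ker _ h1)
  intro m p hp
  exact tmul_mem_tensorRange (N := N) m ⟨p.2, (Submodule.Quotient.mk_eq_zero Q).1 hp⟩

end TensorRange

/-! ### Maps that are linear on one side only -/

section OneSided

variable {k A A' B R R' S : Type u} [CommRing k] [Ring A] [Algebra k A] [Ring A'] [Algebra k A']
  [Ring B] [Algebra k B] [Ring R] [Algebra k R] [Ring R'] [Algebra k R'] [Ring S] [Algebra k S]

/-- The `k`-linear map `f` is linear for the right actions. -/
def IsRightLinear {M : Bimodule k A B} {M' : Bimodule k A' B} (f : M →ₗ[k] M') : Prop :=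
  ∀ (b : B) (m : M), f (op b • m) = op b • f m

/-- The `k`-linear map `g` is linear for the left actions. -/
def IsLeftLinear {N : Bimodule k B R} {N' : Bimodule k B R'} (g : N →ₗ[k] N') : Prop :=
  ∀ (b : B) (n : N), g (b • n) = b • g n

/-- The map `f ⊗_B g` for a right linear map `f` and a left linear map `g`. -/
def mapOneSided {M : Bimodule k A B} {M' : Bimodule k A' B} {N : Bimodule k B R}
    {N' : Bimodule k B R'} (f : M →ₗ[k] M') (hf : IsRightLinear f) (g : N →ₗ[k] N')
    (hg : IsLeftLinear g) : M.tensor N →ₗ[k] M'.tensor N' :=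
  lift ((tmulBilin M' N').compl₁₂ f g) (by
    intro m b n
    change tmul (f (op b • m)) (g n) = tmul (f m) (g (b • n))
    rw [hf, hg, smul_tmul])

theorem isLeftLinear_id {N : Bimodule k B R} :
    IsLeftLinear (LinearMap.id : N →ₗ[k] N) := fun _ _ => rfl

theorem isRightLinear_id {N : Bimodule k B R} :
    IsRightLinear (LinearMap.id : N →ₗ[k] N) := fun _ _ => rfl

/-- The map `f ⊗_B N` for a right linear map `f`. -/
def mapLeft {M : Bimodule k A B} {M' : Bimodule k A' B} (f : M →ₗ[k] M') (hf : IsRightLinear f)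
    (N : Bimodule k B R) : M.tensor N →ₗ[k] M'.tensor N :=
  mapOneSided f hf LinearMap.id isLeftLinear_id

/-- The map `M ⊗_B g` for a left linear map `g`. -/
def mapRight (M : Bimodule k A B) {N : Bimodule k B R} {N' : Bimodule k B R'} (g : N →ₗ[k] N')
    (hg : IsLeftLinear g) : M.tensor N →ₗ[k] M.tensor N' :=
  mapOneSided LinearMap.id isRightLinear_id g hg

/-- The map `m ⊗ n ↦ f(m) n` for a right linear form `f`. -/
def contract {M : Bimodule k A B} (f : M →ₗ[k] regular k B) (hf : IsRightLinear f)
    (N : Bimodule k B R) : M.tensor N →ₗ[k] N :=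
  lid N ∘ₗ mapLeft f hf N

theorem contract_tmul {M : Bimodule k A B} (f : M →ₗ[k] regular k B) (hf : IsRightLinear f)
    {N : Bimodule k B R} (m : M) (n : N) : contract f hf N (tmul m n) = (f m : B) • n := rfl

/-- Finitely many elements of `M` lie in the image of a finite family of dual basis projections for
the right module structure. -/
def HasLocalDual (M : Bimodule k A B) : Prop :=
  ∀ s : Finset M, ∃ (n : ℕ) (c : Fin n → M) (f : Fin n → M →ₗ[k] regular k B),
    (∀ i, IsRightLinear (f i)) ∧ ∀ m ∈ s, m = ∑ i, op (f i m : B) • c i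

/-- Only finitely many left factors occur in chosen expressions of the elements of `s`; one local
dual basis serves them all, and its coefficients move across the tensor sign. -/
theorem HasLocalDual.exists_tensor {M : Bimodule k A B} (hM : M.HasLocalDual)
    {N : Bimodule k B R} (s : Finset (M.tensor N)) :
    ∃ (n : ℕ) (c : Fin n → M) (f : Fin n → M →ₗ[k] regular k B) (hf : ∀ i, IsRightLinear (f i)),
      ∀ x ∈ s, x = ∑ i, tmul (c i) (contract (f i) (hf i) N x) := by
  classical
  choose n m p hx using fun x : M.tensor N => exists_sum_tmul x
  obtain ⟨l, c, f, hf, h⟩ := hM (s.biUnion fun x => Finset.univ.image (m x))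
  refine ⟨l, c, f, hf, fun x hxs => ?_⟩
  have key : ∀ i, tmul (m x i) (p x i) =
      ∑ j, tmul (c j) (contract (f j) (hf j) N (tmul (m x i) (p x i))) := by
    intro i
    have hmem : m x i ∈ s.biUnion fun x => Finset.univ.image (m x) :=
      Finset.mem_biUnion.2 ⟨x, hxs, Finset.mem_image_of_mem _ (Finset.mem_univ i)⟩
    conv_lhs => rw [h _ hmem, sum_tmul]
    exact Finset.sum_congr rfl fun j _ => smul_tmul _ _ _
  conv_lhs => rw [hx x, Finset.sum_congr rfl fun i _ => key i, Finset.sum_comm]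
  refine Finset.sum_congr rfl fun j _ => ?_
  conv_rhs => rw [hx x]
  rw [map_sum, tmul_sum]

/-- The contractions `m ⊗ n ↦ f(m) n` are natural in `N`, and by the dual basis expansion a tensor
with all contractions zero is zero. -/
theorem HasLocalDual.isRightFlat {M : Bimodule k A B} (hM : M.HasLocalDual) : M.IsRightFlat := by
  intro N N' g hg
  refine (injective_iff_map_eq_zero (map (Hom.id M) g).toLin).2 fun x hx => ?_
  obtain ⟨n, c, f, hf, h⟩ := hM.exists_tensor {x}
  rw [h x (Finset.mem_singleton_self x)]
  refine Finset.sum_eq_zero fun i _ => ?_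
  have h1 : g (contract (f i) (hf i) N x) = contract (f i) (hf i) N' (map (Hom.id M) g x) :=
    LinearMap.congr_fun (tensor_ext (f := g.toLin ∘ₗ contract (f i) (hf i) N)
      (g := contract (f i) (hf i) N' ∘ₗ (map (Hom.id M) g).toLin)
      fun m n => g.map_left _ _) x
  have h2 : contract (f i) (hf i) N x = 0 := hg (by
    rw [h1]
    erw [hx]
    rw [map_zero, map_zero])
  rw [h2]
  exact map_zero (tmulBilin M N (c i))

theorem hasLocalDual_regular : (regular k A).HasLocalDual := fun _ =>
  ⟨1, fun _ => (1 : A), fun _ => LinearMap.id, fun _ => isRightLinear_id, fun m _ => by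
    rw [Finset.univ_unique, Finset.sum_singleton]
    exact (one_mul (m : A)).symm⟩

end OneSided

end Bimodule

open Bimodule

/-! ### Casimir elements -/

section Casimir

/-- There is an element `∑ xᵢ ⊗ yᵢ` of `A ⊗ A` that commutes with `A` and is mapped to `1` by the
multiplication. -/
def HasCasimir (k A : Type u) [CommRing k] [Ring A] [Algebra k A] : Prop :=
  ∃ (n : ℕ) (x y : Fin n → A), ∑ i, x i * y i = 1 ∧
    ∀ a : A, ∑ i, (a * x i) ⊗ₜ[k] y i = ∑ i, x i ⊗ₜ[k] (y i * a)

/-- The element is `θ 1`; computing `θ a` from `a * 1` and from `1 * a` gives centrality. -/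
theorem IsSeparableAlgebra.hasCasimir {k A : Type u} [CommRing k] [Ring A] [Algebra k A]
    (h : IsSeparableAlgebra k A) : HasCasimir k A := by
  obtain ⟨θ, hθ, hμ⟩ := h
  obtain ⟨S, hS⟩ := TensorProduct.exists_finset (θ 1)
  let e := S.equivFin
  have he : θ 1 = ∑ i, (e.symm i).1.1 ⊗ₜ[k] (e.symm i).1.2 := by
    rw [hS, ← Finset.sum_coe_sort, ← e.symm.sum_comp]
  refine ⟨S.card, fun i => (e.symm i).1.1, fun i => (e.symm i).1.2, ?_, fun a => ?_⟩
  · have := hμ 1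
    rw [he, map_sum] at this
    simpa using this
  · have h1 := hθ a 1 1
    have h2 := hθ 1 1 a
    rw [mul_one, mul_one] at h1
    rw [mul_one, one_mul] at h2
    rw [h1, he, map_sum, map_sum] at h2
    simpa using h2

variable {k A A' : Type u} [Field k] [Ring A] [Algebra k A] [Ring A'] [Algebra k A']

/-- The two tensor factors of the Casimir element trade places. -/
theorem HasCasimir.opposite (h : HasCasimir k A) : HasCasimir k Aᵐᵒᵖ := by
  obtain ⟨n, x, y, h1, h2⟩ := h
  refine ⟨n, fun i => MulOpposite.op (y i), fun i => MulOpposite.op (x i), ?_, fun a => ?_⟩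
  · simp_rw [← op_mul]
    rw [← Finset.op_sum, h1, op_one]
  · have := congrArg (TensorProduct.comm k Aᵐᵒᵖ Aᵐᵒᵖ ∘ TensorProduct.map
      (opLinearEquiv k : A ≃ₗ[k] Aᵐᵒᵖ).toLinearMap
      (opLinearEquiv k : A ≃ₗ[k] Aᵐᵒᵖ).toLinearMap) (h2 (unop a))
    simp only [Function.comp, map_sum, TensorProduct.map_tmul, TensorProduct.comm_tmul,
      LinearEquiv.coe_coe, coe_opLinearEquiv, op_mul, op_unop] at this
    exact this.symm

/-- The tensor `∑ a xᵢ ⊗ yᵢ = ∑ xᵢ ⊗ yᵢ a` has its second leg in the span of the `yᵢ` by the first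
expression and its first leg in the span of the `xᵢ` by the second. Its product is `a`, so
multiplication maps a fixed finite-dimensional space onto `A`. -/
theorem HasCasimir.finite (h : HasCasimir k A) : Module.Finite k A := by
  obtain ⟨n, x, y, h1, h2⟩ := h
  let V := Submodule.span k (Set.range x)
  let W := Submodule.span k (Set.range y)
  obtain ⟨q, hq⟩ := LinearMap.exists_leftInverse_of_injective V.subtype V.ker_subtype
  obtain ⟨p, hp⟩ := LinearMap.exists_leftInverse_of_injective W.subtype W.ker_subtype
  have hq' : ∀ i, (q (x i) : A) = x i := fun i =>
    congrArg Subtype.val (LinearMap.congr_fun hq ⟨x i, Submodule.subset_span ⟨i, rfl⟩⟩)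
  have hp' : ∀ i, (p (y i) : A) = y i := fun i =>
    congrArg Subtype.val (LinearMap.congr_fun hp ⟨y i, Submodule.subset_span ⟨i, rfl⟩⟩)
  have : Module.Finite k V := Module.Finite.span_of_finite k (Set.finite_range x)
  have : Module.Finite k W := Module.Finite.span_of_finite k (Set.finite_range y)
  refine Module.Finite.of_surjective
    (LinearMap.mul' k A ∘ₗ TensorProduct.map V.subtype W.subtype) fun a => ?_
  refine ⟨∑ i, q (a * x i) ⊗ₜ p (y i), ?_⟩
  have key : TensorProduct.map V.subtype W.subtype (∑ i, q (a * x i) ⊗ₜ p (y i)) =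
      ∑ i, x i ⊗ₜ[k] (y i * a) := by
    have h3 := congrArg (TensorProduct.map (V.subtype ∘ₗ q) LinearMap.id) (h2 a)
    simp only [map_sum, TensorProduct.map_tmul, LinearMap.comp_apply, Submodule.subtype_apply,
      LinearMap.id_apply, hq'] at h3
    rw [← h3, map_sum]
    simp [hp']
  rw [LinearMap.comp_apply, key, map_sum]
  simp only [LinearMap.mul'_apply, ← mul_assoc]
  rw [← Finset.sum_mul, h1, one_mul]

theorem _root_.Module.Basis.exists_eq_sum_coord {ι V : Type*} [AddCommGroup V] [Module k V]
    (β : Module.Basis ι k V) {κ : Type*} [Finite κ] (u : κ → V) :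
    ∃ T : Finset ι, ∀ j, u j = ∑ b ∈ T, β.coord b (u j) • β b := by
  classical
  have := Fintype.ofFinite κ
  refine ⟨Finset.univ.biUnion fun j => (β.repr (u j)).support, fun j => ?_⟩
  conv_lhs => rw [← β.linearCombination_repr (u j), Finsupp.linearCombination_apply]
  exact Finsupp.sum_of_support_subset _ (Finset.subset_biUnion_of_mem
    (fun j => (β.repr (u j)).support) (Finset.mem_univ j)) _ (by simp)

/-- Averaging a coordinate functional `β_b` of a `k`-basis gives `f_b(m) = ∑ β_b(m xᵢ) yᵢ`, which is
right `A`-linear by centrality of the Casimir element. Only finitely many `b` matter for the vectors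
`m xᵢ` with `m ∈ s`, and `∑ b f_b(m) = ∑ m xᵢ yᵢ = m`. -/
theorem HasCasimir.hasLocalDual (h : HasCasimir k A) (M : Bimodule k A' A) : M.HasLocalDual := by
  classical
  obtain ⟨n, x, y, h1, h2⟩ := h
  intro s
  let β := Module.Basis.ofVectorSpace k M
  obtain ⟨T, hT⟩ := β.exists_eq_sum_coord fun p : s × Fin n => op (x p.2) • p.1.1
  let e := T.equivFin
  let f : Module.Basis.ofVectorSpaceIndex k M → M →ₗ[k] A := fun b =>
    ∑ i, (LinearMap.toSpanSingleton k A (y i)) ∘ₗ β.coord b ∘ₗ rAct M (op (x i))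
  have hf : ∀ b m, f b m = ∑ i, β.coord b (op (x i) • m) • y i := by
    intro b m
    simp only [f, LinearMap.sum_apply]
    rfl
  refine ⟨T.card, fun i => β (e.symm i), fun i => f (e.symm i), fun i a m => ?_, fun m hm => ?_⟩
  · change f _ (op a • m) = f _ m * a
    rw [hf, hf]
    have h3 := congrArg (TensorProduct.lift ((LinearMap.lsmul k A).comp
      (β.coord (e.symm i).1 ∘ₗ ((rAct M).toLinearMap ∘ₗ
        (opLinearEquiv k : A ≃ₗ[k] Aᵐᵒᵖ).toLinearMap).flip m))) (h2 a)
    simp only [map_sum, TensorProduct.lift.tmul, LinearMap.comp_apply] at h3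
    rw [Finset.sum_mul]
    refine (Finset.sum_congr rfl fun j _ => ?_).trans (h3.trans (Finset.sum_congr rfl fun j _ => ?_))
    · rw [← mul_smul, ← op_mul]
      rfl
    · rw [smul_mul_assoc]
      rfl
  · have h4 : ∀ i, op (x i) • m = ∑ b ∈ T, β.coord b (op (x i) • m) • β b := fun i => hT (⟨m, hm⟩, i)
    have h5 : m = ∑ i, op (y i) • op (x i) • m := by
      simp_rw [← mul_smul, ← op_mul]
      rw [← Finset.sum_smul, ← Finset.op_sum, h1, op_one, one_smul]
    have h6 : ∀ b, op (f b m) • β b = ∑ i, op (y i) • β.coord b (op (x i) • m) • β b := by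
      intro b
      rw [hf, Finset.op_sum, Finset.sum_smul]
      refine Finset.sum_congr rfl fun i _ => ?_
      exact (smul_assoc _ (op (y i)) (β b)).trans ((rAct M (op (y i))).map_smul _ (β b)).symm
    have h7 : m = ∑ b ∈ T, op (f b m) • β b := by
      rw [Finset.sum_congr rfl fun b _ => h6 b, Finset.sum_comm]
      refine h5.trans (Finset.sum_congr rfl fun i _ => ?_)
      rw [← Finset.smul_sum, ← h4]
    refine h7.trans ?_
    rw [← Finset.sum_coe_sort]
    exact (e.symm.sum_comp (fun b : T => op (f b m) • β b)).symm

end Casimir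

/-! ### Left subcomodules of `C` and endomorphisms of the right comodule `C`. -/

namespace Coring

section Operators

variable {k A : Type u} [CommRing k] [Ring A] [Algebra k A] (C : Coring k A)

/-- The map `φ` is an endomorphism of the right comodule `C`. -/
def IsRightColinear (φ : C.bim →ₗ[k] C.bim) : Prop :=
  ∃ h : IsRightLinear φ, ∀ c, C.comul (φ c) = mapLeft φ h C.bim (C.comul c)

/-- The subspace `N` is a left subcomodule of `C`. -/
def IsLeftSub (N : Submodule k C.bim) : Prop :=
  (∀ (a : A), ∀ n ∈ N, a • n ∈ N) ∧ ∀ n ∈ N, C.comul n ∈ tensorRange C.bim C.bim (N : Set C.bim)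

variable {C}

theorem isRightColinear_lAct (a : A) : C.IsRightColinear (lAct C.bim a) := by
  refine ⟨fun b m => smul_comm a (op b) m, fun c => (C.comul.map_left a c).trans ?_⟩
  exact LinearMap.congr_fun (tensor_ext (f := lAct (C.bim.tensor C.bim) a)
    (g := mapLeft _ (fun b m => smul_comm a (op b) m) C.bim) fun _ _ => rfl) (C.comul c)

/-- Coassociativity and left linearity of `Δ` give `Δ(f(c₁) c₂) = f(c₁) c₂ ⊗ c₃`. -/
theorem isRightColinear_contract (f : C.bim →ₗ[k] regular k A) (hf : IsRightLinear f) :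
    C.IsRightColinear (contract f hf C.bim ∘ₗ C.comul.toLin) := by
  have h : IsRightLinear (contract f hf C.bim ∘ₗ C.comul.toLin) := fun b m => by
    change contract f hf C.bim (C.comul (op b • m)) = _
    rw [C.comul.map_right]
    exact LinearMap.congr_fun (tensor_ext
      (f := contract f hf C.bim ∘ₗ rAct (C.bim.tensor C.bim) (op b))
      (g := rAct C.bim (op b) ∘ₗ contract f hf C.bim)
      fun c c' => smul_comm (f c : A) (op b) c') (C.comul m)
  refine ⟨h, fun c => ?_⟩
  have h1 : ∀ s : C.bim.tensor C.bim, C.comul (contract f hf C.bim s) =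
      contract f hf _ (map (Hom.id _) C.comul s) := fun s =>
    LinearMap.congr_fun (tensor_ext (f := C.comul.toLin ∘ₗ contract f hf C.bim)
      (g := contract f hf _ ∘ₗ (map (Hom.id _) C.comul).toLin)
      fun c c' => C.comul.map_left (f c) c') s
  have h2 : ∀ s : C.bim.tensor C.bim, contract f hf _ (assoc _ _ _ (map C.comul (Hom.id _) s)) =
      mapLeft _ h C.bim s := fun s => LinearMap.congr_fun (tensor_ext
    (f := contract f hf _ ∘ₗ assoc _ _ _ ∘ₗ (map C.comul (Hom.id _)).toLin)
    (g := mapLeft _ h C.bim) fun c c' => LinearMap.congr_fun (tensor_ext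
      (f := contract f hf _ ∘ₗ assoc _ _ _ ∘ₗ (tmulBilin (C.bim.tensor C.bim) C.bim).flip c')
      (g := (tmulBilin C.bim C.bim).flip c' ∘ₗ contract f hf C.bim) fun _ _ => rfl)
      (C.comul c)) s
  exact (h1 _).trans (by rw [← C.coassoc, h2])

/-- The form is `f = ε ∘ φ`: apply `ε ⊗ 1` to `Δ(φ c) = φ(c₁) ⊗ c₂`. -/
theorem IsRightColinear.eq_contract {φ : C.bim →ₗ[k] C.bim} (hφ : C.IsRightColinear φ) :
    ∃ (f : C.bim →ₗ[k] regular k A) (hf : IsRightLinear f),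
      ∀ c, φ c = contract f hf C.bim (C.comul c) := by
  obtain ⟨h, h'⟩ := hφ
  refine ⟨C.counit.toLin ∘ₗ φ, fun b m => ?_, fun c => ?_⟩
  · change C.counit (φ (op b • m)) = _
    rw [h, C.counit.map_right]
    rfl
  · rw [← C.lid_counit (φ c), h']
    exact LinearMap.congr_fun (tensor_ext (f := lid _ ∘ₗ (map C.counit (Hom.id C.bim)).toLin ∘ₗ
      mapLeft φ h C.bim) (g := contract (C.counit.toLin ∘ₗ φ) _ C.bim) fun _ _ => rfl) (C.comul c)

/-- In `φ n = f(n₁) n₂` the second leg may be taken in `N`, which is stable under `A`. -/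
theorem IsLeftSub.apply_mem {N : Submodule k C.bim} (hN : C.IsLeftSub N) {φ : C.bim →ₗ[k] C.bim}
    (hφ : C.IsRightColinear φ) {n : C.bim} (hn : n ∈ N) : φ n ∈ N := by
  obtain ⟨f, hf, h⟩ := hφ.eq_contract
  rw [h]
  exact tensorRange_le (W := N.comap (contract f hf C.bim))
    (fun m p hp => hN.1 (f m) p hp) (hN.2 n hn)

/-- Expanding the first leg in a local dual basis gives `Δ y = ∑ cᵢ ⊗ fᵢ(y₁) y₂`. Thus `Δ` is
recovered, on finitely many elements at a time, from endomorphisms of the right comodule; this turns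
stability under operators back into comodule conditions. -/
theorem exists_comul_eq_sum (hC : C.bim.HasLocalDual) (s : Finset C.bim) :
    ∃ (n : ℕ) (c : Fin n → C.bim) (r : Fin n → C.bim →ₗ[k] C.bim),
      (∀ i, C.IsRightColinear (r i)) ∧ ∀ y ∈ s, C.comul y = ∑ i, tmul (c i) (r i y) := by
  classical
  obtain ⟨n, c, f, hf, h⟩ := hC.exists_tensor (s.image C.comul)
  exact ⟨n, c, fun i => contract (f i) (hf i) C.bim ∘ₗ C.comul.toLin,
    fun i => isRightColinear_contract (f i) (hf i),
    fun y hy => h _ (Finset.mem_image_of_mem _ hy)⟩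

theorem isLeftSub_of_stable (hC : C.bim.HasLocalDual) {N : Submodule k C.bim}
    (hN : ∀ φ, C.IsRightColinear φ → ∀ n ∈ N, φ n ∈ N) : C.IsLeftSub N := by
  refine ⟨fun a n hn => hN _ (isRightColinear_lAct a) n hn, fun n hn => ?_⟩
  obtain ⟨m, c, r, hr, h⟩ := exists_comul_eq_sum hC {n}
  rw [h n (Finset.mem_singleton_self n)]
  exact Submodule.sum_mem _ fun i _ => tmul_mem_tensorRange _ (hN _ (hr i) n hn)

end Operators

/-! ### Coseparability of the opposite coring, and bicolinearity in terms of operators. -/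

section Coseparable

variable {k A : Type u} [CommRing k] [Ring A] [Algebra k A] {C : Coring k A}

/-- The inverse of `swap`. -/
def swapInv (C : Coring k A) : C.bim.opp.tensor C.bim.opp →ₗ[k] C.bim.tensor C.bim :=
  lift (tmulBilin C.bim C.bim).flip
    (fun c a c' => (smul_tmul (M := C.bim) (N := C.bim) c' (unop a) c).symm)

theorem swapInv_comul (c : C.bim) : C.swapInv (C.opposite.comul c) = C.comul c :=
  LinearMap.congr_fun (tensor_ext (f := C.swapInv ∘ₗ (swap C.bim C.bim).toLin)
    (g := LinearMap.id) fun _ _ => rfl) (C.comul c)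

/-- The map is `π` after reversal of the factors; reversal exchanges left and right colinearity. -/
theorem IsCoseparable.opposite (h : C.IsCoseparable) : C.opposite.IsCoseparable := by
  obtain ⟨π, h1, h2, h3⟩ := h
  have hl : ∀ (a : Aᵐᵒᵖ) x, C.swapInv (a • x) = a • C.swapInv x := fun a x =>
    LinearMap.congr_fun (tensor_ext
      (f := C.swapInv ∘ₗ lAct (C.bim.opp.tensor C.bim.opp) a)
      (g := rAct (C.bim.tensor C.bim) a ∘ₗ C.swapInv) fun _ _ => rfl) x
  have hr : ∀ (a : Aᵐᵒᵖ) x, C.swapInv (op a • x) = unop a • C.swapInv x := fun a x =>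
    LinearMap.congr_fun (tensor_ext
      (f := C.swapInv ∘ₗ rAct (C.bim.opp.tensor C.bim.opp) (op a))
      (g := lAct (C.bim.tensor C.bim) (unop a) ∘ₗ C.swapInv) fun _ _ => rfl) x
  let π' : Hom (C.opposite.bim.tensor C.opposite.bim) C.opposite.bim :=
    { toLin := π.toLin ∘ₗ C.swapInv
      map_left := fun a x => (congrArg π (hl a x)).trans (π.map_right (unop a) _)
      map_right := fun a x => (congrArg π (hr a x)).trans (π.map_left (unop a) _) }
  refine ⟨π', fun x => ?_, fun x => ?_, fun c => ?_⟩
  · refine LinearMap.congr_fun (tensor_ext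
      (f := C.opposite.comul.toLin ∘ₗ π'.toLin)
      (g := (map (Hom.id C.opposite.bim) π').toLin ∘ₗ assoc _ _ _ ∘ₗ
        (map C.opposite.comul (Hom.id _)).toLin) fun c c' => ?_) x
    refine (congrArg (swap C.bim C.bim) (h2 (tmul c' c))).trans ?_
    exact LinearMap.congr_fun (tensor_ext
      (f := (swap C.bim C.bim).toLin ∘ₗ (map π (Hom.id C.bim)).toLin ∘ₗ assocInv _ _ _ ∘ₗ
        tmulBilin C.bim (C.bim.tensor C.bim) c')
      (g := (map (Hom.id C.opposite.bim) π').toLin ∘ₗ assoc _ _ _ ∘ₗ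
        (tmulBilin (C.bim.opp.tensor C.bim.opp) C.bim.opp).flip c' ∘ₗ (swap C.bim C.bim).toLin)
      fun _ _ => rfl) (C.comul c)
  · refine LinearMap.congr_fun (tensor_ext
      (f := C.opposite.comul.toLin ∘ₗ π'.toLin)
      (g := (map π' (Hom.id C.opposite.bim)).toLin ∘ₗ assocInv _ _ _ ∘ₗ
        (map (Hom.id _) C.opposite.comul).toLin) fun c c' => ?_) x
    refine (congrArg (swap C.bim C.bim) (h1 (tmul c' c))).trans ?_
    exact LinearMap.congr_fun (tensor_ext
      (f := (swap C.bim C.bim).toLin ∘ₗ (map (Hom.id C.bim) π).toLin ∘ₗ assoc _ _ _ ∘ₗ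
        (tmulBilin (C.bim.tensor C.bim) C.bim).flip c)
      (g := (map π' (Hom.id C.opposite.bim)).toLin ∘ₗ assocInv _ _ _ ∘ₗ
        tmulBilin C.bim.opp (C.bim.opp.tensor C.bim.opp) c ∘ₗ (swap C.bim C.bim).toLin)
      fun _ _ => rfl) (C.comul c')
  · exact (congrArg π (swapInv_comul (C := C) c)).trans (h3 c)

/-- Right colinearity of `π`, read with the first factor fixed, makes each `π(c ⊗ -)` an
endomorphism of the right comodule `C`, hence an operator preserving left subcomodules. -/
theorem isRightColinear_of_bicolinear {π : Hom (C.bim.tensor C.bim) C.bim}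
    (h : ∀ x, C.comul (π x) =
      map π (Hom.id C.bim) (assocInv C.bim C.bim C.bim (map (Hom.id C.bim) C.comul x)))
    (c : C.bim) : C.IsRightColinear (π.toLin ∘ₗ tmulBilin C.bim C.bim c) := by
  refine ⟨fun b m => π.map_right b (tmul c m), fun c' => (h (tmul c c')).trans ?_⟩
  exact LinearMap.congr_fun (tensor_ext
    (f := (map π (Hom.id C.bim)).toLin ∘ₗ assocInv _ _ _ ∘ₗ
      tmulBilin C.bim (C.bim.tensor C.bim) c)
    (g := mapLeft _ (fun b m => π.map_right b (tmul c m)) C.bim) fun _ _ => rfl) (C.comul c')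

/-- With `r = f(c₁) c₂`, left colinearity gives `f` applied to the first leg of `Δ(π(c ⊗ c'))` as
`f(c₁) π(c₂ ⊗ c')`, and `π` is left linear. -/
theorem apply_of_bicolinear {π : Hom (C.bim.tensor C.bim) C.bim}
    (h : ∀ x, C.comul (π x) =
      map (Hom.id C.bim) π (assoc C.bim C.bim C.bim (map C.comul (Hom.id C.bim) x)))
    {r : C.bim →ₗ[k] C.bim} (hr : C.IsRightColinear r) (c c' : C.bim) :
    π (tmul (r c) c') = r (π (tmul c c')) := by
  obtain ⟨f, hf, h'⟩ := hr.eq_contract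
  rw [h', h', h]
  exact LinearMap.congr_fun (tensor_ext
    (f := π.toLin ∘ₗ (tmulBilin C.bim C.bim).flip c' ∘ₗ contract f hf C.bim)
    (g := contract f hf C.bim ∘ₗ (map (Hom.id C.bim) π).toLin ∘ₗ assoc _ _ _ ∘ₗ
      (tmulBilin (C.bim.tensor C.bim) C.bim).flip c')
    fun c c'' => π.map_left (f c) (tmul c'' c')) (C.comul c)

/-- Bilinearity is the case of the operators given by elements of `A`. For colinearity, both sides
are expanded by `exists_comul_eq_sum`, in the first leg over `C` and in the second leg via `C°`. -/
theorem isCoseparable_of_retraction (hC : C.bim.HasLocalDual) (hC' : C.opposite.bim.HasLocalDual)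
    (π : C.bim.tensor C.bim →ₗ[k] C.bim)
    (h1 : ∀ r, C.IsRightColinear r → ∀ c c', π (tmul (r c) c') = r (π (tmul c c')))
    (h2 : ∀ l : C.bim →ₗ[k] C.bim, C.opposite.IsRightColinear l →
      ∀ c c', π (tmul c (l c')) = l (π (tmul c c')))
    (h3 : ∀ c, π (C.comul c) = c) : C.IsCoseparable := by
  classical
  have hl : ∀ (a : A) x, π (a • x) = a • π x := fun a x => LinearMap.congr_fun (tensor_ext
    (f := π ∘ₗ lAct (C.bim.tensor C.bim) a) (g := lAct C.bim a ∘ₗ π)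
    fun c c' => h1 _ (isRightColinear_lAct a) c c') x
  have hr : ∀ (a : A) x, π (op a • x) = op a • π x := fun a x => LinearMap.congr_fun (tensor_ext
    (f := π ∘ₗ rAct (C.bim.tensor C.bim) (op a)) (g := rAct C.bim (op a) ∘ₗ π)
    fun c c' => h2 _ (isRightColinear_lAct (C := C.opposite) (op a)) c c') x
  let π' : Hom (C.bim.tensor C.bim) C.bim := ⟨π, hl, hr⟩
  refine ⟨π', fun x => ?_, fun x => ?_, h3⟩
  · refine LinearMap.congr_fun (tensor_ext
      (f := C.comul.toLin ∘ₗ π)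
      (g := (map (Hom.id C.bim) π').toLin ∘ₗ assoc _ _ _ ∘ₗ
        (map C.comul (Hom.id _)).toLin) fun c c' => ?_) x
    -- One dual basis has to serve both `π(c ⊗ c')` and `c`, so that the two expansions can be
    -- compared term by term.
    obtain ⟨n, d, r, hr, h⟩ := exists_comul_eq_sum hC {π (tmul c c'), c}
    refine (h _ (by simp)).trans ?_
    change _ = map (Hom.id C.bim) π' (assoc _ _ _ (tmulBilin _ _ (C.comul c) c'))
    rw [h c (by simp), map_sum, LinearMap.sum_apply, map_sum, map_sum]
    exact Finset.sum_congr rfl fun i _ => congrArg (tmul (d i)) (h1 _ (hr i) c c').symm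
  · refine LinearMap.congr_fun (tensor_ext
      (f := C.comul.toLin ∘ₗ π)
      (g := (map π' (Hom.id C.bim)).toLin ∘ₗ assocInv _ _ _ ∘ₗ
        (map (Hom.id _) C.comul).toLin) fun c c' => ?_) x
    obtain ⟨n, d, l, hl, h⟩ := exists_comul_eq_sum hC' {(π (tmul c c') : C.bim), c'}
    have h' : ∀ y : C.bim, y ∈ ({(π (tmul c c') : C.bim), c'} : Finset C.bim) →
        C.comul y = ∑ i, tmul (M := C.bim) (N := C.bim) (l i y) (d i) := fun y hy => by
      rw [← swapInv_comul]
      exact (congrArg C.swapInv (h y hy)).trans (map_sum C.swapInv _ _)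
    refine (h' _ (by simp)).trans ?_
    change _ = map π' (Hom.id C.bim) (assocInv _ _ _ (tmulBilin _ _ c (C.comul c')))
    rw [h' c' (by simp), map_sum, map_sum, map_sum]
    exact Finset.sum_congr rfl fun i _ =>
      congrArg (fun y => tmulBilin C.bim C.bim y (d i)) (h2 _ (hl i) c c').symm

end Coseparable

end Coring

open Bimodule

/-- Passes from an internal direct sum of `A`-submodules to the map of `k`-modules by which
semisimplicity of a comodule is defined. -/
theorem bijective_toModule {k A : Type*} [CommRing k] [Ring A] {M : Type*} [AddCommGroup M] [Module k M] [Module A M] {ι : Type*}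
    [DecidableEq ι] {N : ι → Type*} [∀ i, AddCommGroup (N i)] [∀ i, Module k (N i)]
    (φ : ∀ i, N i →ₗ[k] M) (p : ι → Submodule A M) (e : ∀ i, N i ≃+ p i)
    (he : ∀ i x, (e i x : M) = φ i x) (h : DirectSum.IsInternal p) :
    Function.Bijective (DirectSum.toModule k ι M φ) := by
  have : ⇑(DirectSum.toModule k ι M φ) =
      ⇑(DirectSum.coeAddMonoidHom p) ∘ ⇑(DFinsupp.mapRange.addEquiv e) := by
    ext x
    induction x using DirectSum.induction_on with
    | zero => rw [map_zero, Function.comp_apply, map_zero, map_zero]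
    | add x y hx hy => rw [map_add, hx, hy, Function.comp_apply, Function.comp_apply,
        Function.comp_apply, map_add, map_add]
    | of i s =>
      have h1 : DFinsupp.mapRange.addEquiv e (DirectSum.of N i s) =
          DirectSum.of (fun i => p i) i (e i s) :=
        DFinsupp.mapRange_single (f := fun i => e i) (hf := fun i => map_zero (e i))
      rw [Function.comp_apply, h1, DirectSum.coeAddMonoidHom_of, he]
      exact DirectSum.toModule_lof k i s
  rw [this]
  exact Function.Bijective.comp h (DFinsupp.mapRange.addEquiv e).bijective

/-! ### Subcomodules, simple and semisimple comodules over a flat coring. -/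

namespace LeftComodule

variable {k A : Type u} [CommRing k] [Ring A] [Algebra k A] {C : Coring k A}

/-- The submodule `P` is stable under the coaction. -/
def IsSub (M : LeftComodule C) (P : Submodule A M.obj) : Prop :=
  ∀ p ∈ P, M.coact p ∈ tensorRange C.bim M.obj (P : Set M.obj)

theorem isSub_sSup {M : LeftComodule C} {S : Set (Submodule A M.obj)} (h : ∀ P ∈ S, M.IsSub P) :
    M.IsSub (sSup S) := by
  intro p hp
  rw [sSup_eq_iSup'] at hp
  refine Submodule.iSup_induction _ (motive := fun p => M.coact p ∈ tensorRange C.bim M.obj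
    ((sSup S : Submodule A M.obj) : Set M.obj)) hp ?_ ?_ ?_
  · exact fun P p hp => tensorRange_mono (le_sSup P.2 : P.1 ≤ sSup S) (h P.1 P.2 p hp)
  · rw [map_zero]; exact Submodule.zero_mem _
  · intro x y hx hy; rw [map_add]; exact Submodule.add_mem _ hx hy

theorem IsSub.inf (hC : C.bim.IsRightFlat) {M : LeftComodule C} {P Q : Submodule A M.obj}
    (hP : M.IsSub P) (hQ : M.IsSub Q) : M.IsSub (P ⊓ Q) :=
  fun p hp => hC.tensorRange_inf P Q ⟨hP p hp.1, hQ p hp.2⟩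

theorem isSub_bot (M : LeftComodule C) : M.IsSub ⊥ := fun p hp => by
  rw [(Submodule.mem_bot A).1 hp, map_zero]; exact Submodule.zero_mem _

theorem isSub_top (M : LeftComodule C) : M.IsSub ⊤ := fun p _ => by
  rw [Submodule.top_coe, tensorRange_univ]; exact Submodule.mem_top

theorem Hom.map_mem_tensorRange {M N : LeftComodule C} (f : Hom M N) {P : Set M.obj}
    {P' : Set N.obj} (h : ∀ p ∈ P, f.toHom p ∈ P') {m : M.obj}
    (hm : M.coact m ∈ tensorRange C.bim M.obj P) :
    N.coact (f.toHom m) ∈ tensorRange C.bim N.obj P' := by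
  rw [f.colinear]
  exact map_tensorRange (map (Bimodule.Hom.id C.bim) f.toHom).toLin
    (fun c p hp => tmul_mem_tensorRange (N := N.obj) c (h p hp)) hm

theorem IsSubcomodule.isSub {M : LeftComodule C} {P : Submodule A M.obj}
    (h : M.IsSubcomodule P) : M.IsSub P := by
  obtain ⟨S, i, -, hr⟩ := h
  intro p hp
  obtain ⟨s, rfl⟩ : p ∈ Set.range i.toHom := by rw [hr]; exact hp
  refine i.map_mem_tensorRange (P := Set.univ) (fun s _ => ?_) (by
    rw [tensorRange_univ]; exact Submodule.mem_top)
  rw [← hr]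
  exact ⟨s, rfl⟩

section SubObject

variable (hC : C.bim.IsRightFlat) (M : LeftComodule C) (P : Submodule A M.obj) (hP : M.IsSub P)

/-- The coaction on a subcomodule, as a linear map. -/
noncomputable def subCoact : M.obj.sub P →ₗ[k] C.bim.tensor (M.obj.sub P) :=
  -- By flatness `C ⊗ P → C ⊗ M` is injective, so the coaction of `M` restricted to `P` lifts
  -- uniquely to `C ⊗ P`.
  (LinearEquiv.ofInjective (map (Bimodule.Hom.id C.bim) (incl M.obj P)).toLin
    (hC _ _ _ Subtype.val_injective)).symm.toLinearMap ∘ₗ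
    LinearMap.codRestrict _ (M.coact.toLin ∘ₗ (incl M.obj P).toLin)
      (fun p => by rw [← tensorRange_eq_range]; exact hP p p.2)

theorem incl_subCoact (p : M.obj.sub P) :
    map (Bimodule.Hom.id C.bim) (incl M.obj P) (subCoact hC M P hP p) = M.coact (incl M.obj P p) :=
  congrArg Subtype.val (LinearEquiv.apply_symm_apply (LinearEquiv.ofInjective
    (map (Bimodule.Hom.id C.bim) (incl M.obj P)).toLin (hC _ _ _ Subtype.val_injective)) _)

/-- The subcomodule defined by a stable submodule. -/
noncomputable def subObj : LeftComodule C :=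
  let ρ : Bimodule.Hom (M.obj.sub P) (C.bim.tensor (M.obj.sub P)) :=
    { toLin := subCoact hC M P hP
      map_left := fun a p => hC _ _ (incl M.obj P) Subtype.val_injective (by
        rw [incl_subCoact, (incl M.obj P).map_left, M.coact.map_left, Bimodule.Hom.map_left,
          incl_subCoact])
      map_right := fun c p => by rw [op_base_smul, op_base_smul, map_smul] }
  have hρ : ∀ p, map (Bimodule.Hom.id C.bim) (incl M.obj P) (ρ p) = M.coact (incl M.obj P p) :=
    incl_subCoact hC M P hP
  { obj := M.obj.sub P
    coact := ρ
    coassoc := fun p => by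
      -- Coassociativity is tested in `C ⊗ C ⊗ M`, into which `C ⊗ C ⊗ P` embeds by flatness applied
      -- twice.
      refine hC _ _ (map (Bimodule.Hom.id C.bim) (incl M.obj P))
        (hC _ _ _ Subtype.val_injective) ?_
      have h1 : ∀ s : C.bim.tensor (M.obj.sub P), map (Bimodule.Hom.id C.bim)
          (map (Bimodule.Hom.id C.bim) (incl M.obj P)) (assoc _ _ _
            (map C.comul (Bimodule.Hom.id _) s)) = assoc _ _ _ (map C.comul (Bimodule.Hom.id _)
              (map (Bimodule.Hom.id C.bim) (incl M.obj P) s)) := fun s =>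
        LinearMap.congr_fun (tensor_ext
          (f := (map (Bimodule.Hom.id C.bim)
            (map (Bimodule.Hom.id C.bim) (incl M.obj P))).toLin ∘ₗ assoc _ _ _ ∘ₗ
            (map C.comul (Bimodule.Hom.id _)).toLin)
          (g := assoc _ _ _ ∘ₗ (map C.comul (Bimodule.Hom.id _)).toLin ∘ₗ
            (map (Bimodule.Hom.id C.bim) (incl M.obj P)).toLin) fun c p =>
            LinearMap.congr_fun (tensor_ext
              (f := (map (Bimodule.Hom.id C.bim)
                (map (Bimodule.Hom.id C.bim) (incl M.obj P))).toLin ∘ₗ assoc _ _ _ ∘ₗ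
                (tmulBilin (C.bim.tensor C.bim) (M.obj.sub P)).flip p)
              (g := assoc _ _ _ ∘ₗ
                (tmulBilin (C.bim.tensor C.bim) M.obj).flip (incl M.obj P p))
              fun _ _ => rfl) (C.comul c)) s
      have h2 : ∀ s : C.bim.tensor (M.obj.sub P), map (Bimodule.Hom.id C.bim)
          (map (Bimodule.Hom.id C.bim) (incl M.obj P)) (map (Bimodule.Hom.id C.bim) ρ s) =
            map (Bimodule.Hom.id C.bim) M.coact
              (map (Bimodule.Hom.id C.bim) (incl M.obj P) s) := fun s =>
        LinearMap.congr_fun (tensor_ext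
          (f := (map (Bimodule.Hom.id C.bim)
            (map (Bimodule.Hom.id C.bim) (incl M.obj P))).toLin ∘ₗ
              (map (Bimodule.Hom.id C.bim) ρ).toLin)
          (g := (map (Bimodule.Hom.id C.bim) M.coact).toLin ∘ₗ
            (map (Bimodule.Hom.id C.bim) (incl M.obj P)).toLin) fun c p =>
              congrArg (tmul c) (hρ p)) s
      rw [h1, h2, hρ, M.coassoc]
    lid_counit := fun p => by
      have h1 : ∀ s : C.bim.tensor (M.obj.sub P),
          incl M.obj P (lid _ (map C.counit (Bimodule.Hom.id _) s)) =
            lid _ (map C.counit (Bimodule.Hom.id _)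
              (map (Bimodule.Hom.id C.bim) (incl M.obj P) s)) := fun s =>
        LinearMap.congr_fun (tensor_ext
          (f := (incl M.obj P).toLin ∘ₗ lid _ ∘ₗ (map C.counit (Bimodule.Hom.id _)).toLin)
          (g := lid _ ∘ₗ (map C.counit (Bimodule.Hom.id _)).toLin ∘ₗ
            (map (Bimodule.Hom.id C.bim) (incl M.obj P)).toLin) fun _ _ => rfl) s
      refine Subtype.val_injective ((h1 (ρ p)).trans ?_)
      rw [hρ, M.lid_counit]
      rfl }

/-- The inclusion of a subcomodule. -/
noncomputable def subIncl : Hom (subObj hC M P hP) M where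
  toHom := incl M.obj P
  colinear p := (incl_subCoact hC M P hP p).symm

end SubObject

theorem isSubcomodule_iff (hC : C.bim.IsRightFlat) {M : LeftComodule C} {P : Submodule A M.obj} :
    M.IsSubcomodule P ↔ M.IsSub P :=
  ⟨IsSubcomodule.isSub, fun h => ⟨subObj hC M P h, subIncl hC M P h, Subtype.val_injective,
    Subtype.range_coe⟩⟩

theorem isSimple_iff (hC : C.bim.IsRightFlat) {M : LeftComodule C} :
    M.IsSimple ↔ (⊥ : Submodule A M.obj) ≠ ⊤ ∧ ∀ P, M.IsSub P → P = ⊥ ∨ P = ⊤ := by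
  simp only [IsSimple, isSubcomodule_iff hC]
  constructor
  · intro h
    obtain ⟨x, y, hxy, hset⟩ := Set.ncard_eq_two.1 h
    have hb : (⊥ : Submodule A M.obj) ∈ ({x, y} : Set _) := hset ▸ M.isSub_bot
    have ht : (⊤ : Submodule A M.obj) ∈ ({x, y} : Set _) := hset ▸ M.isSub_top
    have hne : (⊥ : Submodule A M.obj) ≠ ⊤ := fun h => hxy
      ((subsingleton_of_bot_eq_top h).elim x y)
    refine ⟨hne, fun P hP => ?_⟩
    have hP' : P ∈ ({x, y} : Set _) := hset ▸ hP
    simp only [Set.mem_insert_iff, Set.mem_singleton_iff] at hb ht hP'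
    grind
  · rintro ⟨hne, h⟩
    refine Set.ncard_eq_two.2 ⟨⊥, ⊤, hne, Set.ext fun P => ⟨h P, ?_⟩⟩
    rintro (rfl | rfl)
    exacts [M.isSub_bot, M.isSub_top]

/-- For a subcomodule `Q` inside the range, the preimage of `Q` is a subcomodule because `C ⊗ f` is
injective by flatness; simplicity of `M` then decides. -/
theorem isMinimalIn_range (hC : C.bim.IsRightFlat) {M N : LeftComodule C} (f : Hom M N)
    (hM : M.IsSimple) (hf : Function.Injective f.toHom) :
    IsMinimalIn {P | N.IsSub P} (LinearMap.range f.toHom.toLinear) := by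
  obtain ⟨hne, h⟩ := (isSimple_iff hC).1 hM
  refine ⟨?_, ?_, fun Q hQ hle => ?_⟩
  · rintro _ ⟨m, rfl⟩
    exact f.map_mem_tensorRange (P := Set.univ)
      (P' := (LinearMap.range f.toHom.toLinear : Set N.obj)) (fun m _ => ⟨m, rfl⟩)
      (by rw [tensorRange_univ]; exact Submodule.mem_top)
  · intro h0
    refine hne (le_antisymm bot_le fun m _ => ?_)
    have : f.toHom m ∈ LinearMap.range f.toHom.toLinear := ⟨m, rfl⟩
    rw [h0] at this
    exact hf (((Submodule.mem_bot A).1 this).trans (map_zero f.toHom.toLin).symm)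
  · have hsub : M.IsSub (Q.comap f.toHom.toLinear) := by
      intro m hm
      have h1 := hQ (f.toHom m) hm
      rw [f.colinear] at h1
      have h2 : tensorRange C.bim N.obj (Q : Set N.obj) ≤
          (tensorRange C.bim M.obj (Q.comap f.toHom.toLinear : Set M.obj)).map
            (map (Bimodule.Hom.id C.bim) f.toHom).toLin := tensorRange_le fun c q hq => by
        obtain ⟨m, rfl⟩ := hle hq
        exact ⟨tmul c m, tmul_mem_tensorRange c hq, rfl⟩
      obtain ⟨x, hx, hxe⟩ := h2 h1
      rwa [← hC _ _ f.toHom hf hxe]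
    rcases h _ hsub with h | h
    · refine Or.inl (le_bot_iff.1 fun q hq => ?_)
      obtain ⟨m, rfl⟩ := hle hq
      have : m ∈ Q.comap f.toHom.toLinear := hq
      rw [h, Submodule.mem_bot] at this
      rw [this, map_zero]
      exact Submodule.zero_mem _
    · refine Or.inr (le_antisymm hle ?_)
      rintro _ ⟨m, rfl⟩
      have : m ∈ Q.comap f.toHom.toLinear := h ▸ Submodule.mem_top
      exact this

/-- The part of semisimplicity that yields complements: simple subcomodules that span. Independence
of the summands is not needed for this. -/
theorem IsSemisimple.exists_homs {M : LeftComodule C} (hM : M.IsSemisimple) :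
    ∃ (ι : Type u) (S : ι → LeftComodule C) (f : ∀ i, Hom (S i) M),
      (∀ i, (S i).IsSimple ∧ Function.Injective (f i).toHom) ∧
      ⨆ i, LinearMap.range (f i).toHom.toLinear = ⊤ := by
  classical
  obtain ⟨ι, S, f, hS, hb⟩ := hM
  have hof : ∀ i s, DirectSum.toModule k ι M.obj (fun i => (f i).toHom.toLin)
      (DirectSum.of (fun i => (S i).obj.carrier) i s) = (f i).toHom s := fun i s =>
    DirectSum.toModule_lof k (φ := fun i => (f i).toHom.toLin) i s
  refine ⟨ι, S, f, fun i => ⟨hS i, fun s t hst => ?_⟩, top_le_iff.1 fun m _ => ?_⟩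
  · refine DirectSum.of_injective (β := fun i => (S i).obj.carrier) i (hb.1 ?_)
    rw [hof, hof, hst]
  · obtain ⟨x, rfl⟩ := hb.2 m
    induction x using DirectSum.induction_on with
    | zero => rw [map_zero]; exact Submodule.zero_mem _
    | add x y hx hy => rw [map_add]; exact Submodule.add_mem _ (hx trivial) (hy trivial)
    | of i s =>
      refine (le_iSup (fun i => LinearMap.range (f i).toHom.toLinear) i) ?_
      exact ⟨s, (hof i s).symm⟩

theorem exists_isCompl (hC : C.bim.IsRightFlat) {M : LeftComodule C}
    (h : sSup {P | IsMinimalIn {P | M.IsSub P} P} = ⊤) {P : Submodule A M.obj} (hP : M.IsSub P) :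
    ∃ Q, M.IsSub Q ∧ IsCompl P Q := by
  obtain ⟨s, hs, -, hc⟩ := exists_sSupIndep_isCompl_of_isMinimalIn (F := {P | M.IsSub P})
    (fun P hP Q hQ => IsSub.inf hC hP hQ) (fun S hS => isSub_sSup fun N hN => hS hN) h hP
  exact ⟨_, isSub_sSup fun P hP => (hs hP).1, hc⟩

theorem IsSemisimple.exists_isCompl (hC : C.bim.IsRightFlat) {M : LeftComodule C}
    (hM : M.IsSemisimple) {P : Submodule A M.obj} (hP : M.IsSub P) :
    ∃ Q, M.IsSub Q ∧ IsCompl P Q := by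
  obtain ⟨ι, S, f, hf, htop⟩ := hM.exists_homs
  refine LeftComodule.exists_isCompl hC (top_le_iff.1 ?_) hP
  rw [← htop]
  exact iSup_le fun i => le_sSup (isMinimalIn_range hC (f i) (hf i).1 (hf i).2)

theorem isSimple_subObj (hC : C.bim.IsRightFlat) {M : LeftComodule C} {P : Submodule A M.obj}
    (hP : IsMinimalIn {P | M.IsSub P} P) : (subObj hC M P hP.1).IsSimple := by
  refine (isSimple_iff hC).2 ⟨fun h => hP.2.1 (le_bot_iff.1 fun p hp => ?_), fun Q hQ => ?_⟩
  · let p' : (subObj hC M P hP.1).obj := (⟨p, hp⟩ : P)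
    have : p' ∈ (⊤ : Submodule A (subObj hC M P hP.1).obj) := Submodule.mem_top
    rw [← h] at this
    have h0 : p' = 0 := (Submodule.mem_bot A).1 this
    exact congrArg Subtype.val h0
  · let j : (subObj hC M P hP.1).obj →ₗ[A] M.obj :=
      (subIncl hC M P hP.1).toHom.toLinear
    have hinj : Function.Injective j := Subtype.val_injective
    have hsub : M.IsSub (Q.map j) := by
      rintro _ ⟨q, hq, rfl⟩
      exact (subIncl hC M P hP.1).map_mem_tensorRange (P' := (Q.map j : Set M.obj))
        (fun p hp => ⟨p, hp, rfl⟩) (hQ q hq)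
    rcases hP.2.2 _ hsub (by rintro _ ⟨q, hq, rfl⟩; exact Subtype.property (p := (· ∈ P)) q)
      with h | h
    · refine Or.inl (le_bot_iff.1 fun q hq => hinj ?_)
      have : j q ∈ Q.map j := ⟨q, hq, rfl⟩
      rw [h, Submodule.mem_bot] at this
      rw [this, map_zero]
    · refine Or.inr (top_le_iff.1 fun q _ => ?_)
      have : j q ∈ Q.map j := by
        rw [h]; exact Subtype.property (p := (· ∈ P)) q
      obtain ⟨q', hq', he⟩ := this
      rwa [← hinj he]

theorem isSemisimple_of_isCompl (hC : C.bim.IsRightFlat) {M : LeftComodule C}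
    (h : ∀ P, M.IsSub P → ∃ Q, M.IsSub Q ∧ IsCompl P Q) : M.IsSemisimple := by
  classical
  have hI : ∀ P ∈ {P | M.IsSub P}, ∀ Q ∈ {P | M.IsSub P}, P ⊓ Q ∈ {P | M.IsSub P} :=
    fun P hP Q hQ => IsSub.inf hC hP hQ
  have hS : ∀ S ⊆ {P | M.IsSub P}, sSup S ∈ {P | M.IsSub P} :=
    fun S hS => isSub_sSup fun N hN => hS hN
  -- A complement of `⊥` built from minimal members is an independent family of minimal subcomodules
  -- with sum `M`.
  obtain ⟨s, hs, hind, hc⟩ := exists_sSupIndep_isCompl_of_isMinimalIn hI hS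
    (sSup_isMinimalIn_eq_top hI hS h) M.isSub_bot
  have key : ∀ P : s, ∃ (S : LeftComodule C) (f : Hom S M), S.IsSimple ∧
      Function.Injective f.toHom ∧ LinearMap.range f.toHom.toLinear = P.1 := fun P =>
    ⟨subObj hC M P.1 (hs P.2).1, subIncl hC M P.1 (hs P.2).1, isSimple_subObj hC (hs P.2),
      Subtype.val_injective, SetLike.coe_injective Subtype.range_coe⟩
  choose S f hsimple hinj hrange using key
  have hint : DirectSum.IsInternal fun P : s => LinearMap.range (f P).toHom.toLinear := by
    simp_rw [hrange]
    exact DirectSum.isInternal_submodule_of_iSupIndep_of_iSup_eq_top ((sSupIndep_iff s).1 hind)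
      (by rw [← sSup_eq_iSup', ← bot_sup_eq (sSup s)]; exact hc.sup_eq_top)
  refine ⟨s, S, f, hsimple, ?_⟩
  convert bijective_toModule (fun P => (f P).toHom.toLin) _
    (fun P => (LinearEquiv.ofInjective (f P).toHom.toLinear (hinj P)).toAddEquiv)
    (fun _ _ => rfl) hint

end LeftComodule

/-! ### Semisimple corings through complements of left subcomodules. -/

namespace Coring

variable {k A : Type u} [CommRing k] [Ring A] [Algebra k A] {C : Coring k A}

/-- The inverse of `tensorToLeft`. -/
def tensorOfLeft (C : Coring k A) : C.bim.tensor C.bim.toLeft →ₗ[k] C.bim.tensor C.bim :=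
  lift (tmulBilin C.bim C.bim) (fun m b n => smul_tmul (N := C.bim) m b n)

/-- The regular left comodule has its coaction in `C ⊗ C.toLeft`, where the right action on the
second factor is forgotten; this is identified with `C ⊗ C`. -/
theorem isLeftSub_iff {P : Submodule A C.bim.toLeft} :
    C.IsLeftSub (P.restrictScalars k) ↔ (LeftComodule.self C).IsSub P := by
  constructor
  · intro h p hp
    exact map_tensorRange (N' := C.bim.toLeft) (tensorToLeft C.bim C.bim)
      (fun c p hp => tmul_mem_tensorRange (N := C.bim.toLeft) c hp) (h.2 p hp)
  · refine fun h => ⟨fun a p hp => P.smul_mem a hp, fun p hp => ?_⟩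
    have h1 : C.tensorOfLeft (tensorToLeft C.bim C.bim (C.comul p)) = C.comul p :=
      LinearMap.congr_fun (tensor_ext (f := C.tensorOfLeft ∘ₗ tensorToLeft C.bim C.bim)
        (g := LinearMap.id) fun _ _ => rfl) (C.comul p)
    rw [← h1]
    exact map_tensorRange (N := C.bim.toLeft) C.tensorOfLeft
      (fun c p hp => tmul_mem_tensorRange (N := C.bim) c hp) (h p hp)

/-- A left subcomodule of `C` as a submodule. -/
def IsLeftSub.toSubmodule {N : Submodule k C.bim} (h : C.IsLeftSub N) :
    Submodule A C.bim.toLeft where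
  carrier := N
  add_mem' := N.add_mem
  zero_mem' := N.zero_mem
  smul_mem' a n hn := h.1 a n hn

theorem isCompl_coe {M : Type*} [AddCommGroup M] {A A' : Type*} [Ring A] [Ring A'] [Module A M]
    [Module A' M] {P Q : Submodule A M} {P' Q' : Submodule A' M} (hP : (P : Set M) = P')
    (hQ : (Q : Set M) = Q') (h : IsCompl P Q) : IsCompl P' Q' := by
  have hP1 : ∀ x, x ∈ P ↔ x ∈ P' := fun x => Set.ext_iff.1 hP x
  have hQ1 : ∀ x, x ∈ Q ↔ x ∈ Q' := fun x => Set.ext_iff.1 hQ x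
  refine ⟨Submodule.disjoint_def.2 fun x hx hx' => ?_, codisjoint_iff.2 (top_le_iff.1 fun x _ => ?_)⟩
  · exact Submodule.disjoint_def.1 h.disjoint x ((hP1 x).2 hx) ((hQ1 x).2 hx')
  · obtain ⟨y, hy, z, hz, rfl⟩ :=
      Submodule.mem_sup.1 (h.sup_eq_top.ge (Submodule.mem_top (x := x)))
    exact Submodule.add_mem_sup ((hP1 y).1 hy) ((hQ1 z).1 hz)

/-- The lattice lemmas apply in both directions because flatness closes the family of subcomodules
under intersections, while closure under sums is automatic. -/
theorem isSemisimple_iff : C.IsSemisimple ↔ C.bim.IsRightFlat ∧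
    ∀ N, C.IsLeftSub N → ∃ N', C.IsLeftSub N' ∧ IsCompl N N' := by
  constructor
  · rintro ⟨hs, hC⟩
    refine ⟨hC, fun N hN => ?_⟩
    obtain ⟨Q, hQ, hc⟩ := hs.exists_isCompl hC ((isLeftSub_iff (P := hN.toSubmodule)).1 hN)
    exact ⟨Q.restrictScalars k, isLeftSub_iff.2 hQ,
      isCompl_coe (P := hN.toSubmodule) rfl rfl hc⟩
  · rintro ⟨hC, h⟩
    refine ⟨LeftComodule.isSemisimple_of_isCompl hC fun P hP => ?_, hC⟩
    obtain ⟨N', hN', hc⟩ := h _ (isLeftSub_iff.2 hP)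
    exact ⟨hN'.toSubmodule, (isLeftSub_iff (P := hN'.toSubmodule)).1 hN',
      isCompl_coe (P := P.restrictScalars k) rfl rfl hc⟩

end Coring

/-! ### Tensoring over `A ⊗_k B`: contraction of the first factor, and flatness. -/

namespace Bimodule

section KTensorTensor

variable {k A B E F R S S' : Type u} [CommRing k] [Ring A] [Algebra k A] [Ring B] [Algebra k B]
  [Ring E] [Algebra k E] [Ring F] [Algebra k F] [Ring R] [Algebra k R] [Ring S] [Algebra k S]
  [Ring S'] [Algebra k S']

theorem kTensor_tensor_ext {M : Bimodule k E A} {M' : Bimodule k F B}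
    {N : Bimodule k (A ⊗[k] B) R} {P : Type u} [AddCommGroup P] [Module k P]
    {f g : (M.kTensor M').tensor N →ₗ[k] P}
    (h : ∀ m m' n, f (tmul (ktmul m m') n) = g (tmul (ktmul m m') n)) : f = g := by
  refine tensor_ext fun x n => ?_
  exact LinearMap.congr_fun (kTensor_ext (f := f ∘ₗ (tmulBilin (M.kTensor M') N).flip n)
    (g := g ∘ₗ (tmulBilin (M.kTensor M') N).flip n) fun m m' => h m m' n) x

theorem kTensor_induction {M : Bimodule k E A} {M' : Bimodule k F B} {p : M.kTensor M' → Prop}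
    (zero : p 0) (add : ∀ x y, p x → p y → p (x + y)) (ktmul : ∀ m m', p (ktmul m m'))
    (x : M.kTensor M') : p x :=
  TensorProduct.induction_on (motive := p) x zero ktmul add

/-- Every element of `M ⊗_k M'` involves finitely many elements of `M`. -/
theorem exists_mem_span_ktmul {M : Bimodule k E A} {M' : Bimodule k F B} (x : M.kTensor M') :
    ∃ s : Finset M, x ∈ Submodule.span k {t | ∃ m ∈ s, ∃ m' : M', t = ktmul m m'} := by
  classical
  induction x using kTensor_induction with
  | zero => exact ⟨∅, Submodule.zero_mem _⟩
  | add x y hx hy =>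
    obtain ⟨s, hs⟩ := hx
    obtain ⟨t, ht⟩ := hy
    refine ⟨s ∪ t, Submodule.add_mem _ (Submodule.span_mono ?_ hs) (Submodule.span_mono ?_ ht)⟩
    · rintro _ ⟨m, hm, h⟩; exact ⟨m, Finset.mem_union_left _ hm, h⟩
    · rintro _ ⟨m, hm, h⟩; exact ⟨m, Finset.mem_union_right _ hm, h⟩
  | ktmul m m' =>
    exact ⟨{m}, Submodule.subset_span ⟨m, Finset.mem_singleton_self m, m', rfl⟩⟩

/-- The linear map out of `(M ⊗_k M') ⊗ N` defined by a trilinear map that is balanced with respect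
to pure tensors. -/
noncomputable def kLiftBalanced {M : Bimodule k E A} {M' : Bimodule k F B}
    {N : Bimodule k (A ⊗[k] B) R} {P : Type u} [AddCommGroup P] [Module k P]
    (f : M →ₗ[k] M' →ₗ[k] N →ₗ[k] P)
    (h : ∀ (m : M) (a : A) (m' : M') (b : B) (n : N), f (op a • m) (op b • m') n = f m m' ((a ⊗ₜ[k] b) • n)) :
    (M.kTensor M').tensor N →ₗ[k] P :=
  lift (klift f) (by
    intro x s n
    induction s using TensorProduct.induction_on with
    | zero => rw [op_zero, zero_smul, zero_smul, map_zero, map_zero, LinearMap.zero_apply]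
    | add s t hs ht =>
      rw [op_add, add_smul, add_smul, map_add, map_add, LinearMap.add_apply, hs, ht]
    | tmul a b =>
      exact LinearMap.congr_fun (kTensor_ext
        (f := (klift f).flip n ∘ₗ rAct (M.kTensor M') (op (a ⊗ₜ b)))
        (g := (klift f).flip ((a ⊗ₜ[k] b) • n)) fun m m' => by
          change klift f (op (a ⊗ₜ[k] b) • ktmul m m') n = _
          rw [right_smul_ktmul]
          exact h m a m' b n) x)

/-- A left module over `A ⊗ B`, as a left module over `B`. -/
@[reducible]
def resRight (N : Bimodule k (A ⊗[k] B) R) : Bimodule k B k :=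
  ofActions N ((lAct N).comp Algebra.TensorProduct.includeRight)
    ((Algebra.ofId k (Module.End k N)).comp (AlgEquiv.toOpposite k k).symm.toAlgHom) (by
      intro b c x
      change ((1 : A) ⊗ₜ[k] b) • (unop c • x) = unop c • (((1 : A) ⊗ₜ[k] b) • x)
      exact smul_comm _ (unop c) x)

variable {M : Bimodule k E A} {M' : Bimodule k F B} {N : Bimodule k (A ⊗[k] B) R}

theorem tmul_resRight (m' : M') (b : B) (n : N) :
    tmul (N := N.resRight) (op b • m') n =
      tmul (N := N.resRight) m' (((1 : A) ⊗ₜ[k] b) • n : N) :=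
  smul_tmul (N := N.resRight) m' b n

/-- The map `(m ⊗ m') ⊗ n ↦ m' ⊗ f(m) n` for a right linear form `f`. -/
noncomputable def contractFirst (f : M →ₗ[k] regular k A) (hf : IsRightLinear f)
    (M' : Bimodule k F B) (N : Bimodule k (A ⊗[k] B) R) :
    (M.kTensor M').tensor N →ₗ[k] M'.tensor N.resRight :=
  kLiftBalanced
    (LinearMap.mk₂ k (fun m m' => tmulBilin M' N.resRight m' ∘ₗ
        lAct N ((f m : A) ⊗ₜ[k] (1 : B)))
      (fun m₁ m₂ m' => by
        rw [map_add, show ((f m₁ + f m₂ : regular k A) : A) ⊗ₜ[k] (1 : B) =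
          (f m₁ : A) ⊗ₜ[k] (1 : B) + (f m₂ : A) ⊗ₜ[k] (1 : B) from TensorProduct.add_tmul _ _ _,
          map_add, LinearMap.comp_add])
      (fun c m m' => by
        rw [map_smul, show ((c • f m : regular k A) : A) ⊗ₜ[k] (1 : B) =
          c • (f m : A) ⊗ₜ[k] (1 : B) from rfl, map_smul, LinearMap.comp_smul])
      (fun m m₁ m₂ => by rw [map_add, LinearMap.add_comp])
      (fun c m m' => by rw [map_smul, LinearMap.smul_comp]))
    (by
      intro m a m' b n
      change tmul (N := N.resRight) (op b • m') (((f (op a • m) : A) ⊗ₜ[k] (1 : B)) • n : N) =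
        tmul (N := N.resRight) m' (((f m : A) ⊗ₜ[k] (1 : B)) • ((a ⊗ₜ[k] b) • n) : N)
      rw [tmul_resRight, ← mul_smul, ← mul_smul, Algebra.TensorProduct.tmul_mul_tmul,
        Algebra.TensorProduct.tmul_mul_tmul, one_mul, one_mul, mul_one, hf]
      rfl)

theorem contractFirst_tmul (f : M →ₗ[k] regular k A) (hf : IsRightLinear f) (m : M) (m' : M')
    (n : N) : contractFirst f hf M' N (tmul (ktmul m m') n) =
      tmul (N := N.resRight) m' (((f m : A) ⊗ₜ[k] (1 : B)) • n : N) := rfl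

/-- The map `m' ⊗ n ↦ (m ⊗ m') ⊗ n`. -/
noncomputable def insertFirst (m : M) (M' : Bimodule k F B) (N : Bimodule k (A ⊗[k] B) R) :
    M'.tensor N.resRight →ₗ[k] (M.kTensor M').tensor N :=
  lift (N := N.resRight) (tmulBilin (M.kTensor M') N ∘ₗ ktmulBilin M M' m) (by
    intro m' b n
    change tmul (ktmul m (op b • m')) n = tmul (ktmul m m') (((1 : A) ⊗ₜ[k] b) • n : N)
    rw [← smul_tmul, right_smul_ktmul, op_one, one_smul])

theorem insertFirst_tmul (m : M) (m' : M') (n : N) :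
    insertFirst m M' N (tmul (N := N.resRight) m' n) = tmul (ktmul m m') n := rfl

/-- A dual basis expansion in the factor `M` alone; nothing is asked of `M'`. -/
theorem exists_kTensor_tensor (hM : M.HasLocalDual) (x : (M.kTensor M').tensor N) :
    ∃ (n : ℕ) (c : Fin n → M) (f : Fin n → M →ₗ[k] regular k A) (hf : ∀ i, IsRightLinear (f i)),
      x = ∑ i, insertFirst (c i) M' N (contractFirst (f i) (hf i) M' N x) := by
  classical
  have hx : ∃ s : Finset M, x ∈ Submodule.span k
      {t | ∃ m ∈ s, ∃ (m' : M') (n : N), t = tmul (ktmul m m') n} := by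
    induction x using tensor_induction with
    | zero => exact ⟨∅, Submodule.zero_mem _⟩
    | add x y hx hy =>
      obtain ⟨s, hs⟩ := hx
      obtain ⟨t, ht⟩ := hy
      refine ⟨s ∪ t, Submodule.add_mem _ (Submodule.span_mono ?_ hs) (Submodule.span_mono ?_ ht)⟩
      · rintro _ ⟨m, hm, h⟩; exact ⟨m, Finset.mem_union_left _ hm, h⟩
      · rintro _ ⟨m, hm, h⟩; exact ⟨m, Finset.mem_union_right _ hm, h⟩
    | tmul y n =>
      obtain ⟨s, hs⟩ := exists_mem_span_ktmul y
      refine ⟨s, Submodule.span_le (p := (Submodule.span k _).comap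
        ((tmulBilin (M.kTensor M') N).flip n)).2 ?_ hs⟩
      rintro _ ⟨m, hm, m', rfl⟩
      exact Submodule.subset_span ⟨m, hm, m', n, rfl⟩
  obtain ⟨s, hs⟩ := hx
  obtain ⟨l, c, f, hf, h⟩ := hM s
  refine ⟨l, c, f, hf, ?_⟩
  let G : (M.kTensor M').tensor N →ₗ[k] (M.kTensor M').tensor N :=
    ∑ i, insertFirst (c i) M' N ∘ₗ contractFirst (f i) (hf i) M' N
  have hG : x ∈ LinearMap.eqLocus LinearMap.id G := by
    refine Submodule.span_le.2 ?_ hs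
    rintro _ ⟨m, hm, m', n, rfl⟩
    change tmul (ktmul m m') n = G (tmul (ktmul m m') n)
    have h1 : ktmul m m' = ∑ i, ktmul (op (f i m : A) • c i) m' := by
      conv_lhs => rw [h m hm]
      exact map_sum ((ktmulBilin M M').flip m') _ _
    conv_lhs => rw [h1, sum_tmul]
    rw [LinearMap.sum_apply]
    refine Finset.sum_congr rfl fun i _ => ?_
    rw [LinearMap.comp_apply, contractFirst_tmul, insertFirst_tmul, ← smul_tmul, right_smul_ktmul,
      op_one, one_smul]
  refine (show x = G x from hG).trans ?_
  rw [LinearMap.sum_apply]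
  rfl

/-- A homomorphism of left modules over `A ⊗ B`, over `B`. -/
def Hom.resRight {N N' : Bimodule k (A ⊗[k] B) k} (g : Hom N N') : Hom N.resRight N'.resRight where
  toLin := g.toLin
  map_left b n := g.map_left (1 ⊗ₜ b) n
  map_right c n := by rw [op_base_smul, op_base_smul, map_smul]

/-- Contracting `M` lands in `M' ⊗_B N`, naturally in `N`, and there flatness of `M'` applies. By
the preceding expansion the contractions together detect zero. -/
theorem HasLocalDual.kTensor_isRightFlat (hM : M.HasLocalDual) (hM' : M'.IsRightFlat) :
    (M.kTensor M').IsRightFlat := by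
  intro N N' g hg
  refine (injective_iff_map_eq_zero (map (Hom.id (M.kTensor M')) g).toLin).2 fun x hx => ?_
  obtain ⟨n, c, f, hf, h⟩ := exists_kTensor_tensor hM x
  rw [h]
  refine Finset.sum_eq_zero fun i _ => ?_
  have h1 : map (Hom.id M') g.resRight (contractFirst (f i) (hf i) M' N x) =
      contractFirst (f i) (hf i) M' N' (map (Hom.id (M.kTensor M')) g x) :=
    LinearMap.congr_fun (kTensor_tensor_ext
      (f := (map (Hom.id M') g.resRight).toLin ∘ₗ contractFirst (f i) (hf i) M' N)
      (g := contractFirst (f i) (hf i) M' N' ∘ₗ (map (Hom.id (M.kTensor M')) g).toLin)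
      fun m m' n => congrArg (tmul (N := N'.resRight) m') (g.map_left _ _)) x
  have h2 : contractFirst (f i) (hf i) M' N x = 0 := hM' _ _ g.resRight hg (by
    rw [h1, show map (Hom.id (M.kTensor M')) g x = 0 from hx, map_zero, map_zero])
  rw [h2, map_zero]

end KTensorTensor
end Bimodule

open Bimodule

/-! ### The module of comodule homomorphisms, and projections. -/

namespace LeftComodule

variable {k A : Type u} [CommRing k] [Ring A] [Algebra k A] {C : Coring k A}

/-- The composition of homomorphisms of comodules. -/
def Hom.comp {L M N : LeftComodule C} (g : Hom M N) (f : Hom L M) : Hom L N where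
  toHom := g.toHom.comp f.toHom
  colinear m := by
    refine (g.colinear (f.toHom m)).trans ((congrArg _ (f.colinear m)).trans ?_)
    exact LinearMap.congr_fun (tensor_ext
      (f := (map (Bimodule.Hom.id C.bim) g.toHom).toLin ∘ₗ
        (map (Bimodule.Hom.id C.bim) f.toHom).toLin)
      (g := (map (Bimodule.Hom.id C.bim) (g.toHom.comp f.toHom)).toLin) fun _ _ => rfl) (L.coact m)

/-- The `k`-module of homomorphisms of comodules. -/
def homs (M N : LeftComodule C) : Submodule k (M.obj →ₗ[k] N.obj) where
  carrier := {f | ∃ h : Hom M N, h.toHom.toLin = f}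
  add_mem' := by
    rintro _ _ ⟨f, rfl⟩ ⟨g, rfl⟩
    refine ⟨⟨⟨f.toHom.toLin + g.toHom.toLin, fun a m => ?_, fun c m => ?_⟩, fun m => ?_⟩, rfl⟩
    · rw [LinearMap.add_apply, LinearMap.add_apply, f.toHom.map_left, g.toHom.map_left, smul_add]
    · rw [LinearMap.add_apply, LinearMap.add_apply, f.toHom.map_right, g.toHom.map_right, smul_add]
    · rw [LinearMap.add_apply, map_add, f.colinear, g.colinear]
      exact LinearMap.congr_fun (tensor_ext
        (f := (map (Bimodule.Hom.id C.bim) f.toHom).toLin +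
          (map (Bimodule.Hom.id C.bim) g.toHom).toLin)
        (g := (map (Bimodule.Hom.id C.bim) _).toLin)
        fun c m => (map_add (tmulBilin C.bim N.obj c) _ _).symm) (M.coact m)
  zero_mem' := by
    refine ⟨⟨⟨0, fun a m => (smul_zero a).symm, fun c m => (smul_zero _).symm⟩, fun m => ?_⟩, rfl⟩
    rw [LinearMap.zero_apply, map_zero]
    exact LinearMap.congr_fun (tensor_ext (f := 0)
      (g := (map (Bimodule.Hom.id C.bim) _).toLin)
        fun _ _ => (map_zero (tmulBilin C.bim N.obj _)).symm) (M.coact m)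
  smul_mem' := by
    rintro c _ ⟨f, rfl⟩
    refine ⟨⟨⟨c • f.toHom.toLin, fun a m => ?_, fun b m => ?_⟩, fun m => ?_⟩, rfl⟩
    · rw [LinearMap.smul_apply, LinearMap.smul_apply, f.toHom.map_left, smul_comm]
    · rw [LinearMap.smul_apply, LinearMap.smul_apply, f.toHom.map_right, smul_comm]
    · rw [LinearMap.smul_apply, map_smul, f.colinear]
      exact LinearMap.congr_fun (tensor_ext
        (f := c • (map (Bimodule.Hom.id C.bim) f.toHom).toLin)
        (g := (map (Bimodule.Hom.id C.bim) _).toLin)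
        fun _ _ => (map_smul (tmulBilin C.bim N.obj _) c _).symm) (M.coact m)

theorem comp_mem_homs {L M N : LeftComodule C} {g : M.obj →ₗ[k] N.obj} {f : L.obj →ₗ[k] M.obj}
    (hg : g ∈ homs M N) (hf : f ∈ homs L M) : g ∘ₗ f ∈ homs L N := by
  obtain ⟨g, rfl⟩ := hg
  obtain ⟨f, rfl⟩ := hf
  exact ⟨g.comp f, rfl⟩

theorem id_mem_homs (M : LeftComodule C) : LinearMap.id ∈ homs M M :=
  ⟨⟨Bimodule.Hom.id _, fun m => LinearMap.congr_fun (tensor_ext (f := LinearMap.id)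
    (g := (map (Bimodule.Hom.id C.bim) _).toLin) fun _ _ => rfl) (M.coact m)⟩, rfl⟩

/-- The projection onto a subcomodule along a complementary one is a homomorphism. -/
theorem IsSub.exists_projection {M : LeftComodule C} {P Q : Submodule A M.obj} (hP : M.IsSub P)
    (hQ : M.IsSub Q) (h : IsCompl P Q) :
    ∃ p ∈ homs M M, (∀ m, p m ∈ P) ∧ ∀ m ∈ P, p m = m := by
  let p : M.obj →ₗ[A] M.obj := P.subtype ∘ₗ Submodule.projectionOnto P Q h
  have hpP : ∀ m ∈ P, p m = m := fun m hm =>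
    congrArg Subtype.val (Submodule.projectionOnto_apply_left h ⟨m, hm⟩)
  have hpQ : ∀ m ∈ Q, p m = 0 := fun m hm =>
    congrArg Subtype.val (Submodule.projectionOnto_apply_right h ⟨m, hm⟩)
  let p' : Bimodule.Hom M.obj M.obj := Bimodule.Hom.ofLinear p
  refine ⟨p'.toLin, ⟨⟨p', fun m => ?_⟩, rfl⟩, fun m => Subtype.property (p := (· ∈ P)) _, hpP⟩
  obtain ⟨x, hx, y, hy, rfl⟩ := Submodule.mem_sup.1 (h.sup_eq_top.ge (Submodule.mem_top (x := m)))
  have h1 : tensorRange C.bim M.obj (P : Set M.obj) ≤ LinearMap.eqLocus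
      (map (Bimodule.Hom.id C.bim) p').toLin LinearMap.id :=
    tensorRange_le fun c m hm => congrArg (tmul c) (hpP m hm)
  have h2 : tensorRange C.bim M.obj (Q : Set M.obj) ≤ LinearMap.ker
      (map (Bimodule.Hom.id C.bim) p').toLin :=
    tensorRange_le fun c m hm => (congrArg (tmul c) (hpQ m hm)).trans
      (map_zero (tmulBilin C.bim M.obj c))
  rw [map_add, map_add, map_add, map_add, show p' x = x from hpP x hx,
    show p' y = 0 from hpQ y hy, map_zero, show map _ p' (M.coact x) = M.coact x from h1 (hP x hx),
    show map _ p' (M.coact y) = 0 from h2 (hQ y hy)]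

end LeftComodule

/-! ### `C ⊗_k D` as a left `D`-comodule. -/

namespace Coring

variable {k A B : Type u} [CommRing k] [Ring A] [Algebra k A] [Ring B] [Algebra k B]
  (C : Coring k A) (D : Coring k B)

/-- The map `d ⊗ d' ↦ (c ↦ d ⊗ (c ⊗ d'))`. -/
noncomputable def copyMap :
    D.bim.tensor D.bim →ₗ[k] C.bim →ₗ[k] D.bim.tensor (C.bim.kTensor D.bim).resRight :=
  lift ((LinearMap.llcomp k C.bim (C.bim.kTensor D.bim)
      (D.bim.tensor (C.bim.kTensor D.bim).resRight)).compl₁₂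
        (tmulBilin D.bim (C.bim.kTensor D.bim).resRight) (ktmulBilin C.bim D.bim).flip)
    (fun d b d' => LinearMap.ext fun c => by
      change tmul (N := (C.bim.kTensor D.bim).resRight) (op b • d) (ktmul c d') =
        tmul (N := (C.bim.kTensor D.bim).resRight) d (ktmul c (b • d'))
      rw [tmul_resRight, left_smul_ktmul, one_smul])

/-- The coaction of `D` on `C ⊗_k D` through the second factor, as a linear map. -/
noncomputable def copyCoact :
    C.bim.kTensor D.bim →ₗ[k] D.bim.tensor (C.bim.kTensor D.bim).resRight :=
  klift (copyMap C D ∘ₗ D.comul.toLin).flip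

theorem isLeftLinear_ktmul (c : C.bim) :
    IsLeftLinear (N := D.bim) (N' := (C.bim.kTensor D.bim).resRight) (ktmulBilin C.bim D.bim c) :=
  fun b d => by
    change ktmul c (b • d) = ((1 : A) ⊗ₜ[k] b) • ktmul c d
    rw [left_smul_ktmul, one_smul]

theorem isLeftLinear_copyMap (c : C.bim) : IsLeftLinear (N := D.bim.tensor D.bim)
    (N' := D.bim.tensor (C.bim.kTensor D.bim).resRight) ((copyMap C D).flip c) :=
  fun b s => LinearMap.congr_fun (tensor_ext
    (f := (copyMap C D).flip c ∘ₗ lAct (D.bim.tensor D.bim) b)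
    (g := lAct (D.bim.tensor (C.bim.kTensor D.bim).resRight) b ∘ₗ (copyMap C D).flip c)
    fun _ _ => rfl) s

/-- The coaction of `D` on `C ⊗_k D` through the second factor. -/
noncomputable def copyCoactHom : Hom (C.bim.kTensor D.bim).resRight
    (D.bim.tensor (C.bim.kTensor D.bim).resRight) where
  toLin := copyCoact C D
  map_left b x := LinearMap.congr_fun (kTensor_ext
    (f := copyCoact C D ∘ₗ lAct (C.bim.kTensor D.bim) (1 ⊗ₜ b))
    (g := lAct (D.bim.tensor (C.bim.kTensor D.bim).resRight) b ∘ₗ copyCoact C D)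
    fun c d => by
      change copyCoact C D (((1 : A) ⊗ₜ[k] b) • ktmul c d) = b • copyMap C D (D.comul d) c
      rw [left_smul_ktmul, one_smul]
      refine (congrArg (fun s => copyMap C D s c) (D.comul.map_left b d)).trans ?_
      exact isLeftLinear_copyMap C D c b (D.comul d)) x
  map_right c x := by rw [op_base_smul, op_base_smul, map_smul]

/-- The map `d ⊗ (d' ⊗ d'') ↦ d ⊗ (d' ⊗ (c ⊗ d''))`. -/
noncomputable def copyMap₂ (c : C.bim) : D.bim.tensor (D.bim.tensor D.bim) →ₗ[k]
    D.bim.tensor (D.bim.tensor (C.bim.kTensor D.bim).resRight) :=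
  mapRight D.bim (N' := D.bim.tensor (C.bim.kTensor D.bim).resRight)
    ((copyMap C D).flip c) (isLeftLinear_copyMap C D c)

theorem assoc_copyMap (c : C.bim) (s : D.bim.tensor D.bim) :
    assoc _ _ _ (map D.comul (Hom.id _) (copyMap C D s c)) =
      copyMap₂ C D c (assoc _ _ _ (map D.comul (Hom.id _) s)) :=
  LinearMap.congr_fun (tensor_ext
    (f := assoc _ _ _ ∘ₗ (map D.comul (Hom.id (C.bim.kTensor D.bim).resRight)).toLin ∘ₗ
      (copyMap C D).flip c)
    (g := copyMap₂ C D c ∘ₗ assoc _ _ _ ∘ₗ (map D.comul (Hom.id _)).toLin)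
    fun d d' => LinearMap.congr_fun (tensor_ext
      (f := assoc _ _ _ ∘ₗ (tmulBilin (D.bim.tensor D.bim)
        (C.bim.kTensor D.bim).resRight).flip (ktmul c d'))
      (g := copyMap₂ C D c ∘ₗ assoc _ _ _ ∘ₗ
          (tmulBilin (D.bim.tensor D.bim) D.bim).flip d')
      fun _ _ => rfl) (D.comul d)) s

theorem map_copyMap (c : C.bim) (s : D.bim.tensor D.bim) :
    map (Hom.id _) (copyCoactHom C D) (copyMap C D s c) =
      copyMap₂ C D c (map (Hom.id _) D.comul s) :=
  LinearMap.congr_fun (tensor_ext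
    (f := (map (Hom.id _) (copyCoactHom C D)).toLin ∘ₗ (copyMap C D).flip c)
    (g := copyMap₂ C D c ∘ₗ (map (Hom.id _) D.comul).toLin)
    fun _ _ => rfl) s

theorem lid_copyMap (c : C.bim) (s : D.bim.tensor D.bim) :
    lid (C.bim.kTensor D.bim).resRight (map D.counit (Hom.id _) (copyMap C D s c)) =
      ktmul c (lid _ (map D.counit (Hom.id _) s)) :=
  LinearMap.congr_fun (tensor_ext (P := C.bim.kTensor D.bim)
    (f := lid (C.bim.kTensor D.bim).resRight ∘ₗ
      (map D.counit (Hom.id (C.bim.kTensor D.bim).resRight)).toLin ∘ₗ (copyMap C D).flip c)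
    (g := ktmulBilin C.bim D.bim c ∘ₗ lid _ ∘ₗ (map D.counit (Hom.id _)).toLin)
    fun d d' => (isLeftLinear_ktmul C D c (D.counit d) d').symm) s

/-- The left `D`-comodule `C ⊗_k D`. -/
noncomputable def copies : LeftComodule D where
  obj := (C.bim.kTensor D.bim).resRight
  coact := copyCoactHom C D
  coassoc := fun x => LinearMap.congr_fun (kTensor_ext
    (f := assoc _ _ _ ∘ₗ (map D.comul (Hom.id (C.bim.kTensor D.bim).resRight)).toLin ∘ₗ
      copyCoact C D)
    (g := (map (Hom.id _) (copyCoactHom C D)).toLin ∘ₗ copyCoact C D) fun c d =>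
      (assoc_copyMap C D c (D.comul d)).trans ((congrArg _ (D.coassoc d)).trans
        (map_copyMap C D c (D.comul d)).symm)) x
  lid_counit := fun x => LinearMap.congr_fun (kTensor_ext (P := C.bim.kTensor D.bim)
    (f := lid (C.bim.kTensor D.bim).resRight ∘ₗ
      (map D.counit (Hom.id (C.bim.kTensor D.bim).resRight)).toLin ∘ₗ copyCoact C D)
    (g := LinearMap.id) fun c d => (lid_copyMap C D c (D.comul d)).trans
      (congrArg (ktmul c) (D.lid_counit d))) x

/-- The homomorphism of comodules `D → C ⊗_k D` defined by an element of `C`. -/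
noncomputable def copyHom (c : C.bim) : LeftComodule.Hom (LeftComodule.self D) (copies C D) where
  toHom :=
    { toLin := ktmulBilin C.bim D.bim c
      map_left := isLeftLinear_ktmul C D c
      map_right := fun b d => by
        rw [op_base_smul, op_base_smul]
        exact map_smul (ktmulBilin C.bim D.bim c) b d }
  colinear d := LinearMap.congr_fun (tensor_ext (f := (copyMap C D).flip c)
    (g := mapRight D.bim (N := D.bim.toLeft) (N' := (C.bim.kTensor D.bim).resRight)
      (ktmulBilin C.bim D.bim c) (isLeftLinear_ktmul C D c) ∘ₗ
        tensorToLeft D.bim D.bim) fun _ _ => rfl) (D.comul d)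

end Coring

open Bimodule

theorem Bimodule.exists_sum_ktmul {k A B A' B' : Type u} [CommRing k] [Ring A] [Algebra k A]
    [Ring B] [Algebra k B] [Ring A'] [Algebra k A'] [Ring B'] [Algebra k B']
    {M : Bimodule k A B} {M' : Bimodule k A' B'} (x : M.kTensor M') :
    ∃ (n : ℕ) (m : Fin n → M) (m' : Fin n → M'), x = ∑ i, ktmul (m i) (m' i) := by
  induction x using kTensor_induction with
  | zero => exact ⟨0, Fin.elim0, Fin.elim0, by simp⟩
  | add x y hx hy =>
    obtain ⟨n, m, p, rfl⟩ := hx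
    obtain ⟨n', m', p', rfl⟩ := hy
    exact ⟨n + n', Fin.append m m', Fin.append p p', by simp [Fin.sum_univ_add]⟩
  | ktmul m m' => exact ⟨1, fun _ => m, fun _ => m', by simp⟩

/-! ### Left subcomodules of the coring `C ⊗_k D`. -/

namespace Coring

section Char

variable {k A B : Type u} [CommRing k] [Ring A] [Algebra k A] [Ring B] [Algebra k B]
  {C : Coring k A} {D : Coring k B}

theorem isRightColinear_id : C.IsRightColinear LinearMap.id :=
  ⟨isRightLinear_id, fun c => LinearMap.congr_fun (tensor_ext (f := LinearMap.id)
    (g := mapLeft LinearMap.id isRightLinear_id C.bim) fun _ _ => rfl) (C.comul c)⟩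

theorem IsRightColinear.tensor {r : C.bim →ₗ[k] C.bim} {s : D.bim →ₗ[k] D.bim}
    (hr : C.IsRightColinear r) (hs : D.IsRightColinear s) :
    (C.tensor D).IsRightColinear (kMapLin' (M := C.bim) (M' := D.bim) r s) := by
  obtain ⟨hr1, hr2⟩ := hr
  obtain ⟨hs1, hs2⟩ := hs
  have h1 : IsRightLinear (kMapLin' (M := C.bim) (M' := D.bim) (N := C.bim) (N' := D.bim) r s) := by
    intro t x
    induction t using TensorProduct.induction_on with
    | zero => rw [op_zero, zero_smul, zero_smul, map_zero]
    | add t t' ht ht' => rw [op_add, add_smul, add_smul, map_add, ht, ht']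
    | tmul a b =>
      refine LinearMap.congr_fun (kTensor_ext
        (f := kMapLin' r s ∘ₗ rAct (C.bim.kTensor D.bim) (op (a ⊗ₜ b)))
        (g := rAct (C.bim.kTensor D.bim) (op (a ⊗ₜ b)) ∘ₗ kMapLin' r s) fun c d => ?_) x
      change kMapLin' r s (op (a ⊗ₜ[k] b) • ktmul c d) = op (a ⊗ₜ[k] b) • ktmul (r c) (s d)
      rw [right_smul_ktmul, right_smul_ktmul, ← hr1, ← hs1]
      rfl
  refine ⟨h1, fun x => LinearMap.congr_fun (kTensor_ext
    (f := (tensorComul C D).toLin ∘ₗ kMapLin' r s)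
    (g := mapLeft _ h1 (C.bim.kTensor D.bim) ∘ₗ (tensorComul C D).toLin) fun c d => ?_) x⟩
  change interchange _ _ _ _ (ktmul (C.comul (r c)) (D.comul (s d))) =
    mapLeft _ h1 _ (interchange _ _ _ _ (ktmul (C.comul c) (D.comul d)))
  rw [hr2, hs2]
  exact LinearMap.congr_fun (interchange_ext
    (f := (interchange C.bim C.bim D.bim D.bim).toLin ∘ₗ
      kMapLin' (mapLeft r hr1 C.bim) (mapLeft s hs1 D.bim))
    (g := mapLeft _ h1 (C.bim.kTensor D.bim) ∘ₗ (interchange C.bim C.bim D.bim D.bim).toLin)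
    fun _ _ _ _ => rfl) (ktmul (C.comul c) (D.comul d))

theorem isRightLinear_counit : IsRightLinear C.counit.toLin := C.counit.map_right

/-- Applying `ε` of `C` to the first leg of the comultiplication leaves only the coaction of `D`.
Hence subcomodules over the coring `C ⊗ D` are subcomodules over `D`. -/
theorem contractFirst_comul (x : C.bim.kTensor D.bim) :
    contractFirst C.counit.toLin isRightLinear_counit D.bim (C.bim.kTensor D.bim)
      (tensorComul C D x) = copyCoact C D x := by
  have key : ∀ s t, contractFirst C.counit.toLin isRightLinear_counit D.bim (C.bim.kTensor D.bim)
      (interchange C.bim C.bim D.bim D.bim (ktmul s t)) =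
        copyMap C D t (lid _ (map C.counit (Hom.id _) s)) := fun s t =>
    LinearMap.congr_fun (interchange_ext
      (f := contractFirst C.counit.toLin isRightLinear_counit D.bim (C.bim.kTensor D.bim) ∘ₗ
        (interchange C.bim C.bim D.bim D.bim).toLin)
      (g := klift ((copyMap C D).flip ∘ₗ lid _ ∘ₗ (map C.counit (Hom.id _)).toLin))
      fun c c' d d' => by
        refine congrArg (tmulBilin D.bim (C.bim.kTensor D.bim).resRight d)
          ((left_smul_ktmul (C.counit c : A) (1 : B) c' d').trans ?_)
        rw [one_smul]
        rfl) (ktmul s t)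
  refine LinearMap.congr_fun (kTensor_ext
    (f := contractFirst C.counit.toLin isRightLinear_counit D.bim (C.bim.kTensor D.bim) ∘ₗ
      (tensorComul C D).toLin) (g := copyCoact C D) fun c d => ?_) x
  refine (key (C.comul c) (D.comul d)).trans ?_
  rw [C.lid_counit]
  rfl

theorem IsLeftSub.copyCoact_mem {N : Submodule k (C.bim.kTensor D.bim)}
    (hN : (C.tensor D).IsLeftSub N) {n : C.bim.kTensor D.bim} (hn : n ∈ N) :
    copyCoact C D n ∈ tensorRange D.bim (C.bim.kTensor D.bim).resRight (N : Set (C.bim.kTensor D.bim)) := by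
  rw [← contractFirst_comul]
  refine tensorRange_le (M := C.bim.kTensor D.bim)
    (W := (tensorRange D.bim (C.bim.kTensor D.bim).resRight N).comap
      (contractFirst C.counit.toLin isRightLinear_counit D.bim (C.bim.kTensor D.bim)))
    (fun x p hp => ?_) (hN.2 n hn)
  rw [Submodule.mem_comap]
  induction x using kTensor_induction with
  | zero =>
    rw [show tmul (0 : C.bim.kTensor D.bim) p = 0 from
      LinearMap.congr_fun (map_zero (tmulBilin _ _)) p, map_zero]
    exact Submodule.zero_mem _
  | add x y hx hy =>
    rw [show tmul (x + y) p = tmul x p + tmul y p from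
      LinearMap.congr_fun (map_add (tmulBilin _ _) x y) p, map_add]
    exact Submodule.add_mem _ hx hy
  | ktmul c d =>
    exact tmul_mem_tensorRange (N := (C.bim.kTensor D.bim).resRight) d
      (hN.1 ((C.counit c : A) ⊗ₜ[k] (1 : B)) p hp)

theorem left_smul_tmul_one (a : A) (x : C.bim.kTensor D.bim) :
    (a ⊗ₜ[k] (1 : B)) • x = kMapLin' (M := C.bim) (M' := D.bim) (N := C.bim) (N' := D.bim)
      (lAct C.bim a) LinearMap.id x :=
  LinearMap.congr_fun (kTensor_ext (f := lAct (C.bim.kTensor D.bim) (a ⊗ₜ 1))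
    (g := kMapLin' (lAct C.bim a) LinearMap.id) fun c d =>
      (left_smul_ktmul a (1 : B) c d).trans (by rw [one_smul]; rfl)) x

theorem left_smul_one_tmul (b : B) (x : C.bim.kTensor D.bim) :
    ((1 : A) ⊗ₜ[k] b) • x = kMapLin' (M := C.bim) (M' := D.bim) (N := C.bim) (N' := D.bim)
      LinearMap.id (lAct D.bim b) x :=
  LinearMap.congr_fun (kTensor_ext (f := lAct (C.bim.kTensor D.bim) (1 ⊗ₜ b))
    (g := kMapLin' LinearMap.id (lAct D.bim b)) fun c d =>
      (left_smul_ktmul (1 : A) b c d).trans (by rw [one_smul]; rfl)) x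

/-- With `Δ c = ∑ eⱼ ⊗ rⱼ c`, the comultiplication of `n` is the sum over `j` of the `D`-coaction of
`(rⱼ ⊗ 1) n` with `eⱼ` inserted in front. Dual bases are needed only for `C`, which leaves `D`
arbitrary. -/
theorem isLeftSub_tensor (hC : C.bim.HasLocalDual) {N : Submodule k (C.bim.kTensor D.bim)}
    (h1 : ∀ r, C.IsRightColinear r → ∀ n ∈ N,
      kMapLin' (M := C.bim) (M' := D.bim) (N := C.bim) (N' := D.bim) r LinearMap.id n ∈ N)
    (h2 : ∀ b : B, ∀ n ∈ N, ((1 : A) ⊗ₜ[k] b) • n ∈ N)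
    (h3 : ∀ n ∈ N, copyCoact C D n ∈
      tensorRange D.bim (C.bim.kTensor D.bim).resRight (N : Set (C.bim.kTensor D.bim))) :
    (C.tensor D).IsLeftSub N := by
  classical
  refine ⟨fun t n hn => ?_, fun n hn => ?_⟩
  · change t • (show C.bim.kTensor D.bim from n) ∈ N
    induction t using TensorProduct.induction_on with
    | zero => rw [zero_smul]; exact N.zero_mem
    | add t t' ht ht' => rw [add_smul]; exact N.add_mem ht ht'
    | tmul a b =>
      have : a ⊗ₜ[k] b = ((1 : A) ⊗ₜ[k] b) * (a ⊗ₜ[k] (1 : B)) := by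
        rw [Algebra.TensorProduct.tmul_mul_tmul, one_mul, mul_one]
      rw [this, mul_smul]
      refine h2 b _ ?_
      rw [left_smul_tmul_one]
      exact h1 _ (isRightColinear_lAct a) n hn
  · obtain ⟨m, c, d, hx⟩ := exists_sum_ktmul (M := C.bim) (M' := D.bim) n
    obtain ⟨l, e, r, hr, he⟩ := exists_comul_eq_sum hC (Finset.univ.image c)
    have key : tensorComul C D n =
        ∑ j, insertFirst (e j) D.bim (C.bim.kTensor D.bim)
          (copyCoact C D (kMapLin' (r j) LinearMap.id n)) := by
      rw [hx]
      simp only [map_sum]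
      rw [Finset.sum_comm]
      refine Finset.sum_congr rfl fun i _ => ?_
      change interchange _ _ _ _ (ktmulBilin _ _ (C.comul (c i)) (D.comul (d i))) = _
      rw [he (c i) (Finset.mem_image_of_mem _ (Finset.mem_univ i)), map_sum, LinearMap.sum_apply,
        map_sum]
      exact Finset.sum_congr rfl fun j _ => LinearMap.congr_fun (tensor_ext
        (f := (interchange C.bim C.bim D.bim D.bim).toLin ∘ₗ
          ktmulBilin _ _ (tmul (e j) (r j (c i))))
        (g := insertFirst (e j) D.bim (C.bim.kTensor D.bim) ∘ₗ (copyMap C D).flip (r j (c i)))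
        fun _ _ => rfl) (D.comul (d i))
    refine (show (C.tensor D).comul n = _ from key) ▸ Submodule.sum_mem _ fun j _ => ?_
    exact tensorRange_le (N := (C.bim.kTensor D.bim).resRight)
      (W := (tensorRange (C.bim.kTensor D.bim) (C.bim.kTensor D.bim) N).comap
        (insertFirst (e j) D.bim (C.bim.kTensor D.bim)))
      (fun d p hp => tmul_mem_tensorRange (N := C.bim.kTensor D.bim) (ktmul (e j) d) hp)
      (h3 _ (h1 _ (hr j) n hn))

theorem isLeftSub_tensor_of_stable (hC : C.bim.HasLocalDual) (hD : D.bim.HasLocalDual)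
    {N : Submodule k (C.bim.kTensor D.bim)}
    (h1 : ∀ r, C.IsRightColinear r → ∀ n ∈ N,
      kMapLin' (M := C.bim) (M' := D.bim) (N := C.bim) (N' := D.bim) r LinearMap.id n ∈ N)
    (h2 : ∀ s, D.IsRightColinear s → ∀ n ∈ N,
      kMapLin' (M := C.bim) (M' := D.bim) (N := C.bim) (N' := D.bim) LinearMap.id s n ∈ N) :
    (C.tensor D).IsLeftSub N := by
  classical
  refine isLeftSub_tensor hC h1 (fun b n hn => ?_) fun n hn => ?_
  · rw [left_smul_one_tmul]
    exact h2 _ (isRightColinear_lAct b) n hn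
  · obtain ⟨m, c, d, hx⟩ := exists_sum_ktmul (M := C.bim) (M' := D.bim) n
    obtain ⟨l, e, s, hs, he⟩ := exists_comul_eq_sum hD (Finset.univ.image d)
    have key : copyCoact C D n = ∑ j, tmul (N := (C.bim.kTensor D.bim).resRight) (e j)
        (kMapLin' (M := C.bim) (M' := D.bim) (N := C.bim) (N' := D.bim) LinearMap.id (s j) n) := by
      rw [hx]
      simp only [map_sum]
      have h4 : ∀ j, tmul (N := (C.bim.kTensor D.bim).resRight) (e j) (∑ i, kMapLin' (M := C.bim)
          (M' := D.bim) (N := C.bim) (N' := D.bim) LinearMap.id (s j) (ktmul (c i) (d i))) =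
          ∑ i, tmul (N := (C.bim.kTensor D.bim).resRight) (e j) (ktmul (c i) (s j (d i))) :=
        fun j => tmul_sum (N := (C.bim.kTensor D.bim).resRight) _ _ _
      rw [Finset.sum_congr rfl fun j _ => h4 j, Finset.sum_comm]
      refine Finset.sum_congr rfl fun i _ => ?_
      change copyMap C D (D.comul (d i)) (c i) = _
      rw [he (d i) (Finset.mem_image_of_mem _ (Finset.mem_univ i)), map_sum, LinearMap.sum_apply]
      rfl
    rw [key]
    exact Submodule.sum_mem _ fun j _ => tmul_mem_tensorRange
      (N := (C.bim.kTensor D.bim).resRight) (e j) (h2 _ (hs j) n hn)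

end Char

/-! ### Complements in the `D`-comodule `C ⊗_k D`. -/

section Semisimple

variable {k A B : Type u} [Field k] [Ring A] [Algebra k A] [Ring B] [Algebra k B]
  {C : Coring k A} {D : Coring k B}

theorem ktmulBilin_injective {c : C.bim} (hc : c ≠ 0) :
    Function.Injective (ktmulBilin C.bim D.bim c) := by
  obtain ⟨f, hf⟩ : ∃ f : Module.Dual k C.bim, f c ≠ 0 := by
    by_contra! h
    exact hc ((Module.forall_dual_apply_eq_zero_iff k c).1 h)
  refine (injective_iff_map_eq_zero _).2 fun d hd => ?_
  have := congrArg (TensorProduct.lid k D.bim ∘ TensorProduct.map f LinearMap.id) hd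
  have h2 : f c • d = 0 := by
    refine Eq.trans ?_ (this.trans ?_)
    · exact (TensorProduct.lid_tmul d (f c)).symm
    · exact (congrArg _ (map_zero _)).trans (map_zero _)
  exact (smul_eq_zero.1 h2).resolve_left hf

/-- The images `c ⊗ D` span, and for `c ≠ 0` the map `d ↦ c ⊗ d` is injective since `k` is a field,
so it carries the simple constituents of `D` to minimal subcomodules. -/
theorem copies_exists_isCompl (hD : D.IsSemisimple) {P : Submodule B (copies C D).obj}
    (hP : (copies C D).IsSub P) : ∃ Q, (copies C D).IsSub Q ∧ IsCompl P Q := by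
  refine LeftComodule.exists_isCompl hD.2 (top_le_iff.1 fun x _ => ?_) hP
  obtain ⟨ι, S, f, hf, htop⟩ := hD.1.exists_homs
  refine kTensor_induction (M := C.bim) (M' := D.bim) (p := (· ∈ sSup {P | IsMinimalIn {P | (copies C D).IsSub P} P}))
    (Submodule.zero_mem _) (fun x y hx hy => Submodule.add_mem _ hx hy) (fun c d => ?_) x
  by_cases hc : c = 0
  · subst hc
    have : ktmul (0 : C.bim) d = 0 := LinearMap.congr_fun (map_zero (ktmulBilin C.bim D.bim)) d
    rw [this]
    exact Submodule.zero_mem (sSup {P | IsMinimalIn {P | (copies C D).IsSub P} P})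
  · have h1 : (⊤ : Submodule B (LeftComodule.self D).obj) ≤
        (sSup {P | IsMinimalIn {P | (copies C D).IsSub P} P}).comap
          (copyHom C D c).toHom.toLinear := by
      rw [← htop]
      refine iSup_le fun i => ?_
      rintro _ ⟨y, rfl⟩
      have h2 : LinearMap.range ((copyHom C D c).comp (f i)).toHom.toLinear ≤
          sSup {P | IsMinimalIn {P | (copies C D).IsSub P} P} :=
        le_sSup (LeftComodule.isMinimalIn_range hD.2 _ (hf i).1
          ((ktmulBilin_injective hc).comp (hf i).2))
      exact h2 ⟨y, rfl⟩
    exact h1 (Submodule.mem_top (x := d))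

end Semisimple

end Coring

/-! ### Averaging a `D`-colinear projection by coseparability. -/

open Bimodule

/-- Inserting the Casimir element makes an arbitrary bilinear map balanced over `A`. -/
theorem exists_lift_of_casimir {k A A' R : Type u} [CommRing k] [Ring A] [Algebra k A]
    [Ring A'] [Algebra k A'] [Ring R] [Algebra k R] {n : ℕ} {x y : Fin n → A}
    (h : ∀ a : A, ∑ i, (a * x i) ⊗ₜ[k] y i = ∑ i, x i ⊗ₜ[k] (y i * a))
    {M : Bimodule k A' A} {N : Bimodule k A R} {P : Type u} [AddCommGroup P] [Module k P]
    (f : M →ₗ[k] N →ₗ[k] P) :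
    ∃ F : M.tensor N →ₗ[k] P, ∀ m n, F (tmul m n) = ∑ i, f (op (x i) • m) (y i • n) := by
  let g : M →ₗ[k] N →ₗ[k] P := ∑ i, f.compl₁₂ (rAct M (op (x i))) (lAct N (y i))
  have hg : ∀ m n, g m n = ∑ i, f (op (x i) • m) (y i • n) := fun m n => by
    simp only [g, LinearMap.sum_apply]
    rfl
  refine ⟨lift g fun m a n => ?_, hg⟩
  rw [hg, hg]
  have := congrArg (TensorProduct.lift (f.compl₁₂
    ((rAct M).toLinearMap.flip m ∘ₗ (opLinearEquiv k : A ≃ₗ[k] Aᵐᵒᵖ).toLinearMap)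
    ((lAct N).toLinearMap.flip n))) (h a)
  simp only [map_sum, TensorProduct.lift.tmul] at this
  refine (Finset.sum_congr rfl fun i _ => ?_).trans (this.trans (Finset.sum_congr rfl fun i _ => ?_))
  · rw [← mul_smul, ← op_mul]
    rfl
  · rw [← mul_smul]
    rfl

namespace Coring

section

variable {k A B : Type u} [CommRing k] [Ring A] [Algebra k A] [Ring B] [Algebra k B]
  {C : Coring k A} {D : Coring k B}

variable (C D) in
/-- The action of endomorphisms of `C` on the first factor of `C ⊗_k D`. -/
noncomputable def onFirst : (C.bim →ₗ[k] C.bim) →ₗ[k] C.bim.kTensor D.bim →ₗ[k] C.bim.kTensor D.bim :=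
  LinearMap.rTensorHom D.bim

theorem onFirst_comp (r s : C.bim →ₗ[k] C.bim) :
    onFirst C D (r ∘ₗ s) = onFirst C D r ∘ₗ onFirst C D s :=
  kTensor_ext fun _ _ => rfl

theorem kMapLin'_id (r : C.bim →ₗ[k] C.bim) :
    kMapLin' (M := C.bim) (M' := D.bim) (N := C.bim) (N' := D.bim) r LinearMap.id =
      onFirst C D r :=
  kTensor_ext fun _ _ => rfl

theorem onFirst_mem_homs (r : C.bim →ₗ[k] C.bim) :
    onFirst C D r ∈ LeftComodule.homs (copies C D) (copies C D) := by
  let h : Hom (C.bim.kTensor D.bim).resRight (C.bim.kTensor D.bim).resRight :=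
    { toLin := onFirst C D r
      map_left := fun b x => LinearMap.congr_fun (kTensor_ext
        (f := onFirst C D r ∘ₗ lAct (C.bim.kTensor D.bim) (1 ⊗ₜ b))
        (g := lAct (C.bim.kTensor D.bim) (1 ⊗ₜ b) ∘ₗ onFirst C D r) fun c d => by
          refine (congrArg (onFirst C D r)
            (left_smul_ktmul (1 : A) b c d)).trans
              (Eq.trans ?_ (left_smul_ktmul (1 : A) b (r c) d).symm)
          rw [one_smul, one_smul]
          rfl) x
      map_right := fun c x => by
        rw [op_base_smul, op_base_smul]
        exact map_smul (onFirst C D r) c x }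
  refine ⟨⟨h, fun x => LinearMap.congr_fun (kTensor_ext
    (f := copyCoact C D ∘ₗ onFirst C D r)
    (g := (map (Hom.id D.bim) h).toLin ∘ₗ copyCoact C D) fun c d => ?_) x⟩, rfl⟩
  exact LinearMap.congr_fun (tensor_ext
    (f := (copyMap C D).flip (r c))
    (g := (map (Hom.id D.bim) h).toLin ∘ₗ (copyMap C D).flip c) fun _ _ => rfl) (D.comul d)

theorem klift_mem_homs {f : C.bim →ₗ[k] D.bim →ₗ[k] C.bim.kTensor D.bim}
    (hf : ∀ c, f c ∈ LeftComodule.homs (LeftComodule.self D) (copies C D)) :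
    (klift f : C.bim.kTensor D.bim →ₗ[k] C.bim.kTensor D.bim) ∈
      LeftComodule.homs (copies C D) (copies C D) := by
  let h : Hom (C.bim.kTensor D.bim).resRight (C.bim.kTensor D.bim).resRight :=
    { toLin := klift f
      map_left := fun b x => LinearMap.congr_fun (kTensor_ext
        (f := klift f ∘ₗ lAct (C.bim.kTensor D.bim) (1 ⊗ₜ b))
        (g := lAct (C.bim.kTensor D.bim) (1 ⊗ₜ b) ∘ₗ klift f) fun c d => by
          refine (congrArg (klift f) (left_smul_ktmul (1 : A) b c d)).trans ?_
          rw [one_smul]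
          obtain ⟨g, hg⟩ := hf c
          change f c (b • d) = ((1 : A) ⊗ₜ[k] b) • f c d
          rw [← hg]
          exact g.toHom.map_left b d) x
      map_right := fun c x => by
        rw [op_base_smul, op_base_smul]
        exact map_smul (klift f) c x }
  refine ⟨⟨h, fun x => LinearMap.congr_fun (kTensor_ext
    (f := copyCoact C D ∘ₗ klift f)
    (g := (map (Hom.id D.bim) h).toLin ∘ₗ copyCoact C D) fun c d => ?_) x⟩, rfl⟩
  obtain ⟨g, hg⟩ := hf c
  change copyCoact C D (f c d) = _
  rw [← hg]
  refine (g.colinear d).trans ?_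
  exact LinearMap.congr_fun (tensor_ext
    (f := (map (Hom.id D.bim) g.toHom).toLin ∘ₗ tensorToLeft D.bim D.bim)
    (g := (map (Hom.id D.bim) h).toLin ∘ₗ (copyMap C D).flip c) fun d d' =>
      congrArg (tmulBilin D.bim (C.bim.kTensor D.bim).resRight d)
        (LinearMap.congr_fun hg d')) (D.comul d)

/-- The kernel is the image of the `D`-colinear map `1 - p`, hence a `D`-subcomodule; commutation
with the operators `r` gives stability under the first factor. -/
theorem isLeftSub_of_projection (hC : C.bim.HasLocalDual)
    {p : C.bim.kTensor D.bim →ₗ[k] C.bim.kTensor D.bim}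
    (hp : p ∈ LeftComodule.homs (copies C D) (copies C D)) (hpp : ∀ x, p (p x) = p x)
    (hpr : ∀ r, C.IsRightColinear r → ∀ x, p (onFirst C D r x) = onFirst C D r (p x))
    {K : Submodule k (C.bim.kTensor D.bim)} (hK : ∀ x, x ∈ K ↔ p x = 0) :
    (C.tensor D).IsLeftSub K := by
  obtain ⟨h, hh⟩ := Submodule.sub_mem _ (LeftComodule.id_mem_homs (copies C D)) hp
  have hh' : ∀ x : C.bim.kTensor D.bim, (h.toHom x : C.bim.kTensor D.bim) = x - p x :=
    fun x => LinearMap.congr_fun hh x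
  refine isLeftSub_tensor hC (fun r hr n hn => ?_) (fun b n hn => ?_) fun n hn => ?_
  · rw [hK] at hn ⊢
    rw [kMapLin'_id, hpr r hr, hn, map_zero]
  · rw [hK] at hn ⊢
    obtain ⟨g, hg⟩ := hp
    rw [← hg] at hn ⊢
    exact (g.toHom.map_left b n).trans ((congrArg (lAct (C.bim.kTensor D.bim) (1 ⊗ₜ b)) hn).trans
      (map_zero (lAct (C.bim.kTensor D.bim) (1 ⊗ₜ b))))
  · have hn' : h.toHom n = n := (hh' n).trans (by rw [(hK n).1 hn, sub_zero])
    rw [← hn']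
    refine h.map_mem_tensorRange (P := Set.univ) (P' := K.carrier) (fun x _ => ?_)
      (by rw [tensorRange_univ]; exact Submodule.mem_top)
    have h0 : ∀ x : C.bim.kTensor D.bim, p (x - p x) = 0 := fun x => by
      rw [map_sub, hpp, sub_self]
    exact (hK _).2 ((congrArg p (hh' x)).trans (h0 x))

/-- The average `q(c ⊗ d) = ∑ π(c₁ xᵢ ⊗ -) p(yᵢ c₂ ⊗ d)` keeps `D`-colinearity and the image `N`,
and it commutes with the endomorphisms of the right comodule `C` by left colinearity of `π`. The
Casimir element is needed because `p` is not `A`-linear, so the unaveraged formula is not defined on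
`C ⊗_A C`. -/
theorem IsCoseparable.exists_isCompl_of_projection (hA : HasCasimir k A)
    (hCd : C.bim.HasLocalDual) (hC : C.IsCoseparable) {N : Submodule k (C.bim.kTensor D.bim)} (hN : (C.tensor D).IsLeftSub N)
    {p : C.bim.kTensor D.bim →ₗ[k] C.bim.kTensor D.bim}
    (hp : p ∈ LeftComodule.homs (copies C D) (copies C D)) (hpN : ∀ x, p x ∈ N)
    (hpn : ∀ n ∈ N, p n = n) :
    ∃ N', (C.tensor D).IsLeftSub N' ∧ IsCompl N N' := by
  classical
  obtain ⟨l, x, y, hxy, hcas⟩ := hA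
  obtain ⟨π, hπ1, hπ2, hπ3⟩ := hC
  have hNr : ∀ r, C.IsRightColinear r → ∀ n ∈ N, onFirst C D r n ∈ N := by
    intro r hr n hn
    rw [← kMapLin'_id]
    exact hN.apply_mem (hr.tensor isRightColinear_id) hn
  let F : C.bim →ₗ[k] C.bim →ₗ[k] D.bim →ₗ[k] C.bim.kTensor D.bim :=
    (LinearMap.llcomp k D.bim (C.bim.kTensor D.bim) (C.bim.kTensor D.bim)).compl₁₂
      (onFirst C D ∘ₗ (tmulBilin C.bim C.bim).compr₂ π.toLin)
      (LinearMap.llcomp k D.bim (C.bim.kTensor D.bim) (C.bim.kTensor D.bim) p ∘ₗ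
        ktmulBilin C.bim D.bim)
  let πr : C.bim → C.bim →ₗ[k] C.bim := fun c => π.toLin ∘ₗ tmulBilin C.bim C.bim c
  have hF : ∀ c c' d, F c c' d = onFirst C D (πr c) (p (ktmul c' d)) :=
    fun _ _ _ => rfl
  have hFhom : ∀ c c', F c c' ∈ LeftComodule.homs (LeftComodule.self D) (copies C D) :=
    fun c c' => LeftComodule.comp_mem_homs (onFirst_mem_homs (πr c))
      (LeftComodule.comp_mem_homs hp ⟨copyHom C D c', rfl⟩)
  obtain ⟨Ψ, hΨ⟩ := exists_lift_of_casimir hcas F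
  have hΨhom : ∀ s, Ψ s ∈ LeftComodule.homs (LeftComodule.self D) (copies C D) := by
    intro s
    induction s using tensor_induction with
    | zero => rw [map_zero]; exact Submodule.zero_mem _
    | add s t hs ht => rw [map_add]; exact Submodule.add_mem _ hs ht
    | tmul c c' => rw [hΨ]; exact Submodule.sum_mem _ fun i _ => hFhom _ _
  let q : C.bim.kTensor D.bim →ₗ[k] C.bim.kTensor D.bim := klift (Ψ ∘ₗ C.comul.toLin)
  have hq : ∀ c d, q (ktmul c d) = Ψ (C.comul c) d := fun _ _ => rfl
  have hqhom : q ∈ LeftComodule.homs (copies C D) (copies C D) := klift_mem_homs fun c => hΨhom _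
  have hqN : ∀ z, q z ∈ N := by
    intro z
    induction z using kTensor_induction with
    | zero => rw [map_zero]; exact N.zero_mem
    | add z w hz hw => rw [map_add]; exact N.add_mem hz hw
    | ktmul c d =>
      rw [hq]
      generalize C.comul c = s
      induction s using tensor_induction with
      | zero => rw [map_zero]; exact N.zero_mem
      | add s t hs ht => rw [map_add]; exact N.add_mem hs ht
      | tmul c c' =>
        rw [hΨ, LinearMap.sum_apply]
        exact Submodule.sum_mem _ fun i _ => hNr _ (isRightColinear_of_bicolinear hπ2 _) _ (hpN _)
  -- On `N` the projection can be dropped, since the operators `y_t rⱼ` on the first factor preserve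
  -- `N`. What remains on the first factor is `∑ π(eⱼ x_t y_t ⊗ rⱼ c) = π(Δ c) = c`.
  have hqn : ∀ n ∈ N, q n = n := by
    intro n hn
    obtain ⟨m, c, d, hcd⟩ := exists_sum_ktmul (M := C.bim) (M' := D.bim) n
    obtain ⟨l', e, r, hr, he⟩ := exists_comul_eq_sum hCd (Finset.univ.image c)
    have he' := fun i => he (c i) (Finset.mem_image_of_mem _ (Finset.mem_univ i))
    have h1 : q n = ∑ j, ∑ t, onFirst C D (πr (op (x t) • e j))
        (p (onFirst C D (lAct C.bim (y t)) (onFirst C D (r j) n))) := by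
      conv_lhs => rw [hcd, map_sum]
      conv_rhs => rw [hcd]
      simp only [map_sum]
      have h2 : ∀ i, q (ktmul (c i) (d i)) = ∑ j, ∑ t, F (op (x t) • e j) (y t • r j (c i)) (d i) := by
        intro i
        rw [hq, he', map_sum, LinearMap.sum_apply]
        refine Finset.sum_congr rfl fun j _ => ?_
        rw [hΨ, LinearMap.sum_apply]
      rw [Finset.sum_congr rfl fun i _ => h2 i, Finset.sum_comm]
      refine Finset.sum_congr rfl fun j _ => ?_
      rw [Finset.sum_comm]
      rfl
    have h3 : ∀ j t, p (onFirst C D (lAct C.bim (y t))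
        (onFirst C D (r j) n)) = onFirst C D (lAct C.bim (y t))
        (onFirst C D (r j) n) := fun j t =>
      hpn _ (hNr _ (isRightColinear_lAct _) _ (hNr _ (hr j) n hn))
    rw [h1, Finset.sum_congr rfl fun j _ => Finset.sum_congr rfl fun t _ => by rw [h3]]
    conv_rhs => rw [hcd]
    conv_lhs => rw [hcd]
    simp only [map_sum]
    rw [Finset.sum_congr rfl fun j _ => Finset.sum_comm, Finset.sum_comm]
    refine Finset.sum_congr rfl fun i _ => ?_
    have h4 : c i = ∑ j, ∑ t, π (tmul (op (x t) • e j) (y t • r j (c i))) := by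
      conv_lhs => rw [← hπ3 (c i), he', map_sum]
      refine Finset.sum_congr rfl fun j _ => ?_
      rw [← map_sum]
      refine congrArg π ?_
      have h5 : ∀ t, tmul (op (x t) • e j) (y t • r j (c i)) = tmul (e j) ((x t * y t) • r j (c i)) :=
        fun t => by rw [smul_tmul, mul_smul]
      rw [Finset.sum_congr rfl fun t _ => h5 t, ← tmul_sum, ← Finset.sum_smul, hxy, one_smul]
    conv_rhs => rw [h4]
    exact Eq.symm ((map_sum ((ktmulBilin C.bim D.bim).flip (d i)) _ _).trans
      (Finset.sum_congr rfl fun j _ => map_sum ((ktmulBilin C.bim D.bim).flip (d i)) _ _))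
  have hqr : ∀ r, C.IsRightColinear r → ∀ z,
      q (onFirst C D r z) = onFirst C D r (q z) := by
    intro r hr z
    have hΨr : ∀ s, Ψ (mapLeft r hr.1 C.bim s) = onFirst C D r ∘ₗ Ψ s := fun s =>
      LinearMap.congr_fun (tensor_ext (f := Ψ ∘ₗ mapLeft r hr.1 C.bim)
        (g := LinearMap.llcomp k D.bim _ _ (onFirst C D r) ∘ₗ Ψ) fun c c' => by
          change Ψ (tmul (r c) c') = onFirst C D r ∘ₗ Ψ (tmul c c')
          rw [hΨ, hΨ]
          refine LinearMap.ext fun d => ?_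
          rw [LinearMap.sum_apply, LinearMap.comp_apply, LinearMap.sum_apply, map_sum]
          refine Finset.sum_congr rfl fun i _ => ?_
          rw [hF, hF, ← hr.1]
          have h1 : πr (r (op (x i) • c)) = r ∘ₗ πr (op (x i) • c) :=
            LinearMap.ext fun c' => apply_of_bicolinear hπ1 hr _ c'
          rw [h1, onFirst_comp]
          rfl) s
    refine LinearMap.congr_fun (kTensor_ext (f := q ∘ₗ onFirst C D r)
      (g := onFirst C D r ∘ₗ q) fun c d => ?_) z
    change Ψ (C.comul (r c)) d = onFirst C D r (Ψ (C.comul c) d)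
    rw [hr.2, hΨr]
    rfl
  let K : Submodule k (C.bim.kTensor D.bim) := LinearMap.ker q
  have hK : ∀ z, z ∈ K ↔ q z = 0 := fun z => Iff.rfl
  have hNK : IsCompl N K := by
    refine ⟨Submodule.disjoint_def.2 fun n hn hn' => ?_,
      codisjoint_iff.2 (top_le_iff.1 fun z _ => ?_)⟩
    · rw [← hqn n hn]
      exact hn'
    · refine Submodule.mem_sup.2 ⟨q z, hqN z, z - q z, ?_, add_sub_cancel _ _⟩
      rw [hK, map_sub, hqn _ (hqN z), sub_self]
  exact ⟨K, isLeftSub_of_projection hCd hqhom (fun z => hqn _ (hqN z)) hqr hK, hNK⟩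

end

section

variable {k A B : Type u} [Field k] [Ring A] [Algebra k A] [Ring B] [Algebra k B]
  {C : Coring k A} {D : Coring k B}

theorem IsCoseparable.tensor_isSemisimple (hA : HasCasimir k A) (hC : C.IsCoseparable)
    (hD : D.IsSemisimple) : (C.tensor D).IsSemisimple := by
  have hCd : C.bim.HasLocalDual := hA.hasLocalDual C.bim
  refine isSemisimple_iff.2 ⟨hCd.kTensor_isRightFlat hD.2, fun N hN => ?_⟩
  let P : Submodule B (copies C D).obj :=
    { carrier := N.carrier
      add_mem' := N.add_mem
      zero_mem' := N.zero_mem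
      smul_mem' := fun b n hn => hN.1 ((1 : A) ⊗ₜ[k] b) n hn }
  have hP : (copies C D).IsSub P := fun n hn => hN.copyCoact_mem hn
  obtain ⟨Q, hQ, hPQ⟩ := copies_exists_isCompl hD hP
  obtain ⟨p, hp, hpN, hpn⟩ := hP.exists_projection hQ hPQ
  exact hC.exists_isCompl_of_projection hA hCd hN hp hpN hpn

end

end Coring

/-! ### Trivial corings of fields; coseparable corings are semisimple. -/

open Bimodule

namespace Coring

section

variable {k : Type u} [CommRing k]

/-- A left subcomodule is in particular an ideal of the field `K`, hence `⊥` or `⊤`. -/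
theorem trivial_isSemisimple (K : Type u) [Field K] [Algebra k K] :
    (trivial k K).IsSemisimple := by
  refine isSemisimple_iff.2 ⟨HasLocalDual.isRightFlat (hasLocalDual_regular (k := k) (A := K)),
    fun N hN => ?_⟩
  by_cases h : N = ⊥
  · subst h
    refine ⟨⊤, ⟨fun _ _ _ => Submodule.mem_top, fun n _ => ?_⟩, isCompl_bot_top⟩
    rw [Submodule.top_coe, tensorRange_univ]
    exact Submodule.mem_top
  · obtain ⟨x, hx, hx0⟩ := Submodule.exists_mem_ne_zero_of_ne_bot h
    have hN' : N = ⊤ := top_le_iff.1 fun y _ => by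
      have h1 : ((show K from y) * (show K from x)⁻¹) * (show K from x) = (show K from y) :=
        inv_mul_cancel_right₀ hx0 _
      have h2 := hN.1 ((show K from y) * (show K from x)⁻¹) x hx
      exact (show (((show K from y) * (show K from x)⁻¹) • x : (trivial k K).bim) = y from h1) ▸ h2
    subst hN'
    refine ⟨⊥, ⟨fun a n hn => ?_, fun n hn => ?_⟩, isCompl_top_bot⟩
    · rw [Submodule.mem_bot] at hn ⊢
      rw [hn, smul_zero]
    · rw [Submodule.mem_bot] at hn
      rw [hn, map_zero]
      exact Submodule.zero_mem _

end

section

variable {k A : Type u} [Field k] [Ring A] [Algebra k A] {C : Coring k A}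

/-- Removes the factor `k` in `C ⊗_k k`, so that semisimplicity of a coseparable coring becomes the
case `D = k` of the product theorem. -/
theorem IsSemisimple.of_tensor_trivial (hC : C.bim.HasLocalDual)
    (h : (C.tensor (trivial k k)).IsSemisimple) : C.IsSemisimple := by
  refine isSemisimple_iff.2 ⟨hC.isRightFlat, fun N hN => ?_⟩
  let e : C.bim ≃ₗ[k] C.bim.kTensor (regular k k) := (TensorProduct.rid k C.bim).symm
  have h1 : (C.tensor (trivial k k)).IsLeftSub (N.map e.toLinearMap) := by
    refine isLeftSub_tensor_of_stable (D := trivial k k) hC hasLocalDual_regular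
      (fun r hr n hn => ?_) (fun s hs n hn => ?_)
    · obtain ⟨n, hn, rfl⟩ := hn
      exact ⟨r n, hN.apply_mem hr hn, rfl⟩
    · obtain ⟨n, hn, rfl⟩ := hn
      -- A `k`-linear endomorphism of `k` is multiplication by its value at `1`.
      let z : k := s (1 : k)
      refine ⟨z • n, N.smul_mem z hn, ?_⟩
      exact (TensorProduct.smul_tmul (R := k) z n (1 : k)).trans
        (congrArg (fun z : k => n ⊗ₜ[k] z) (mul_one z))
  obtain ⟨N', hN', hc⟩ := (isSemisimple_iff.1 h).2 _ h1
  let N'' : Submodule k (C.bim.kTensor (regular k k)) := N'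
  have hc' : IsCompl (N.map e.toLinearMap) N'' := hc
  refine ⟨N''.comap e.toLinearMap, isLeftSub_of_stable hC fun r hr n hn => ?_, ?_⟩
  · exact hN'.apply_mem (hr.tensor isRightColinear_id) hn
  · have := (Submodule.orderIsoMapComap e).symm.isCompl hc'
    have h2 : (Submodule.orderIsoMapComap e).symm (N.map e.toLinearMap) = N :=
      (Submodule.orderIsoMapComap e).symm_apply_apply N
    rw [h2] at this
    exact this

theorem IsCoseparable.isSemisimple (hA : HasCasimir k A) (hC : C.IsCoseparable) :
    C.IsSemisimple :=
  .of_tensor_trivial (hA.hasLocalDual C.bim) (hC.tensor_isSemisimple hA (trivial_isSemisimple k))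

end

/-! ### Operators on `C ⊗_k D`, and coseparability from `C ⊗_k C°`. -/

section Retraction

variable {k A B : Type u} [Field k] [Ring A] [Algebra k A] [Ring B] [Algebra k B]
  {C : Coring k A} {D : Coring k B}

/-- The endomorphisms of the right comodule `C`. -/
abbrev RightEnd {k A : Type u} [CommRing k] [Ring A] [Algebra k A] (C : Coring k A) : Type u :=
  {r : C.bim →ₗ[k] C.bim // C.IsRightColinear r}

/-- The endomorphisms of `C` and `D` acting on `C ⊗_k D`. -/
noncomputable def kTensorOps (C : Coring k A) (D : Coring k B) :
    C.RightEnd ⊕ D.RightEnd → Module.End k (C.bim.kTensor D.bim) :=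
  Sum.elim (fun r => kMapLin' (M := C.bim) (M' := D.bim) r.1 LinearMap.id)
    (fun s => kMapLin' (M := C.bim) (M' := D.bim) LinearMap.id s.1)

theorem IsSemisimple.stableComplemented (hC : C.bim.HasLocalDual) (hD : D.bim.HasLocalDual)
    (h : (C.tensor D).IsSemisimple) : StableComplemented (kTensorOps C D) := by
  intro N hN
  obtain ⟨N', hN', hc⟩ := (isSemisimple_iff.1 h).2 N (isLeftSub_tensor_of_stable hC hD
    (fun r hr n hn => hN (.inl ⟨r, hr⟩) n hn) (fun s hs n hn => hN (.inr ⟨s, hs⟩) n hn))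
  refine ⟨N', fun i n hn => ?_, hc⟩
  rcases i with r | s
  · exact hN'.apply_mem (r.2.tensor isRightColinear_id) hn
  · exact hN'.apply_mem (isRightColinear_id.tensor s.2) hn

end Retraction

section Left

variable {k A : Type u} [CommRing k] [Ring A] [Algebra k A] {C : Coring k A}

theorem IsRightColinear.isLeftLinear {l : C.bim →ₗ[k] C.bim} (hl : C.opposite.IsRightColinear l) :
    IsLeftLinear (N := C.bim) (N' := C.bim) l := fun a m => hl.1 (op a) m

theorem IsRightColinear.comul_apply {l : C.bim →ₗ[k] C.bim} (hl : C.opposite.IsRightColinear l)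
    (c : C.bim) : C.comul (l c) = mapRight C.bim l hl.isLeftLinear (C.comul c) := by
  rw [← swapInv_comul, ← swapInv_comul]
  refine (congrArg C.swapInv (hl.2 c)).trans ?_
  exact LinearMap.congr_fun (tensor_ext (M := C.bim.opp) (N := C.bim.opp)
    (f := C.swapInv ∘ₗ mapLeft (M := C.bim.opp) (M' := C.bim.opp) l hl.1 C.bim.opp)
    (g := mapRight C.bim l hl.isLeftLinear ∘ₗ C.swapInv) fun _ _ => rfl) (C.opposite.comul c)

/-- Since `l` acts only on the second leg of `Δ` and is left linear, `r(l c) = f(c₁) l(c₂) = l(f(c₁)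
c₂)`. -/
theorem IsRightColinear.commute {r l : C.bim →ₗ[k] C.bim} (hr : C.IsRightColinear r)
    (hl : C.opposite.IsRightColinear l) (c : C.bim) : r (l c) = l (r c) := by
  obtain ⟨f, hf, h⟩ := hr.eq_contract
  rw [h, h, hl.comul_apply]
  exact LinearMap.congr_fun (tensor_ext (f := contract f hf C.bim ∘ₗ
    mapRight C.bim l hl.isLeftLinear) (g := l ∘ₗ contract f hf C.bim)
    fun c c' => (hl.isLeftLinear (f c) c').symm) (C.comul c)

theorem comul_injective : Function.Injective C.comul := fun c c' h => by
  rw [← C.lid_counit c, ← C.lid_counit c', h]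

/-- Endomorphisms of the right and of the left comodule `C` acting on `C ⊗_A C`. -/
def tensorBiOps (C : Coring k A) :
    C.RightEnd ⊕ C.opposite.RightEnd → (C.bim.tensor C.bim →ₗ[k] C.bim.tensor C.bim) :=
  Sum.elim (fun r => mapLeft r.1 r.2.1 C.bim) (fun l => mapRight C.bim l.1 l.2.isLeftLinear)

/-- Endomorphisms of the right and of the left comodule `C` acting on `C`. -/
def biOps (C : Coring k A) : C.RightEnd ⊕ C.opposite.RightEnd → (C.bim →ₗ[k] C.bim) :=
  Sum.elim (fun r => r.1) (fun l => l.1)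

theorem comul_biOps (i : C.RightEnd ⊕ C.opposite.RightEnd) (c : C.bim) :
    C.comul (C.biOps i c) = C.tensorBiOps i (C.comul c) := by
  rcases i with r | l
  · exact r.2.2 c
  · exact l.2.comul_apply c

theorem isCoseparable_of_biOps (hC : C.bim.HasLocalDual) (hC' : C.opposite.bim.HasLocalDual)
    (π : C.bim.tensor C.bim →ₗ[k] C.bim) (h1 : ∀ i x, π (C.tensorBiOps i x) = C.biOps i (π x))
    (h2 : ∀ c, π (C.comul c) = c) : C.IsCoseparable :=
  isCoseparable_of_retraction hC hC' π (fun r hr c c' => h1 (.inl ⟨r, hr⟩) (tmul c c'))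
    (fun l hl c c' => h1 (.inr ⟨l, hl⟩) (tmul c c')) h2

end Left

/-- An endomorphism of the right comodule `C°` is one of the left comodule `C`. So the operators on
`C ⊗_k C°` cover both families acting on the quotient `C ⊗_A C`, where `Δ` is an equivariant
embedding. -/
theorem isCoseparable_of_tensor_opposite {k A : Type u} [Field k] [Ring A] [Algebra k A]
    {C : Coring k A} (hC : C.bim.HasLocalDual) (hC' : C.opposite.bim.HasLocalDual)
    (h : (C.tensor C.opposite).IsSemisimple) : C.IsCoseparable := by
  let q : C.bim.kTensor C.opposite.bim →ₗ[k] C.bim.tensor C.bim :=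
    klift (M' := C.opposite.bim) (tmulBilin C.bim C.bim)
  have hq : Function.Surjective q := fun x => by
    induction x using tensor_induction with
    | zero => exact ⟨0, map_zero q⟩
    | add x y hx hy =>
      obtain ⟨x, rfl⟩ := hx
      obtain ⟨y, rfl⟩ := hy
      exact ⟨x + y, map_add q x y⟩
    | tmul c c' => exact ⟨ktmul (M' := C.opposite.bim) c c', rfl⟩
  have hqa : ∀ i x, q (kTensorOps C C.opposite i x) = C.tensorBiOps i (q x) := by
    intro i x
    refine LinearMap.congr_fun (kTensor_ext (M := C.bim) (M' := C.opposite.bim)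
      (f := q ∘ₗ kTensorOps C C.opposite i) (g := C.tensorBiOps i ∘ₗ q) fun c c' => ?_) x
    rcases i with r | l
    · rfl
    · rfl
  obtain ⟨p, hp1, hp2⟩ := (h.stableComplemented hC hC').exists_retraction hq hqa
    (j := C.comul.toLin) comul_injective comul_biOps
  exact isCoseparable_of_biOps hC hC' p hp2 hp1

end Coring

open Bimodule

/-! ### Extension of scalars: operators on `K ⊗_k C`. -/

namespace Coring

section BaseChange

variable {k A : Type u} [Field k] [Ring A] [Algebra k A] {C : Coring k A}

/-- The endomorphisms of the right comodule `C`, acting on `K ⊗_k C`. -/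
noncomputable def rightOps (C : Coring k A) (K : Type u) [Field K] [Algebra k K] :
    C.RightEnd → Module.End K (K ⊗[k] C.bim) :=
  fun r => LinearMap.baseChange K r.1

/-- The endomorphisms of the left comodule `C`, acting on `K ⊗_k C`. -/
noncomputable def leftOps (C : Coring k A) (K : Type u) [Field K] [Algebra k K] :
    C.opposite.RightEnd → Module.End K (K ⊗[k] C.bim) :=
  fun l => LinearMap.baseChange K (M := C.bim) (N := C.bim) l.1

variable {K : Type u} [Field K] [Algebra k K]

theorem baseChange_ext {M N : Type*} [AddCommGroup M] [Module k M] [AddCommGroup N] [Module K N]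
    {f g : K ⊗[k] M →ₗ[K] N} (h : ∀ m, f (1 ⊗ₜ m) = g (1 ⊗ₜ m)) : f = g := by
  refine LinearMap.ext fun x => ?_
  induction x using TensorProduct.induction_on with
  | zero => rw [map_zero, map_zero]
  | add x y hx hy => rw [map_add, map_add, hx, hy]
  | tmul c m =>
    have : c ⊗ₜ[k] m = c • ((1 : K) ⊗ₜ[k] m) := by
      rw [TensorProduct.smul_tmul', smul_eq_mul, mul_one]
    rw [this, map_smul, map_smul, h]

theorem commute_rightOps_leftOps (r : C.RightEnd) (l : C.opposite.RightEnd) :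
    Commute (C.rightOps K r) (C.leftOps K l) :=
  baseChange_ext fun c => congrArg (fun c : C.bim => (1 : K) ⊗ₜ[k] c) (r.2.commute l.2 c)

/-- Endomorphisms of the trivial coring `K` are the multiplications by elements of `K`, so stability
under the second family of operators on `C ⊗ K` means being a `K`-subspace. -/
theorem stableComplemented_rightOps (hC : C.bim.HasLocalDual)
    (h : (C.tensor (trivial k K)).IsSemisimple) : StableComplemented (C.rightOps K) := by
  intro N hN
  let e : K ⊗[k] C.bim ≃ₗ[k] C.bim.kTensor (regular k K) := TensorProduct.comm k K C.bim
  have hr : ∀ (r : C.RightEnd) (x : K ⊗[k] C.bim),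
      kTensorOps C (trivial k K) (.inl r) (e x) = e (C.rightOps K r x) := fun r x =>
    LinearMap.congr_fun (TensorProduct.ext' (M := K) (N := C.bim)
      (g := kTensorOps C (trivial k K) (.inl r) ∘ₗ e.toLinearMap)
      (h := e.toLinearMap ∘ₗ (C.rightOps K r).restrictScalars k) fun _ _ => rfl) x
  let ev : (trivial k K).RightEnd → K := fun s => s.1 (1 : K)
  have hs : ∀ (s : (trivial k K).RightEnd) (x : K ⊗[k] C.bim),
      kTensorOps C (trivial k K) (.inr s) (e x) = e (ev s • x) := fun s x =>
    LinearMap.congr_fun (TensorProduct.ext' (M := K) (N := C.bim)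
      (g := kTensorOps C (trivial k K) (.inr s) ∘ₗ e.toLinearMap)
      (h := e.toLinearMap ∘ₗ (Algebra.lsmul k k (K ⊗[k] C.bim) (ev s)))
      fun x c => by
        refine congrArg (ktmul (M' := regular k K) c) ?_
        refine Eq.trans ?_ (s.2.1 x (1 : K))
        exact congrArg s.1 (one_mul x).symm) x
  have hmul : ∀ z : K, (trivial k K).IsRightColinear (lAct (regular k K) z) :=
    fun z => isRightColinear_lAct (C := trivial k K) z
  let N₁ : Submodule k (C.bim.kTensor (trivial k K).bim) :=
    (N.restrictScalars k).map e.toLinearMap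
  obtain ⟨N', hN', hc⟩ := h.stableComplemented (D := trivial k K) hC hasLocalDual_regular N₁ (by
    rintro (r | s) _ ⟨n, hn, rfl⟩
    · exact ⟨_, hN r n hn, (hr r n).symm⟩
    · exact ⟨_, N.smul_mem (ev s) hn, (hs s n).symm⟩)
  let N₂ : Submodule K (K ⊗[k] C.bim) :=
    { carrier := {x | e x ∈ N'}
      add_mem' := fun {x y} hx hy => by
        change e (x + y) ∈ N'
        rw [map_add]
        exact N'.add_mem hx hy
      zero_mem' := by
        change e 0 ∈ N'
        rw [map_zero]
        exact N'.zero_mem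
      smul_mem' := fun z x hx => by
        have h1 := hN' (.inr ⟨_, hmul z⟩) _ hx
        rw [hs] at h1
        exact (congrArg (fun w : K => e (w • x) ∈ N') (mul_one z)).mp h1 }
  refine ⟨N₂, fun r x hx => ?_, ?_⟩
  · have h1 := hN' (.inl r) _ hx
    rw [hr] at h1
    exact h1
  · have := (Submodule.orderIsoMapComap e).symm.isCompl hc
    have h2 : (Submodule.orderIsoMapComap e).symm N₁ = N.restrictScalars k :=
      (Submodule.orderIsoMapComap e).symm_apply_apply _
    rw [h2] at this
    exact isCompl_coe (P := N.restrictScalars k) rfl rfl this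

/-- If `Δ c = ∑ mᵢ ⊗ pᵢ`, every `r c = ∑ f(mᵢ) pᵢ` lies in `∑ A pᵢ`, which is finite-dimensional
because `A` is. The orbit of `c` therefore spans a finite-dimensional stable subspace. -/
theorem exists_finiteDimensional_stable [Module.Finite k A] (x : K ⊗[k] C.bim) :
    ∃ V : Submodule K (K ⊗[k] C.bim), FiniteDimensional K V ∧ Stable (C.rightOps K) V ∧ x ∈ V := by
  have key : ∀ c : C.bim, ∃ V : Submodule k C.bim, Module.Finite k V ∧
      (∀ r : C.RightEnd, ∀ v ∈ V, r.1 v ∈ V) ∧ c ∈ V := by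
    intro c
    obtain ⟨n, m, p, hc⟩ := exists_sum_tmul (C.comul c)
    let O : Submodule k C.bim := Submodule.span k (Set.range fun r : C.RightEnd => r.1 c)
    have hO : O ≤ ⨆ i, LinearMap.range ((lAct C.bim).toLinearMap.flip (p i)) := by
      refine Submodule.span_le.2 ?_
      rintro _ ⟨r, rfl⟩
      obtain ⟨f, hf, h⟩ := r.2.eq_contract
      simp only [h, hc, map_sum, contract_tmul]
      exact Submodule.sum_mem _ fun i _ =>
        le_iSup (fun i => LinearMap.range ((lAct C.bim).toLinearMap.flip (p i))) i ⟨f (m i), rfl⟩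
    refine ⟨O, Submodule.finiteDimensional_of_le hO, fun r v hv => ?_,
      Submodule.subset_span ⟨⟨LinearMap.id, isRightColinear_id⟩, rfl⟩⟩
    refine Submodule.span_le (p := O.comap r.1).2 ?_ hv
    rintro _ ⟨s, rfl⟩
    refine Submodule.subset_span ⟨⟨r.1 ∘ₗ s.1, ?_⟩, rfl⟩
    refine ⟨fun a c => (congrArg r.1 (s.2.1 a c)).trans (r.2.1 a _), fun c => ?_⟩
    refine (r.2.2 (s.1 c)).trans ((congrArg _ (s.2.2 c)).trans ?_)
    exact LinearMap.congr_fun (tensor_ext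
      (f := mapLeft r.1 r.2.1 C.bim ∘ₗ mapLeft s.1 s.2.1 C.bim)
      (g := mapLeft (r.1 ∘ₗ s.1) _ C.bim) fun _ _ => rfl) (C.comul c)
  induction x using TensorProduct.induction_on with
  | zero => exact ⟨⊥, inferInstance, fun i n hn => by
      rw [(Submodule.mem_bot K).1 hn, map_zero]; exact Submodule.zero_mem _, Submodule.zero_mem _⟩
  | add x y hx hy =>
    obtain ⟨V, hV1, hV2, hV3⟩ := hx
    obtain ⟨W, hW1, hW2, hW3⟩ := hy
    refine ⟨V ⊔ W, inferInstance, fun i n hn => ?_, Submodule.add_mem_sup hV3 hW3⟩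
    obtain ⟨v, hv, w, hw, rfl⟩ := Submodule.mem_sup.1 hn
    rw [map_add]
    exact Submodule.add_mem_sup (hV2 i v hv) (hW2 i w hw)
  | tmul z c =>
    obtain ⟨V, hV1, hV2, hV3⟩ := key c
    refine ⟨LinearMap.range (LinearMap.baseChange K V.subtype), inferInstance, ?_,
      ⟨z ⊗ₜ ⟨c, hV3⟩, rfl⟩⟩
    rintro r _ ⟨v, rfl⟩
    exact ⟨LinearMap.baseChange K (r.1.restrict (hV2 r)) v, LinearMap.congr_fun (baseChange_ext
      (f := LinearMap.baseChange K V.subtype ∘ₗ LinearMap.baseChange K (r.1.restrict (hV2 r)))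
      (g := C.rightOps K r ∘ₗ LinearMap.baseChange K V.subtype) fun _ => rfl) v⟩

end BaseChange

end Coring

open Bimodule

/-! ### The commutant over `K`, and descent of the retraction to `k`. -/

namespace Coring

section BaseChange

variable {k A : Type u} [Field k] [Ring A] [Algebra k A] {C : Coring k A}
  {K : Type u} [Field K] [Algebra k K]

/-- The map `c ↦ ((x ⊗ a) ↦ x ⊗ c a)`. -/
noncomputable def baseChangeSMul (C : Coring k A) (K : Type u) [Field K] [Algebra k K] :
    C.bim →ₗ[k] K ⊗[k] A →ₗ[k] K ⊗[k] C.bim :=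
  LinearMap.lTensorHom K ∘ₗ
    ((rAct C.bim).toLinearMap ∘ₗ (opLinearEquiv k : A ≃ₗ[k] Aᵐᵒᵖ).toLinearMap).flip

/-- Right multiplication by an element of `A` is an endomorphism of the left comodule, so `N` is
stable under the right action of `K ⊗ A`. -/
theorem exists_smul_mem {N : Submodule K (K ⊗[k] C.bim)} (hN : Stable (C.leftOps K) N)
    (z : K ⊗[k] A) : ∃ g : K ⊗[k] C.bim →ₗ[K] K ⊗[k] C.bim,
      (∀ c, g (1 ⊗ₜ c) = baseChangeSMul C K c z) ∧ ∀ n ∈ N, g n ∈ N := by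
  induction z using TensorProduct.induction_on with
  | zero => exact ⟨0, fun c => (map_zero _).symm, fun n _ => N.zero_mem⟩
  | add z w hz hw =>
    obtain ⟨g, hg, hg'⟩ := hz
    obtain ⟨h, hh, hh'⟩ := hw
    exact ⟨g + h, fun c => by rw [LinearMap.add_apply, hg, hh, map_add],
      fun n hn => N.add_mem (hg' n hn) (hh' n hn)⟩
  | tmul x a =>
    refine ⟨x • LinearMap.baseChange K (rAct C.bim (op a)), fun c => ?_, fun n hn => ?_⟩
    · rw [LinearMap.smul_apply, LinearMap.baseChange_tmul, TensorProduct.smul_tmul', smul_eq_mul,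
        mul_one]
      rfl
    · exact N.smul_mem x
        (hN ⟨_, isRightColinear_lAct (C := C.opposite) (op a)⟩ n hn)

/-- An operator that commutes with the endomorphisms of the right comodule `C` is determined by its
composition with the counit. -/
theorem apply_eq_of_commute (hC : C.bim.HasLocalDual) {φ : Module.End K (K ⊗[k] C.bim)}
    (hφ : ∀ r, Commute (C.rightOps K r) φ) :
    ∃ F : C.bim.tensor C.bim →ₗ[k] K ⊗[k] C.bim, ∃ η : C.bim →ₗ[k] K ⊗[k] A,
      (∀ c c', F (tmul c c') = baseChangeSMul C K c (η c')) ∧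
      ∀ c, φ (1 ⊗ₜ c) = F (C.comul c) := by
  classical
  have hφ' : ∀ (r : C.RightEnd) x, LinearMap.lTensor K r.1 (φ x) = φ (LinearMap.lTensor K r.1 x) :=
    fun r x => LinearMap.congr_fun (hφ r) x
  -- Commutation with left multiplication by `A` makes `η = (1 ⊗ ε) φ(1 ⊗ -)` left `A`-linear, so
  -- that `c₁ η(c₂)` makes sense on `C ⊗_A C`.
  let η : C.bim →ₗ[k] K ⊗[k] A :=
    LinearMap.lTensor K C.counit.toLin ∘ₗ φ.restrictScalars k ∘ₗ TensorProduct.mk k K C.bim 1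
  have hη : ∀ (a : A) c, η (a • c) = LinearMap.lTensor K (LinearMap.mulLeft k a) (η c) := by
    intro a c
    have h1 := hφ' ⟨_, isRightColinear_lAct a⟩ (1 ⊗ₜ c)
    change LinearMap.lTensor K C.counit.toLin (φ (1 ⊗ₜ (a • c))) = _
    refine (congrArg (LinearMap.lTensor K C.counit.toLin) h1.symm).trans ?_
    exact LinearMap.congr_fun (TensorProduct.ext'
      (g := LinearMap.lTensor K C.counit.toLin ∘ₗ LinearMap.lTensor K (lAct C.bim a))
      (h := LinearMap.lTensor K (LinearMap.mulLeft k a) ∘ₗ LinearMap.lTensor K C.counit.toLin)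
      fun x c => congrArg (fun a : A => x ⊗ₜ[k] a) (C.counit.map_left a c)) _
  let F : C.bim.tensor C.bim →ₗ[k] K ⊗[k] C.bim :=
    lift ((baseChangeSMul C K).compl₂ η) fun c a c' => by
      change baseChangeSMul C K (op a • c) (η c') = baseChangeSMul C K c (η (a • c'))
      rw [hη]
      exact LinearMap.congr_fun (TensorProduct.ext'
        (g := baseChangeSMul C K (op a • c))
        (h := baseChangeSMul C K c ∘ₗ LinearMap.lTensor K (LinearMap.mulLeft k a))
        fun x b => congrArg (fun c : C.bim => x ⊗ₜ[k] c)
          ((mul_smul (op b) (op a) c).symm)) (η c')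
  refine ⟨F, η, fun _ _ => rfl, fun c => ?_⟩
  obtain ⟨S, hS⟩ := TensorProduct.exists_finset (φ (1 ⊗ₜ c))
  obtain ⟨n, d, r, hr, h⟩ := exists_comul_eq_sum hC (insert c (S.image Prod.snd))
  -- The right counit axiom for the `C`-components of `φ(1 ⊗ c)`. The basis `d` also serves `c`, so
  -- after moving each `r j` through `φ` the sum becomes `c₁ η(c₂)`.
  have h1 : φ (1 ⊗ₜ c) = ∑ j, baseChangeSMul C K (d j)
      (LinearMap.lTensor K C.counit.toLin (LinearMap.lTensor K (r j) (φ (1 ⊗ₜ c)))) := by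
    rw [hS]
    simp only [map_sum]
    rw [Finset.sum_comm]
    refine Finset.sum_congr rfl fun p hp => ?_
    have h2 : p.2 = ∑ j, op (C.counit (r j p.2) : A) • d j := by
      conv_lhs => rw [← C.rid_counit p.2, h _ (Finset.mem_insert_of_mem
        (Finset.mem_image_of_mem _ hp)), map_sum, map_sum]
      rfl
    conv_lhs => rw [h2, TensorProduct.tmul_sum]
    rfl
  rw [h1, h c (Finset.mem_insert_self _ _), map_sum]
  exact Finset.sum_congr rfl fun j _ => congrArg (baseChangeSMul C K (d j))
    (congrArg (LinearMap.lTensor K C.counit.toLin) (hφ' ⟨_, hr j⟩ (1 ⊗ₜ c)))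

/-- Writing `Δ c = ∑ lⱼ c ⊗ dⱼ` with endomorphisms `lⱼ` of the left comodule turns `φ(1 ⊗ c) = c₁
η(c₂)` into `φ n = ∑ (lⱼ n) η(dⱼ)`. Both the operators `lⱼ` and the right action of `K ⊗ A` preserve
`N`. -/
theorem apply_mem_of_commute (hC : C.bim.HasLocalDual) (hC' : C.opposite.bim.HasLocalDual)
    {N : Submodule K (K ⊗[k] C.bim)} (hN : Stable (C.leftOps K) N)
    {φ : Module.End K (K ⊗[k] C.bim)} (hφ : ∀ r, Commute (C.rightOps K r) φ)
    {n : K ⊗[k] C.bim} (hn : n ∈ N) : φ n ∈ N := by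
  classical
  obtain ⟨F, η, hF, hφF⟩ := apply_eq_of_commute hC hφ
  obtain ⟨S, hS⟩ := TensorProduct.exists_finset n
  obtain ⟨m, d, l, hl, h⟩ := exists_comul_eq_sum hC' (S.image Prod.snd)
  choose g hg hgN using fun z => exists_smul_mem hN z
  have key : φ n = ∑ j, g (η (d j)) (C.leftOps K ⟨l j, hl j⟩ n) := by
    rw [hS]
    simp only [map_sum]
    rw [Finset.sum_comm]
    refine Finset.sum_congr rfl fun p hp => ?_
    have hp1 : p.1 ⊗ₜ[k] p.2 = p.1 • ((1 : K) ⊗ₜ[k] p.2) := by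
      rw [TensorProduct.smul_tmul', smul_eq_mul, mul_one]
    have h2 : C.comul p.2 = ∑ j, tmul (M := C.bim) (N := C.bim) (l j p.2) (d j) := by
      rw [← swapInv_comul]
      exact (congrArg C.swapInv (h _ (Finset.mem_image_of_mem _ hp))).trans (map_sum C.swapInv _ _)
    rw [hp1]
    simp only [map_smul]
    rw [hφF, h2, map_sum, Finset.smul_sum]
    refine Finset.sum_congr rfl fun j _ => ?_
    exact congrArg (p.1 • ·) ((hF (l j p.2) (d j)).trans (hg (η (d j)) (l j p.2)).symm)
  rw [key]
  exact N.sum_mem fun j _ => hgN _ _ (hN _ _ hn)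

/-- Stable complements in `X ⊗_K X`, for `X = K ⊗ C`, give an equivariant retraction of `K ⊗ Δ`,
because `K ⊗ (C ⊗_A C)` is an equivariant quotient of `X ⊗_K X`. One algebraically closed `K` is
enough. -/
theorem isCoseparable_of_algebraicClosure [IsAlgClosed K] [Module.Finite k A]
    (hC : C.bim.HasLocalDual) (hC' : C.opposite.bim.HasLocalDual)
    (h : (C.tensor (trivial k K)).IsSemisimple) : C.IsCoseparable := by
  have hsc := (stableComplemented_rightOps hC h).tensorOps
    (fun r l => commute_rightOps_leftOps (C := C) (K := K) r l) exists_finiteDimensional_stable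
    (fun N hN φ hφ n hn => apply_mem_of_commute hC hC' hN hφ hn)
  let q₀ : C.bim ⊗[k] C.bim →ₗ[k] C.bim.tensor C.bim := TensorProduct.lift (tmulBilin C.bim C.bim)
  have hq₀ : Function.Surjective q₀ := fun x => by
    induction x using tensor_induction with
    | zero => exact ⟨0, map_zero q₀⟩
    | add x y hx hy =>
      obtain ⟨x, rfl⟩ := hx
      obtain ⟨y, rfl⟩ := hy
      exact ⟨x + y, map_add q₀ x y⟩
    | tmul c c' => exact ⟨c ⊗ₜ c', rfl⟩
  let δ := TensorProduct.AlgebraTensorModule.distribBaseChange k K C.bim C.bim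
  let q : (K ⊗[k] C.bim) ⊗[K] (K ⊗[k] C.bim) →ₗ[K] K ⊗[k] (C.bim.tensor C.bim) :=
    LinearMap.baseChange K q₀ ∘ₗ δ.symm.toLinearMap
  have hq : Function.Surjective q :=
    (LinearMap.lTensor_surjective K hq₀).comp δ.symm.surjective
  have hqt : ∀ (x : K) c y c', q ((x ⊗ₜ c) ⊗ₜ (y ⊗ₜ c')) = (x * y) ⊗ₜ tmul c c' := fun x c y c' =>
    congrArg (LinearMap.baseChange K q₀)
      (TensorProduct.AlgebraTensorModule.distribBaseChange_symm_tmul k K c c' x y)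
  have hqa : ∀ i x, q (tensorOps (C.rightOps K) (C.leftOps K) i x) =
      LinearMap.baseChange K (C.tensorBiOps i) (q x) := by
    intro i x
    refine LinearMap.congr_fun (TensorProduct.ext (R := K)
      (g := q ∘ₗ tensorOps (C.rightOps K) (C.leftOps K) i)
      (h := LinearMap.baseChange K (C.tensorBiOps i) ∘ₗ q)
      (baseChange_ext fun c => baseChange_ext fun c' => ?_)) x
    rcases i with r | l
    · exact (hqt 1 (r.1 c) 1 c').trans
        (congrArg (LinearMap.baseChange K (C.tensorBiOps (.inl r))) (hqt 1 c 1 c')).symm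
    · exact (hqt 1 c 1 (l.1 c')).trans
        (congrArg (LinearMap.baseChange K (C.tensorBiOps (.inr l))) (hqt 1 c 1 c')).symm
  let j : K ⊗[k] C.bim →ₗ[K] K ⊗[k] (C.bim.tensor C.bim) := LinearMap.baseChange K C.comul.toLin
  have hj : Function.Injective j :=
    Module.Flat.lTensor_preserves_injective_linearMap C.comul.toLin comul_injective
  have hjc : ∀ i z, j (LinearMap.baseChange K (C.biOps i) z) =
      LinearMap.baseChange K (C.tensorBiOps i) (j z) := fun i z =>
    LinearMap.congr_fun (baseChange_ext (f := j ∘ₗ LinearMap.baseChange K (C.biOps i))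
      (g := LinearMap.baseChange K (C.tensorBiOps i) ∘ₗ j) fun c =>
        congrArg (fun s : C.bim.tensor C.bim => (1 : K) ⊗ₜ[k] s) (comul_biOps i c)) z
  obtain ⟨p, hp1, hp2⟩ := hsc.exists_retraction hq hqa hj hjc
  -- Descent: the operators come from `k`, so they commute with `t ⊗ 1`, and composing the
  -- retraction with it keeps equivariance.
  obtain ⟨t, ht⟩ : ∃ t : K →ₗ[k] k, t 1 = 1 := by
    obtain ⟨t, ht⟩ := LinearMap.exists_leftInverse_of_injective (Algebra.linearMap k K)
      (LinearMap.ker_eq_bot.2 (algebraMap k K).injective)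
    exact ⟨t, by simpa using LinearMap.congr_fun ht 1⟩
  let τ : K ⊗[k] C.bim →ₗ[k] C.bim := TensorProduct.lift (LinearMap.lsmul k C.bim ∘ₗ t)
  refine isCoseparable_of_biOps hC hC'
    (τ ∘ₗ p.restrictScalars k ∘ₗ TensorProduct.mk k K (C.bim.tensor C.bim) 1)
    (fun i x => ?_) fun c => ?_
  · change τ (p (1 ⊗ₜ C.tensorBiOps i x)) = C.biOps i (τ (p (1 ⊗ₜ x)))
    refine (congrArg τ (hp2 i (1 ⊗ₜ x))).trans ?_
    exact LinearMap.congr_fun (TensorProduct.ext'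
      (g := τ ∘ₗ (LinearMap.baseChange K (C.biOps i)).restrictScalars k)
      (h := C.biOps i ∘ₗ τ) fun z c => (map_smul (C.biOps i) (t z) c).symm) (p (1 ⊗ₜ x))
  · refine (congrArg τ (hp1 (1 ⊗ₜ c))).trans ?_
    change t 1 • c = c
    rw [ht, one_smul]

end BaseChange

end Coring
end Coseparable

/-! ### The equivalence of the four conditions. -/

theorem mainTheorem1 {k A : Type u} [Field k] [Ring A] [Algebra k A]
    (hA : Coseparable.IsSeparableAlgebra k A) (C : Coseparable.Coring k A) :
    List.TFAE [
      C.IsCoseparable,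
      ∀ (K : Type u) [Field K] [Algebra k K],
        (C.tensor (Coseparable.Coring.trivial k K)).IsSemisimple,
      ∀ (B : Type u) [Ring B] [Algebra k B] (D : Coseparable.Coring k B),
        D.IsSemisimple → (C.tensor D).IsSemisimple,
      (C.tensor C.opposite).IsSemisimple] := by
  have hcas := hA.hasCasimir
  have hC := hcas.hasLocalDual C.bim
  have hC' := hcas.opposite.hasLocalDual C.opposite.bim
  have := hcas.finite
  tfae_have 1 → 3 := fun h B _ _ D hD => h.tensor_isSemisimple hcas hD
  tfae_have 3 → 2 := fun h K _ _ => h K _ (Coseparable.Coring.trivial_isSemisimple K)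
  tfae_have 2 → 1 := fun h =>
    Coseparable.Coring.isCoseparable_of_algebraicClosure hC hC' (h (AlgebraicClosure k))
  tfae_have 1 → 4 := fun h =>
    h.tensor_isSemisimple hcas (h.opposite.isSemisimple hcas.opposite)
  tfae_have 4 → 1 := Coseparable.Coring.isCoseparable_of_tensor_opposite hC hC'
  tfae_finish
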